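/- **Setting.** A \emph{rhombus graph} is an edge-to-edge tiling of the plane $\mathbb C$ by rhombi of side length $1$ whose vertices are coloured white, black or "face" so that each rhombus has one white corner $w$, one black corner $b$ opposite to it, and two face corners. The white–black diagonals are the edges $(b,w)$ of an infinite bipartite isoradial graph. We assume that the rhombus angles are bounded away from $0$ and $\pi$. Sides of rhombi are oriented away from white and towards black vertices. For an edge $(b,w)$ let $e^{i\varphi},e^{i\vartheta}$, $\vartheta-\pi<\varphi<\vartheta$, be the sides leaving $w$ of its rhombus, and put $\overline\partial(b,w)=i(e^{i\vartheta}-e^{i\varphi})$, with $\overline\partial(b,w)=0$ if $b,w$ are not adjacent. Let $\frac1{\overline\partial}$ be the two-sided inverse of $\overline\partial$: $\sum_w\overline\partial(b,w)\frac1{\overline\partial}(w,b')=\delta_{b,b'}$, $\sum_b\frac1{\overline\partial}(w,b)\overline\partial(b,w')=\delta_{w,w'}$, and $\frac1{\overline\partial}(w,b)\to0$ as $b\to\infty$ for every $w$. For vertices $u,v$ of the tiling, the discrete exponential $g_{u\to v}(z)$ is the rational function obtained as the product along any path of sides from $u$ to $v$ of a factor $\frac1{z-e^{i\phi}}$ for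 each side of direction $e^{i\phi}$ traversed along its orientation, and of a factor $z-e^{i\phi}$ for each such side traversed against it. Let $F,F'$ be face vertices with $F'-F=De^{i\theta_0}$, $D>0$, and let $F=v_0\to v_1\to\dots\to v_{2P}=F'$ be a path of sides with $v_{j+1}-v_j=e^{i\phi_j}$, $\theta_0-\frac\pi2<\phi_j<\theta_0+\frac\pi2$. The \emph{straight-line zipper} along this path consists of all edges joining a white $v_{2j-1}$ to black neighbours lying on the left of the path (the side of $e^{i(\theta_0+\pi/2)}$), and all edges joining a black $v_{2j-1}$ to white neighbours lying on the right of the path (the side of $e^{i(\theta_0-\pi/2)}$). Let $\overline\partial_{\mathrm{zip}}$ be the restriction of $\overline\partial$ to the zipper edges, and $\frac{\overline\partial_{\mathrm{zip}}}{\overline\partial}:=\overline\partial_{\mathrm{zip}}\frac1{\overline\partial}$, a matrix of finite rank indexed by black vertices. **Statement.** For every $n\ge1$, $$\mathrm{tr}\Big[\Big(\frac{\overline\partial_{\mathrm{zip}}}{\overline\partial}\Big)^n\Big]=\frac1{(2\pi i)^n}\int_0^{-ie^{i\theta_0}\infty}dz_1\cdots\int_0^{-ie^{i\theta_0}\infty}dz_n\;\prod_{j=1}^n\frac{1-\dfrac{g_{F\to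 F'}(z_j)}{g_{F\to F'}(z_{j+1})}}{z_j-z_{j+1}},\qquad z_{n+1}:=z_1,$$ where the contours are straight rays, the integral converges absolutely, and on $z_j=z_{j+1}$ the corresponding factor is understood as its limit $-g_{F\to F'}'(z_j)/g_{F\to F'}(z_j)$ (so for $n=1$ the integrand is $-g_{F\to F'}'/g_{F\to F'}$). -/

import Mathlib

/-- A rhombus of side length `1`, drawn with its white corner first.  `right` and `left` are the
unit vectors of the two sides leaving the white corner, on the right and on the left of the
diagonal from the white corner to the opposite (black) corner. -/
structure Rhombus where
  white : ℂ
  right : ℂ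
  left : ℂ
  norm_right : ‖right‖ = 1
  norm_left : ‖left‖ = 1
  ccw : 0 < (starRingEnd ℂ right * left).im

namespace Rhombus

/-- The two other corners, which are dual vertices (centres of faces of the isoradial graph). -/
def faceR (R : Rhombus) : ℂ := R.white + R.right

def faceL (R : Rhombus) : ℂ := R.white + R.left

def black (R : Rhombus) : ℂ := R.white + R.right + R.left

def closedRegion (R : Rhombus) : Set ℂ :=
  {z | ∃ s t : ℝ, s ∈ Set.Icc 0 1 ∧ t ∈ Set.Icc 0 1 ∧ z = R.white + s * R.right + t * R.left}

def openRegion (R : Rhombus) : Set ℂ :=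
  {z | ∃ s t : ℝ, s ∈ Set.Ioo 0 1 ∧ t ∈ Set.Ioo 0 1 ∧ z = R.white + s * R.right + t * R.left}

end Rhombus

/-- An infinite bipartite isoradial graph, given through its rhombus graph: an edge-to-edge tiling
of the plane by unit rhombi whose vertices are coloured white / black / face.  The edges of
the isoradial graph are the white-black diagonals of the rhombi.  The last four fields say that a
vertex of the tiling lying in a closed rhombus is a corner of it, of the same colour. -/
structure RhombusGraph where
  rhombi : Set Rhombus
  covers : ∀ z : ℂ, ∃ R ∈ rhombi, z ∈ R.closedRegion
  no_overlap : ∀ R ∈ rhombi, ∀ S ∈ rhombi, (R.openRegion ∩ S.openRegion).Nonempty → R = S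
  white_mem : ∀ R ∈ rhombi, ∀ S ∈ rhombi, S.white ∈ R.closedRegion → S.white = R.white
  black_mem : ∀ R ∈ rhombi, ∀ S ∈ rhombi, S.black ∈ R.closedRegion → S.black = R.black
  faceR_mem : ∀ R ∈ rhombi, ∀ S ∈ rhombi, S.faceR ∈ R.closedRegion →
    S.faceR = R.faceR ∨ S.faceR = R.faceL
  faceL_mem : ∀ R ∈ rhombi, ∀ S ∈ rhombi, S.faceL ∈ R.closedRegion →
    S.faceL = R.faceR ∨ S.faceL = R.faceL

/-- Product of matrices with possibly infinite index types; it is only used where all the sums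
have finitely many nonzero terms. -/
noncomputable def infMul {α β γ : Type*} (A : Matrix α β ℂ) (B : Matrix β γ ℂ) : Matrix α γ ℂ :=
  fun i k => ∑ᶠ j, A i j * B j k

open Classical in
noncomputable def infPow {α : Type*} (A : Matrix α α ℂ) : ℕ → Matrix α α ℂ
  | 0 => fun i j => if i = j then 1 else 0
  | n + 1 => infMul (infPow A n) A

noncomputable def infTrace {α : Type*} (A : Matrix α α ℂ) : ℂ := ∑ᶠ i, A i i

/-- The quotient `(1 - g x / g y) / (x - y)`, with its limiting value on the diagonal. -/
noncomputable def cyclicKernel (g : ℂ → ℂ) (x y : ℂ) : ℂ :=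
  open Classical in
  if x = y then -(deriv g x / g x) else (1 - g x / g y) / (x - y)

/-- The integrand `∏ (1 - g (z j) / g (z (j+1))) / (z j - z (j+1))`, indices mod `n`. -/
noncomputable def cyclicIntegrand (g : ℂ → ℂ) (n : ℕ) [NeZero n] (z : Fin n → ℂ) : ℂ :=
  ∏ j : Fin n, cyclicKernel g (z j) (z (j + 1))

/-- The open positive orthant, which parametrizes `n` copies of a ray `0 → u ∞`. -/
def orthant (n : ℕ) : Set (Fin n → ℝ) := Set.univ.pi fun _ => Set.Ioi 0

/-- Pull-back of `f(z) dz_1 ⋯ dz_n` under `z j = t j * u`. -/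
noncomputable def rayPullback (u : ℂ) (n : ℕ) (f : (Fin n → ℂ) → ℂ) (t : Fin n → ℝ) : ℂ :=
  f (fun j => (t j : ℂ) * u) * u ^ n

/-- `∫_0^{u ∞} ⋯ ∫_0^{u ∞} f(z) dz_1 ⋯ dz_n` along straight rays. -/
noncomputable def rayIntegral (u : ℂ) (n : ℕ) (f : (Fin n → ℂ) → ℂ) : ℂ :=
  ∫ t in orthant n, rayPullback u n f t

namespace RhombusGraph

variable (T : RhombusGraph)

/-- The angles of the rhombi are bounded away from `0` and `π` (their sines are bounded below). -/
def BoundedAngles : Prop :=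
  ∃ ε : ℝ, 0 < ε ∧ ∀ R ∈ T.rhombi, ε ≤ (starRingEnd ℂ R.right * R.left).im

def IsWhite (v : ℂ) : Prop := ∃ R ∈ T.rhombi, R.white = v

def IsBlack (v : ℂ) : Prop := ∃ R ∈ T.rhombi, R.black = v

def IsFace (v : ℂ) : Prop := ∃ R ∈ T.rhombi, R.faceR = v ∨ R.faceL = v

abbrev White : Type := {v : ℂ // T.IsWhite v}

abbrev Black : Type := {v : ℂ // T.IsBlack v}

/-- Oriented edges of the rhombus graph: away from white vertices, towards black ones. -/
def Arrow (u v : ℂ) : Prop :=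
  ∃ R ∈ T.rhombi, (u = R.white ∧ v = R.faceR) ∨ (u = R.white ∧ v = R.faceL) ∨
    (u = R.faceR ∧ v = R.black) ∨ (u = R.faceL ∧ v = R.black)

/-- The rhombus graph; points of the plane that are not vertices of the tiling are isolated. -/
def graph : SimpleGraph ℂ := SimpleGraph.fromRel T.Arrow

open Classical in
/-- Multiplier of the discrete exponential along a step `u → v` of the rhombus graph. -/
noncomputable def stepFactor (u v : ℂ) : RatFunc ℂ :=
  if T.Arrow u v then (RatFunc.X - RatFunc.C (v - u))⁻¹ else RatFunc.X - RatFunc.C (u - v)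

noncomputable def walkExp : {u v : ℂ} → T.graph.Walk u v → RatFunc ℂ
  | _, _, SimpleGraph.Walk.nil => 1
  | _, _, SimpleGraph.Walk.cons (u := u) (v := v) _ p => T.stepFactor u v * walkExp p

open Classical in
/-- The discrete exponential `g_{u → v}` as a rational function: the product of the multipliers
along a path from `u` to `v`. -/
noncomputable def discreteExpRat (u v : ℂ) : RatFunc ℂ :=
  if h : T.graph.Reachable u v then T.walkExp h.some else 0

/-- The discrete exponential `g_{u → v}(z)`. -/
noncomputable def discreteExp (u v z : ℂ) : ℂ :=
  RatFunc.eval (RingHom.id ℂ) z (T.discreteExpRat u v)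

open Classical in
/-- The black-to-white Kasteleyn matrix, with critical weights. -/
noncomputable def dbar : Matrix T.Black T.White ℂ := fun b w =>
  if h : ∃ R ∈ T.rhombi, R.white = w ∧ R.black = b then
    Complex.I * (h.choose.left - h.choose.right)
  else 0

open Classical in
/-- The restriction of the Kasteleyn matrix to the edges (rhombi) in `E`. -/
noncomputable def dbarOn (E : Set Rhombus) : Matrix T.Black T.White ℂ := fun b w =>
  if ∃ R ∈ E, R.white = w ∧ R.black = b then T.dbar b w else 0

open Classical in
/-- `K` is a two-sided inverse of the Kasteleyn matrix with `K w b → 0` as `b → ∞`. -/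
structure IsInverseKasteleyn (K : Matrix T.White T.Black ℂ) : Prop where
  dbar_mul : ∀ b b' : T.Black, infMul T.dbar K b b' = if b = b' then 1 else 0
  mul_dbar : ∀ w w' : T.White, infMul K T.dbar w w' = if w = w' then 1 else 0
  tendsto_zero : ∀ w : T.White, Filter.Tendsto (fun b : T.Black => K w b)
    (Filter.comap (fun b : T.Black => (b : ℂ)) (Filter.cocompact ℂ)) (nhds 0)

/-- The inverse Kasteleyn matrix: the matrix satisfying `IsInverseKasteleyn`. -/
noncomputable def invDbar : Matrix T.White T.Black ℂ :=
  Classical.epsilon T.IsInverseKasteleyn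

/-- A straight-line path `F = v 0 → v 1 → ⋯ → v (2 P) = F'` on the rhombus graph, with direction
angles `φ j` of its steps within `π / 2` of `θ₀`. -/
structure StraightLinePath (F F' : ℂ) (θ₀ : ℝ) where
  P : ℕ
  v : ℕ → ℂ
  φ : ℕ → ℝ
  start_eq : v 0 = F
  end_eq : v (2 * P) = F'
  adj : ∀ j < 2 * P, T.graph.Adj (v j) (v (j + 1))
  step : ∀ j < 2 * P, v (j + 1) - v j = Complex.exp (φ j * Complex.I)
  angle_mem : ∀ j < 2 * P, φ j ∈ Set.Ioo (θ₀ - Real.pi / 2) (θ₀ + Real.pi / 2)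

variable {T}

/-- The edges of the zipper along a straight-line path.  At a white middle vertex `v (2 j + 1)`
these are the edges to the black neighbours on the left of the path: the rhombus, seen from its
white corner, lies in the sector that runs counterclockwise from the direction
`φ (2 j + 1)` of `v (2 j + 2)` to the direction `φ (2 j) + π` of `v (2 j)`.
At a black middle vertex these are the edges to the white neighbours on the right of the path:
the directions of the sides pointing to the black corner lie in the sector that runs
counterclockwise from `φ (2 j)` (side from `v (2 j)`) to `φ (2 j + 1) + π` (side from
`v (2 j + 2)`). -/
def StraightLinePath.zipper {F F' : ℂ} {θ₀ : ℝ} (p : T.StraightLinePath F F' θ₀) :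
    Set Rhombus :=
  {R | R ∈ T.rhombi ∧ ∃ j < p.P, ∃ α β : ℝ, α < β ∧
    R.right = Complex.exp (α * Complex.I) ∧ R.left = Complex.exp (β * Complex.I) ∧
    ((R.white = p.v (2 * j + 1) ∧ p.φ (2 * j + 1) ≤ α ∧ β ≤ p.φ (2 * j) + Real.pi) ∨
      (R.black = p.v (2 * j + 1) ∧ p.φ (2 * j) ≤ α ∧ β ≤ p.φ (2 * j + 1) + Real.pi))}

/-- The matrix `∂_zip (1 / ∂)`, indexed by black vertices. -/
noncomputable def StraightLinePath.zipRatio {F F' : ℂ} {θ₀ : ℝ}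
    (p : T.StraightLinePath F F' θ₀) : Matrix T.Black T.Black ℂ :=
  infMul (T.dbarOn p.zipper) T.invDbar

end RhombusGraph

/-! The entries of the inverse matrix are contour integrals of discrete exponentials. The trace then
becomes a multiple integral in which the sums over zipper edges can be carried out in closed form.

For white `w` and black `b` put K(w,b) = (1/2π) ∫ g_{w→b}(z) dz along a ray from 0 that points away
from an open half plane containing all poles of g_{w→b}. Around the fan of rhombi at a vertex,
partial fractions turn each product ∂̄(b,w) g_{w→b} into a common factor times a difference of two
simple fractions. Off the diagonal, all rays can be rotated to a common one, where these differences
cancel; on the diagonal each term is a rhombus angle and the angles add up to 2π. With the decay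
K(w,b) = O(1/|b − w|) and a summation by parts over large discs, K is identified with the inverse
matrix (`isInverse_kernel`, `isInverse_unique`, `invDbar_eq`).

The half plane comes from a deformation argument. The tiling lifts to the free vector space on the
directions of sides (`exists_isPotential`), so each direction may be replaced by another vector; as
long as the rhombi stay uniformly nondegenerate along a homotopy, the deformed plane map stays
injective (`deform_injective`). If the signed directions separating two points did not lie in a half
plane with a fixed margin, positive multiples of slightly perturbed directions would add up to zero,
and the corresponding deformation would make the two points collide (`exists_direction`). The margin
is uniform, and it also yields the decay of K.

For `w` and `b` on zipper edges the half plane can be chosen so that the ray rotates to the fixed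
ray through −i e^{iθ₀} (`StraightLinePath.exists_half_plane`), so all entries occurring in the trace
are integrals along one ray. Splitting g_{w→b} = g_{w→F} g_{F→b} and regrouping by edges leaves the
sums over zipper edges of ∂̄(b,w) g_{F→b}(x) g_{w→F}(y). These telescope first over the sector at a
middle vertex and then along the path, and give −i times the cyclic kernel (`sum_zipperTerm`).
Fubini for finitely many product functions finishes the proof (`integrable_and_trace`). -/

/-- The determinant of two vectors of the plane. -/
noncomputable def wedge (a b : ℂ) : ℝ := a.re * b.im - a.im * b.re

theorem wedge_eq_im (a b : ℂ) : (starRingEnd ℂ a * b).im = wedge a b := by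
  simp [wedge]; ring

theorem wedge_add_right (a b c : ℂ) : wedge a (b + c) = wedge a b + wedge a c := by
  simp [wedge]; ring

theorem wedge_real_mul_right (a : ℂ) (x : ℝ) (b : ℂ) : wedge a (x * b) = x * wedge a b := by
  simp [wedge]; ring

@[simp] theorem wedge_self (a : ℂ) : wedge a a = 0 := by simp [wedge]; ring

theorem abs_wedge_le (a b : ℂ) : |wedge a b| ≤ ‖a‖ * ‖b‖ := by
  rw [← wedge_eq_im]
  refine (Complex.abs_im_le_norm _).trans ?_
  simp

/-! ### Affine coordinates in a single rhombus. -/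

namespace Rhombus

variable (R S : Rhombus)

theorem wedge_pos : 0 < wedge R.right R.left := by
  rw [← wedge_eq_im]; exact R.ccw

/-- Coordinate along the right side. -/
noncomputable def coordR (z : ℂ) : ℝ := wedge z R.left / wedge R.right R.left

/-- Coordinate along the left side. -/
noncomputable def coordL (z : ℂ) : ℝ := wedge R.right z / wedge R.right R.left

theorem eq_coord (z : ℂ) : z = R.coordR z * R.right + R.coordL z * R.left := by
  have h := R.wedge_pos.ne'
  apply Complex.ext
  · simp only [coordR, coordL, Complex.add_re, Complex.mul_re, Complex.ofReal_re,
      Complex.ofReal_im, zero_mul, sub_zero]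
    field_simp
    simp only [wedge]; ring
  · simp only [coordR, coordL, Complex.add_im, Complex.mul_im, Complex.ofReal_re,
      Complex.ofReal_im, zero_mul, add_zero]
    field_simp
    simp only [wedge]; ring

theorem coordR_add (z w : ℂ) : R.coordR (z + w) = R.coordR z + R.coordR w := by
  simp [coordR, wedge]; ring

theorem coordL_add (z w : ℂ) : R.coordL (z + w) = R.coordL z + R.coordL w := by
  simp [coordL, wedge]; ring

theorem coordR_sub (z w : ℂ) : R.coordR (z - w) = R.coordR z - R.coordR w := by
  simp [coordR, wedge]; ring

theorem coordL_sub (z w : ℂ) : R.coordL (z - w) = R.coordL z - R.coordL w := by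
  simp [coordL, wedge]; ring

theorem coordR_mul (x : ℝ) (z : ℂ) : R.coordR (x * z) = x * R.coordR z := by
  simp [coordR, wedge]; ring

theorem coordL_mul (x : ℝ) (z : ℂ) : R.coordL (x * z) = x * R.coordL z := by
  simp [coordL, wedge]; ring

@[simp] theorem coordR_zero : R.coordR 0 = 0 := by simp [coordR, wedge]

@[simp] theorem coordL_zero : R.coordL 0 = 0 := by simp [coordL, wedge]

@[simp] theorem coordR_right : R.coordR R.right = 1 := div_self R.wedge_pos.ne'

@[simp] theorem coordR_left : R.coordR R.left = 0 := by simp [coordR]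

@[simp] theorem coordL_left : R.coordL R.left = 1 := div_self R.wedge_pos.ne'

@[simp] theorem coordL_right : R.coordL R.right = 0 := by simp [coordL]

theorem coordR_comb (s t : ℝ) : R.coordR (s * R.right + t * R.left) = s := by
  simp [coordR_add, coordR_mul]

theorem coordL_comb (s t : ℝ) : R.coordL (s * R.right + t * R.left) = t := by
  simp [coordL_add, coordL_mul]

theorem continuous_coordR : Continuous R.coordR := by
  unfold coordR wedge; fun_prop

theorem continuous_coordL : Continuous R.coordL := by
  unfold coordL wedge; fun_prop

theorem mem_closedRegion {z : ℂ} : z ∈ R.closedRegion ↔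
    R.coordR (z - R.white) ∈ Set.Icc (0 : ℝ) 1 ∧ R.coordL (z - R.white) ∈ Set.Icc (0 : ℝ) 1 := by
  constructor
  · rintro ⟨s, t, hs, ht, rfl⟩
    have e : R.white + s * R.right + t * R.left - R.white = s * R.right + t * R.left := by ring
    rw [e, coordR_comb, coordL_comb]
    exact ⟨hs, ht⟩
  · rintro ⟨hs, ht⟩
    refine ⟨_, _, hs, ht, ?_⟩
    have := R.eq_coord (z - R.white)
    linear_combination this

theorem mem_openRegion {z : ℂ} : z ∈ R.openRegion ↔
    R.coordR (z - R.white) ∈ Set.Ioo (0 : ℝ) 1 ∧ R.coordL (z - R.white) ∈ Set.Ioo (0 : ℝ) 1 := by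
  constructor
  · rintro ⟨s, t, hs, ht, rfl⟩
    have e : R.white + s * R.right + t * R.left - R.white = s * R.right + t * R.left := by ring
    rw [e, coordR_comb, coordL_comb]
    exact ⟨hs, ht⟩
  · rintro ⟨hs, ht⟩
    refine ⟨_, _, hs, ht, ?_⟩
    have := R.eq_coord (z - R.white)
    linear_combination this

theorem isClosed_closedRegion : IsClosed R.closedRegion := by
  have : R.closedRegion = (fun z => R.coordR (z - R.white)) ⁻¹' Set.Icc 0 1 ∩
      (fun z => R.coordL (z - R.white)) ⁻¹' Set.Icc 0 1 := by
    ext z; exact R.mem_closedRegion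
  rw [this]
  exact (isClosed_Icc.preimage (R.continuous_coordR.comp (continuous_id.sub continuous_const))).inter
    (isClosed_Icc.preimage (R.continuous_coordL.comp (continuous_id.sub continuous_const)))

theorem isOpen_openRegion : IsOpen R.openRegion := by
  have : R.openRegion = (fun z => R.coordR (z - R.white)) ⁻¹' Set.Ioo 0 1 ∩
      (fun z => R.coordL (z - R.white)) ⁻¹' Set.Ioo 0 1 := by
    ext z; exact R.mem_openRegion
  rw [this]
  exact (isOpen_Ioo.preimage (R.continuous_coordR.comp (continuous_id.sub continuous_const))).inter
    (isOpen_Ioo.preimage (R.continuous_coordL.comp (continuous_id.sub continuous_const)))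

theorem coord_combo (x y : ℂ) (a b : ℝ) (hab : a + b = 1) :
    R.coordR (a • x + b • y - R.white) =
      a * R.coordR (x - R.white) + b * R.coordR (y - R.white) ∧
    R.coordL (a • x + b • y - R.white) =
      a * R.coordL (x - R.white) + b * R.coordL (y - R.white) := by
  have hc : (a : ℂ) + b = 1 := by exact_mod_cast hab
  have : a • x + b • y - R.white = a * (x - R.white) + b * (y - R.white) := by
    simp only [Complex.real_smul]; linear_combination R.white * hc
  rw [this]
  simp [coordR_add, coordL_add, coordR_mul, coordL_mul]

theorem convex_closedRegion : Convex ℝ R.closedRegion := by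
  intro x hx y hy a b ha hb hab
  rw [mem_closedRegion] at *
  obtain ⟨h1, h2⟩ := R.coord_combo x y a b hab
  rw [h1, h2]
  exact ⟨convex_Icc 0 1 hx.1 hy.1 ha hb hab, convex_Icc 0 1 hx.2 hy.2 ha hb hab⟩

theorem convex_openRegion : Convex ℝ R.openRegion := by
  intro x hx y hy a b ha hb hab
  rw [mem_openRegion] at *
  obtain ⟨h1, h2⟩ := R.coord_combo x y a b hab
  rw [h1, h2]
  exact ⟨convex_Ioo 0 1 hx.1 hy.1 ha hb hab, convex_Ioo 0 1 hx.2 hy.2 ha hb hab⟩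

noncomputable def center : ℂ := R.white + (1 / 2 : ℝ) * R.right + (1 / 2 : ℝ) * R.left

theorem center_mem : R.center ∈ R.openRegion :=
  ⟨1 / 2, 1 / 2, by norm_num, by norm_num, rfl⟩

theorem combo_center_mem {z : ℂ} (hz : z ∈ R.closedRegion) {a : ℝ} (ha : 0 < a) (ha' : a ≤ 1) :
    (1 - a) • z + a • R.center ∈ R.openRegion := by
  have hc := R.center_mem
  rw [mem_closedRegion] at hz
  rw [mem_openRegion] at *
  obtain ⟨h1, h2⟩ := R.coord_combo z R.center (1 - a) a (by ring)
  rw [h1, h2]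
  obtain ⟨⟨z1, z2⟩, z3, z4⟩ := hz
  obtain ⟨⟨c1, c2⟩, c3, c4⟩ := hc
  have := mul_nonneg (sub_nonneg.2 ha') z1
  have := mul_nonneg (sub_nonneg.2 ha') z3
  have := mul_nonneg (sub_nonneg.2 ha') (sub_nonneg.2 z2)
  have := mul_nonneg (sub_nonneg.2 ha') (sub_nonneg.2 z4)
  have := mul_pos ha c1
  have := mul_pos ha c3
  have := mul_pos ha (sub_pos.2 c2)
  have := mul_pos ha (sub_pos.2 c4)
  refine ⟨⟨?_, ?_⟩, ?_, ?_⟩ <;> nlinarith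

theorem white_mem : R.white ∈ R.closedRegion := ⟨0, 0, by norm_num, by norm_num, by simp⟩

theorem faceR_mem : R.faceR ∈ R.closedRegion := ⟨1, 0, by norm_num, by norm_num, by simp [faceR]⟩

theorem faceL_mem : R.faceL ∈ R.closedRegion := ⟨0, 1, by norm_num, by norm_num, by simp [faceL]⟩

theorem black_mem : R.black ∈ R.closedRegion := ⟨1, 1, by norm_num, by norm_num, by simp [black]⟩

theorem coordR_bound (z : ℂ) : |R.coordR z| * wedge R.right R.left ≤ ‖z‖ := by
  rw [coordR, abs_div, abs_of_pos R.wedge_pos, div_mul_cancel₀ _ R.wedge_pos.ne']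
  simpa [R.norm_left] using abs_wedge_le z R.left

theorem coordL_bound (z : ℂ) : |R.coordL z| * wedge R.right R.left ≤ ‖z‖ := by
  rw [coordL, abs_div, abs_of_pos R.wedge_pos, div_mul_cancel₀ _ R.wedge_pos.ne']
  simpa [R.norm_right] using abs_wedge_le R.right z

theorem dist_white_le {z : ℂ} (hz : z ∈ R.closedRegion) : ‖z - R.white‖ ≤ 2 := by
  obtain ⟨s, t, hs, ht, rfl⟩ := hz
  have e : R.white + s * R.right + t * R.left - R.white = s * R.right + t * R.left := by ring
  rw [e]
  refine (norm_add_le _ _).trans ?_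
  rw [norm_mul, norm_mul, R.norm_right, R.norm_left, Complex.norm_real, Complex.norm_real,
    Real.norm_of_nonneg hs.1, Real.norm_of_nonneg ht.1]
  linarith [hs.2, ht.2]

/-- Displacements in a rhombus, expanded along the two oriented sides. -/
noncomputable def lin (z : ℂ) : ℂ →₀ ℝ :=
  Finsupp.single R.right (R.coordR z) + Finsupp.single R.left (R.coordL z)

theorem lin_sub (z w : ℂ) : R.lin (z - w) = R.lin z - R.lin w := by
  simp only [lin, coordR_sub, coordL_sub, Finsupp.single_sub]; abel

@[simp] theorem lin_zero : R.lin 0 = 0 := by simp [lin]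

theorem right_ne_left : R.right ≠ R.left := fun h => by
  have := R.wedge_pos
  rw [h, wedge_self] at this
  exact lt_irrefl _ this

/-- `e` is a side of `R` starting at `p`, and `k` is the coordinate along `e`. -/
def IsSide (e p : ℂ) (k : ℂ → ℝ) : Prop :=
  (e = R.right ∧ k = R.coordR ∧ (p = R.white ∨ p = R.faceL)) ∨
  (e = R.left ∧ k = R.coordL ∧ (p = R.white ∨ p = R.faceR))

variable {R S}

namespace IsSide

variable {e p : ℂ} {k : ℂ → ℝ}

theorem mem (h : R.IsSide e p k) {x : ℝ} (hx : x ∈ Set.Icc (0 : ℝ) 1) :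
    p + x * e ∈ R.closedRegion := by
  rcases h with ⟨rfl, -, rfl | rfl⟩ | ⟨rfl, -, rfl | rfl⟩
  · exact ⟨x, 0, hx, by norm_num, by simp⟩
  · exact ⟨x, 1, hx, by norm_num, by simp [faceL]; ring⟩
  · exact ⟨0, x, by norm_num, hx, by simp⟩
  · exact ⟨1, x, by norm_num, hx, by simp [faceR]⟩

theorem coord (h : R.IsSide e p k) (x : ℝ) : k (p + x * e - R.white) = x := by
  rcases h with ⟨rfl, rfl, rfl | rfl⟩ | ⟨rfl, rfl, rfl | rfl⟩ <;>
    simp [faceL, faceR, coordR_add, coordL_add, coordR_sub, coordL_sub, coordR_mul, coordL_mul]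

theorem coord_white (h : R.IsSide e p k) : k (R.white - R.white) = 0 := by
  rcases h with ⟨rfl, rfl, -⟩ | ⟨rfl, rfl, -⟩ <;> simp

theorem coord_black (h : R.IsSide e p k) : k (R.black - R.white) = 1 := by
  rcases h with ⟨rfl, rfl, -⟩ | ⟨rfl, rfl, -⟩ <;>
    simp [black, coordR_add, coordL_add, coordR_sub, coordL_sub]

theorem coord_faceR (h : R.IsSide e p k) : k (R.faceR - R.white) = 0 ∨ k (R.faceR - R.white) = 1 := by
  rcases h with ⟨rfl, rfl, -⟩ | ⟨rfl, rfl, -⟩ <;> simp [faceR]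

theorem coord_faceL (h : R.IsSide e p k) : k (R.faceL - R.white) = 0 ∨ k (R.faceL - R.white) = 1 := by
  rcases h with ⟨rfl, rfl, -⟩ | ⟨rfl, rfl, -⟩ <;> simp [faceL]

theorem start_cases (h : R.IsSide e p k) : p = R.white ∨
    ((p = R.faceR ∨ p = R.faceL) ∧ p + e = R.black) := by
  rcases h with ⟨rfl, -, rfl | rfl⟩ | ⟨rfl, -, rfl | rfl⟩
  · simp
  · right; exact ⟨Or.inr rfl, by simp [faceL, black]; ring⟩
  · simp
  · right; exact ⟨Or.inl rfl, by simp [faceR, black]⟩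

theorem end_cases (h : R.IsSide e p k) : p + e = R.black ∨ p + e = R.faceR ∨ p + e = R.faceL := by
  rcases h with ⟨rfl, -, rfl | rfl⟩ | ⟨rfl, -, rfl | rfl⟩
  · right; left; rfl
  · left; simp [faceL, black]; ring
  · right; right; rfl
  · left; simp [faceR, black]

theorem norm_eq (h : R.IsSide e p k) : ‖e‖ = 1 := by
  rcases h with ⟨rfl, -⟩ | ⟨rfl, -⟩
  exacts [R.norm_right, R.norm_left]

end IsSide

/-- A linear functional that is maximal on `R` at two distinct points is maximal on a side through
both. -/
theorem exists_side_of_max (f : ℂ →L[ℝ] ℝ) {u : ℝ} (hf : ∀ z ∈ R.closedRegion, f z ≤ u)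
    (hc : f R.center < u) {x y : ℂ} (hx : x ∈ R.closedRegion) (hy : y ∈ R.closedRegion)
    (hfx : f x = u) (hfy : f y = u) (hxy : x ≠ y) :
    ∃ e p k, R.IsSide e p k ∧ ∃ a b : ℝ, a ∈ Set.Icc (0 : ℝ) 1 ∧ b ∈ Set.Icc (0 : ℝ) 1 ∧
      x = p + a * e ∧ y = p + b * e ∧ R.lin (y - x) = Finsupp.single e (b - a) := by
  have lin_f : ∀ s t : ℝ, f (R.white + s * R.right + t * R.left) =
      f R.white + s * f R.right + t * f R.left := by
    intro s t
    simp [← Complex.real_smul, map_add, map_smul]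
  obtain ⟨s, t, hs, ht, rfl⟩ := hx
  obtain ⟨s', t', hs', ht', rfl⟩ := hy
  have h00 := hf _ ⟨0, 0, by norm_num, by norm_num, rfl⟩
  -- Moving one coordinate to 0 or to 1 cannot raise `f` above its maximum, so a nonzero slope along
  -- a side pins that coordinate to an end.
  have key : ∀ s t : ℝ, s ∈ Set.Icc (0 : ℝ) 1 → t ∈ Set.Icc (0 : ℝ) 1 →
      f (R.white + s * R.right + t * R.left) = u →
      (0 < f R.right → s = 1) ∧ (f R.right < 0 → s = 0) ∧ (0 < f R.left → t = 1) ∧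
      (f R.left < 0 → t = 0) := by
    intro s t hs ht hu
    have h0t := hf _ ⟨0, t, by norm_num, ht, rfl⟩
    have h1t := hf _ ⟨1, t, by norm_num, ht, rfl⟩
    have hs0 := hf _ ⟨s, 0, hs, by norm_num, rfl⟩
    have hs1 := hf _ ⟨s, 1, hs, by norm_num, rfl⟩
    rw [lin_f] at h0t h1t hs0 hs1 hu
    obtain ⟨a1, a2⟩ := hs
    obtain ⟨b1, b2⟩ := ht
    refine ⟨fun h => ?_, fun h => ?_, fun h => ?_, fun h => ?_⟩ <;> nlinarith
  obtain ⟨k1, k2, k3, k4⟩ := key s t hs ht hfx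
  obtain ⟨k1', k2', k3', k4'⟩ := key s' t' hs' ht' hfy
  have hd : R.lin (R.white + s' * R.right + t' * R.left - (R.white + s * R.right + t * R.left)) =
      Finsupp.single R.right (s' - s) + Finsupp.single R.left (t' - t) := by
    have e : R.white + s' * R.right + t' * R.left - (R.white + s * R.right + t * R.left) =
      ((s' - s : ℝ) : ℂ) * R.right + ((t' - t : ℝ) : ℂ) * R.left := by push_cast; ring
    rw [e, lin, coordR_comb, coordL_comb]
  rw [hd]
  rcases eq_or_ne (f R.right) 0 with ha | ha
  · have hb : f R.left ≠ 0 := by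
      intro hb
      rw [center, lin_f, ha, hb] at hc
      rw [lin_f, ha, hb] at hfx
      linarith
    have ht2 : t' = t ∧ (t = 0 ∨ t = 1) := by
      rcases lt_or_gt_of_ne hb with h | h
      · rw [k4 h, k4' h]; simp
      · rw [k3 h, k3' h]; simp
    obtain ⟨rfl, rfl | rfl⟩ := ht2
    · exact ⟨R.right, R.white, _, Or.inl ⟨rfl, rfl, Or.inl rfl⟩, s, s', hs, hs', by simp, by simp,
        by simp⟩
    · exact ⟨R.right, R.faceL, _, Or.inl ⟨rfl, rfl, Or.inr rfl⟩, s, s', hs, hs',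
        by simp [faceL]; ring, by simp [faceL]; ring, by simp⟩
  · have hs2 : s' = s ∧ (s = 0 ∨ s = 1) := by
      rcases lt_or_gt_of_ne ha with h | h
      · rw [k2 h, k2' h]; simp
      · rw [k1 h, k1' h]; simp
    obtain ⟨rfl, rfl | rfl⟩ := hs2
    · exact ⟨R.left, R.white, _, Or.inr ⟨rfl, rfl, Or.inl rfl⟩, t, t', ht, ht', by simp, by simp,
        by simp⟩
    · exact ⟨R.left, R.faceR, _, Or.inr ⟨rfl, rfl, Or.inr rfl⟩, t, t', ht, ht',
        by simp [faceR], by simp [faceR], by simp⟩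

theorem le_of_forall_openRegion_lt (f : ℂ →L[ℝ] ℝ) {u : ℝ} (hf : ∀ z ∈ R.openRegion, f z < u)
    {z : ℂ} (hz : z ∈ R.closedRegion) : f z ≤ u := by
  by_contra! h
  have hc := hf _ R.center_mem
  -- The point at proportion `a` on the segment from `z` to the centre is where `f` takes the value
  -- `u`, yet it lies in the open rhombus.
  set a := (f z - u) / (f z - f R.center) with ha
  have hpos : 0 < f z - f R.center := by linarith
  have ha0 : 0 < a := div_pos (by linarith) hpos
  have ha1 : a ≤ 1 := by rw [ha, div_le_one hpos]; linarith
  have := hf _ (R.combo_center_mem hz ha0 ha1)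
  rw [map_add, map_smul, map_smul, smul_eq_mul, smul_eq_mul] at this
  have e : a * (f z - f R.center) = f z - u := div_mul_cancel₀ _ hpos.ne'
  nlinarith

end Rhombus

/-! ### How two rhombi of the tiling can meet. -/

namespace RhombusGraph

variable (T : RhombusGraph)

theorem white_ne_face {R S : Rhombus} (hR : R ∈ T.rhombi) (hS : S ∈ T.rhombi) :
    S.white ≠ R.faceR ∧ S.white ≠ R.faceL := by
  constructor <;> intro h
  · have := T.white_mem R hR S hS (h ▸ R.faceR_mem)
    rw [this] at h
    have hn := R.norm_right
    simp [Rhombus.faceR] at h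
    simp [h] at hn
  · have := T.white_mem R hR S hS (h ▸ R.faceL_mem)
    rw [this] at h
    have hn := R.norm_left
    simp [Rhombus.faceL] at h
    simp [h] at hn

theorem black_ne_face {R S : Rhombus} (hR : R ∈ T.rhombi) (hS : S ∈ T.rhombi) :
    S.black ≠ R.faceR ∧ S.black ≠ R.faceL := by
  constructor <;> intro h
  · have := T.black_mem R hR S hS (h ▸ R.faceR_mem)
    rw [this] at h
    have hn := R.norm_left
    simp [Rhombus.faceR, Rhombus.black] at h
    simp [h] at hn
  · have := T.black_mem R hR S hS (h ▸ R.faceL_mem)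
    rw [this] at h
    have hn := R.norm_right
    simp [Rhombus.faceL, Rhombus.black] at h
    simp [h] at hn

theorem white_ne_black {R S : Rhombus} (hR : R ∈ T.rhombi) (hS : S ∈ T.rhombi) :
    S.white ≠ R.black := by
  intro h
  have := T.white_mem R hR S hS (h ▸ R.black_mem)
  rw [this] at h
  have h2 := R.coordR_add R.right R.left
  have h3 : R.right + R.left = 0 := by
    have : R.white = R.white + R.right + R.left := h
    linear_combination -this
  rw [h3] at h2
  simp at h2

/-- This compatibility makes the lift of the tiling well defined. A line separating the two open
rhombi contains both points, so they lie on a side of `R` and on a side of `S`, and these sides are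
parallel. Equal orientations give equal expansions. Opposite orientations are ruled out by the
colours: an end of one side would be a vertex of the tiling that the other rhombus does not allow at
that place. -/
theorem lin_compat {R S : Rhombus} (hR : R ∈ T.rhombi) (hS : S ∈ T.rhombi) {x y : ℂ}
    (hxR : x ∈ R.closedRegion) (hyR : y ∈ R.closedRegion)
    (hxS : x ∈ S.closedRegion) (hyS : y ∈ S.closedRegion) : R.lin (y - x) = S.lin (y - x) := by
  rcases eq_or_ne R S with rfl | hRS
  · rfl
  rcases eq_or_ne x y with rfl | hxy
  · simp
  have hdisj : Disjoint R.openRegion S.openRegion := by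
    rw [Set.disjoint_iff_inter_eq_empty]
    by_contra h
    exact hRS (T.no_overlap R hR S hS (Set.nonempty_iff_ne_empty.2 h))
  obtain ⟨f, u, h1, h2⟩ := geometric_hahn_banach_open_open R.convex_openRegion
    R.isOpen_openRegion S.convex_openRegion S.isOpen_openRegion hdisj
  have h2' : ∀ z ∈ S.openRegion, (-f) z < -u := fun z hz => by
    simpa using h2 z hz
  have b1 : ∀ z ∈ R.closedRegion, f z ≤ u := fun z hz => Rhombus.le_of_forall_openRegion_lt f h1 hz
  have b2 : ∀ z ∈ S.closedRegion, (-f) z ≤ -u :=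
    fun z hz => Rhombus.le_of_forall_openRegion_lt (-f) h2' hz
  have hfx : f x = u := le_antisymm (b1 x hxR) (by simpa using b2 x hxS)
  have hfy : f y = u := le_antisymm (b1 y hyR) (by simpa using b2 y hyS)
  obtain ⟨e, p, k, side, a, b, ha, hb, hx, hy, hl⟩ := Rhombus.exists_side_of_max f b1
    (h1 _ R.center_mem) hxR hyR hfx hfy hxy
  obtain ⟨e', p', k', side', a', b', ha', hb', hx', hy', hl'⟩ := Rhombus.exists_side_of_max (-f) b2
    (h2' _ S.center_mem) hxS hyS (by simp [hfx]) (by simp [hfy]) hxy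
  rw [hl, hl']
  have hdiff : ((b - a : ℝ) : ℂ) * e = ((b' - a' : ℝ) : ℂ) * e' := by
    push_cast; linear_combination hy' - hx' + hx - hy
  have hba : b - a ≠ 0 := by
    intro h
    apply hxy
    rw [hx, hy, show b = a by linarith]
  have habs : |b - a| = |b' - a'| := by
    have := congrArg norm hdiff
    simpa only [norm_mul, Complex.norm_real, side.norm_eq, side'.norm_eq, mul_one,
      Real.norm_eq_abs] using this
  have hbaC : ((b - a : ℝ) : ℂ) ≠ 0 := by exact_mod_cast hba
  rcases abs_eq_abs.1 habs with hd | hd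
  · rw [← hd] at hdiff ⊢
    rw [mul_left_cancel₀ hbaC hdiff]
  · exfalso
    have he : e' = -e := by
      have : ((b - a : ℝ) : ℂ) * e = ((b - a : ℝ) : ℂ) * (-e') := by
        rw [hdiff, show b' - a' = -(b - a) by linarith]; push_cast; ring
      have := mul_left_cancel₀ hbaC this
      rw [this]; ring
    subst he
    have hp' : p' = p + ((a + a' : ℝ) : ℂ) * e := by
      push_cast; linear_combination hx - hx'
    obtain ⟨ha0, ha1⟩ := ha
    obtain ⟨hb0, hb1⟩ := hb
    obtain ⟨ha0', ha1'⟩ := ha'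
    obtain ⟨hb0', hb1'⟩ := hb'
    have hpos : 0 < a + a' := by
      rcases lt_or_gt_of_ne hba with h | h
      · nlinarith
      · nlinarith
    -- Either the start of the side of `S` lies on the side of `R`, past its start, or the end of
    -- the side of `S` lies strictly inside the side of `R`. In both cases the corner of `S` must be
    -- a corner of `R` of the same colour, whose coordinate `k` is prescribed.
    rcases le_or_gt (a + a') 1 with hle | hgt
    · have hmem : p' ∈ R.closedRegion := hp' ▸ side.mem ⟨hpos.le, hle⟩
      have hk : k (p' - R.white) = a + a' := by rw [hp']; exact side.coord _
      rcases side'.start_cases with h | ⟨h, hblack⟩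
      · rw [h] at hmem hk
        rw [T.white_mem R hR S hS hmem, side.coord_white] at hk
        linarith
      · have hcor : p' = R.faceR ∨ p' = R.faceL := by
          rcases h with h | h
          · rw [h] at hmem ⊢; exact T.faceR_mem R hR S hS hmem
          · rw [h] at hmem ⊢; exact T.faceL_mem R hR S hS hmem
        have h1' : a + a' = 1 := by
          rcases hcor with h | h
          · rw [h] at hk
            rcases side.coord_faceR with h' | h' <;> linarith
          · rw [h] at hk
            rcases side.coord_faceL with h' | h' <;> linarith
        have hp : S.black = p := by
          rw [← hblack, hp', h1']; push_cast; ring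
        have hpm : S.black ∈ R.closedRegion := by
          rw [hp]; simpa using side.mem (x := 0) ⟨le_rfl, zero_le_one⟩
        have hRb := T.black_mem R hR S hS hpm
        have c1 := side.coord_black
        have c0 := side.coord 0
        simp only [Complex.ofReal_zero, zero_mul, add_zero] at c0
        rw [← hRb, hp, c0] at c1
        exact zero_ne_one c1
    · have hq : p' + -e = p + ((a + a' - 1 : ℝ) : ℂ) * e := by
        rw [hp']; push_cast; ring
      have hlt : a + a' - 1 < 1 := by
        rcases lt_or_gt_of_ne hba with h | h
        · nlinarith
        · nlinarith
      have hmem : p' + -e ∈ R.closedRegion := hq ▸ side.mem ⟨by linarith, by linarith⟩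
      have hk : k (p' + -e - R.white) = a + a' - 1 := by rw [hq]; exact side.coord _
      rcases side'.end_cases with h | h | h
      · rw [h] at hmem hk
        rw [T.black_mem R hR S hS hmem, side.coord_black] at hk
        linarith
      · rw [h] at hmem hk
        rcases T.faceR_mem R hR S hS hmem with h' | h'
        · rw [h'] at hk
          rcases side.coord_faceR with h' | h' <;> linarith
        · rw [h'] at hk
          rcases side.coord_faceL with h' | h' <;> linarith
      · rw [h] at hmem hk
        rcases T.faceL_mem R hR S hS hmem with h' | h'
        · rw [h'] at hk
          rcases side.coord_faceR with h' | h' <;> linarith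
        · rw [h'] at hk
          rcases side.coord_faceL with h' | h' <;> linarith

end RhombusGraph

theorem wedge_smul_eq (a b z : ℂ) : (wedge a b : ℂ) * z = wedge z b * a + wedge a z * b := by
  apply Complex.ext <;> simp [wedge] <;> ring

theorem eq_or_eq_neg_of_wedge_eq_zero {a b : ℂ} (ha : ‖a‖ = 1) (hb : ‖b‖ = 1)
    (h : wedge a b = 0) : b = a ∨ b = -a := by
  have ha' : a.re * a.re + a.im * a.im = 1 := by
    rw [← Complex.normSq_apply, Complex.normSq_eq_norm_sq, ha]; norm_num
  have hb' : b.re * b.re + b.im * b.im = 1 := by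
    rw [← Complex.normSq_apply, Complex.normSq_eq_norm_sq, hb]; norm_num
  simp only [wedge] at h
  have e1 : b.re = (a.re * b.re + a.im * b.im) * a.re := by
    linear_combination (-b.re) * ha' - a.im * h
  have e2 : b.im = (a.re * b.re + a.im * b.im) * a.im := by
    linear_combination (-b.im) * ha' + a.re * h
  have hk2 : (a.re * b.re + a.im * b.im) ^ 2 = 1 := by
    linear_combination hb' * (a.re * a.re + a.im * a.im) + ha' - h * (a.re * b.im - a.im * b.re)
  rcases sq_eq_one_iff.1 hk2 with h1 | h1
  · left; rw [h1] at e1 e2; apply Complex.ext <;> simp [e1, e2]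
  · right; rw [h1] at e1 e2; apply Complex.ext <;> simp [e1, e2]

namespace Rhombus

variable {R S : Rhombus}

theorem exists_side_of_max_point (f : ℂ →L[ℝ] ℝ) {u : ℝ} (hf : ∀ z ∈ R.closedRegion, f z ≤ u)
    (hc : f R.center < u) {x : ℂ} (hx : x ∈ R.closedRegion) (hfx : f x = u) :
    ∃ e p k, R.IsSide e p k ∧ ∃ a : ℝ, a ∈ Set.Icc (0 : ℝ) 1 ∧ x = p + a * e ∧
      (f e = 0 ∨ a = 0 ∨ a = 1) := by
  have lin_f : ∀ s t : ℝ, f (R.white + s * R.right + t * R.left) =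
      f R.white + s * f R.right + t * f R.left := by
    intro s t
    simp [← Complex.real_smul, map_add, map_smul]
  obtain ⟨s, t, hs, ht, rfl⟩ := hx
  have h0t := hf _ ⟨0, t, by norm_num, ht, rfl⟩
  have h1t := hf _ ⟨1, t, by norm_num, ht, rfl⟩
  have hs0 := hf _ ⟨s, 0, hs, by norm_num, rfl⟩
  have hs1 := hf _ ⟨s, 1, hs, by norm_num, rfl⟩
  have key : (f R.right = 0 ∨ s = 0 ∨ s = 1) ∧ (f R.left = 0 ∨ t = 0 ∨ t = 1) := by
    rw [lin_f] at h0t h1t hs0 hs1 hfx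
    obtain ⟨a1, a2⟩ := hs
    obtain ⟨b1, b2⟩ := ht
    constructor
    · rcases lt_trichotomy (f R.right) 0 with h | h | h
      · right; left; nlinarith
      · left; exact h
      · right; right; nlinarith
    · rcases lt_trichotomy (f R.left) 0 with h | h | h
      · right; left; nlinarith
      · left; exact h
      · right; right; nlinarith
  obtain ⟨k1, k2⟩ := key
  have hR : t = 0 ∨ t = 1 → ∃ e p k, R.IsSide e p k ∧ ∃ a : ℝ, a ∈ Set.Icc (0 : ℝ) 1 ∧
      R.white + s * R.right + t * R.left = p + a * e ∧ (f e = 0 ∨ a = 0 ∨ a = 1) := by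
    rintro (rfl | rfl)
    · exact ⟨R.right, R.white, _, Or.inl ⟨rfl, rfl, Or.inl rfl⟩, s, hs, by simp, k1⟩
    · exact ⟨R.right, R.faceL, _, Or.inl ⟨rfl, rfl, Or.inr rfl⟩, s, hs, by simp [faceL]; ring, k1⟩
  have hL : s = 0 ∨ s = 1 → ∃ e p k, R.IsSide e p k ∧ ∃ a : ℝ, a ∈ Set.Icc (0 : ℝ) 1 ∧
      R.white + s * R.right + t * R.left = p + a * e ∧ (f e = 0 ∨ a = 0 ∨ a = 1) := by
    rintro (rfl | rfl)
    · exact ⟨R.left, R.white, _, Or.inr ⟨rfl, rfl, Or.inl rfl⟩, t, ht, by simp, k2⟩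
    · exact ⟨R.left, R.faceR, _, Or.inr ⟨rfl, rfl, Or.inr rfl⟩, t, ht, by simp [faceR], k2⟩
  rcases k2 with h2 | h2
  · rcases k1 with h1 | h1
    · exfalso
      rw [center, lin_f, h1, h2] at hc
      rw [lin_f, h1, h2] at hfx
      linarith
    · exact hL h1
  · exact hR h2

/-- `v` is a corner of `R`. -/
def IsCorner (R : Rhombus) (v : ℂ) : Prop :=
  v = R.white ∨ v = R.faceR ∨ v = R.faceL ∨ v = R.black

theorem IsSide.corner_start {e p : ℂ} {k : ℂ → ℝ} (h : R.IsSide e p k) : R.IsCorner p := by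
  rcases h.start_cases with h | ⟨h | h, -⟩ <;> simp [IsCorner, h]

theorem IsSide.corner_end {e p : ℂ} {k : ℂ → ℝ} (h : R.IsSide e p k) : R.IsCorner (p + e) := by
  rcases h.end_cases with h | h | h <;> simp [IsCorner, h]

end Rhombus

namespace RhombusGraph

variable (T : RhombusGraph)

theorem isCorner_of_mem {R S : Rhombus} (hR : R ∈ T.rhombi) (hS : S ∈ T.rhombi) {v : ℂ}
    (hv : S.IsCorner v) (h : v ∈ R.closedRegion) : R.IsCorner v := by
  rcases hv with rfl | rfl | rfl | rfl
  · left; exact T.white_mem R hR S hS h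
  · rcases T.faceR_mem R hR S hS h with h | h <;> simp [Rhombus.IsCorner, h]
  · rcases T.faceL_mem R hR S hS h with h | h <;> simp [Rhombus.IsCorner, h]
  · right; right; right; exact T.black_mem R hR S hS h

/-- Two rhombi with a common point have a common corner. -/
theorem exists_common_corner {R S : Rhombus} (hR : R ∈ T.rhombi) (hS : S ∈ T.rhombi) {x : ℂ}
    (hxR : x ∈ R.closedRegion) (hxS : x ∈ S.closedRegion) :
    ∃ v, R.IsCorner v ∧ S.IsCorner v := by
  rcases eq_or_ne R S with rfl | hRS
  · exact ⟨_, Or.inl rfl, Or.inl rfl⟩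
  have hdisj : Disjoint R.openRegion S.openRegion := by
    rw [Set.disjoint_iff_inter_eq_empty]
    by_contra h
    exact hRS (T.no_overlap R hR S hS (Set.nonempty_iff_ne_empty.2 h))
  obtain ⟨f, u, h1, h2⟩ := geometric_hahn_banach_open_open R.convex_openRegion
    R.isOpen_openRegion S.convex_openRegion S.isOpen_openRegion hdisj
  have h2' : ∀ z ∈ S.openRegion, (-f) z < -u := fun z hz => by
    simpa using h2 z hz
  have b1 : ∀ z ∈ R.closedRegion, f z ≤ u := fun z hz => Rhombus.le_of_forall_openRegion_lt f h1 hz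
  have b2 : ∀ z ∈ S.closedRegion, (-f) z ≤ -u :=
    fun z hz => Rhombus.le_of_forall_openRegion_lt (-f) h2' hz
  have hfx : f x = u := le_antisymm (b1 x hxR) (by simpa using b2 x hxS)
  obtain ⟨e, p, k, side, a, ⟨ha0, ha1⟩, hx, hfe⟩ := Rhombus.exists_side_of_max_point f b1
    (h1 _ R.center_mem) hxR hfx
  obtain ⟨e', p', k', side', a', ⟨ha0', ha1'⟩, hx', hfe'⟩ := Rhombus.exists_side_of_max_point (-f) b2
    (h2' _ S.center_mem) hxS (by simp [hfx])
  have toR : ∀ v, S.IsCorner v → v ∈ R.closedRegion → ∃ v, R.IsCorner v ∧ S.IsCorner v :=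
    fun v hv hm => ⟨v, T.isCorner_of_mem hR hS hv hm, hv⟩
  have toS : ∀ v, R.IsCorner v → v ∈ S.closedRegion → ∃ v, R.IsCorner v ∧ S.IsCorner v :=
    fun v hv hm => ⟨v, hv, T.isCorner_of_mem hS hR hv hm⟩
  rcases hfe with hfe | rfl | rfl
  · rcases hfe' with hfe' | rfl | rfl
    · have hw : wedge e e' = 0 := by
        by_contra hw
        have hf0 : ∀ z, f z = 0 := by
          intro z
          have := congrArg f (wedge_smul_eq e e' z)
          simp only [← Complex.real_smul, map_add, map_smul, hfe, smul_eq_mul] at this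
          have h0 : f e' = 0 := by simpa using hfe'
          rw [h0] at this
          simpa [hw] using this
        have e1 := h1 _ R.center_mem
        rw [← hfx, hf0, hf0] at e1
        exact lt_irrefl _ e1
      rcases eq_or_eq_neg_of_wedge_eq_zero side.norm_eq side'.norm_eq hw with rfl | rfl
      · rcases le_total a' a with h | h
        · refine toR p' side'.corner_start ?_
          have : p' = p + ((a - a' : ℝ) : ℂ) * e' := by push_cast; linear_combination hx - hx'
          rw [this]; exact side.mem ⟨by linarith, by linarith⟩
        · refine toS p side.corner_start ?_
          have : p = p' + ((a' - a : ℝ) : ℂ) * e' := by push_cast; linear_combination hx' - hx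
          rw [this]; exact side'.mem ⟨by linarith, by linarith⟩
      · rcases le_total (a + a') 1 with h | h
        · refine toR p' side'.corner_start ?_
          have : p' = p + ((a + a' : ℝ) : ℂ) * e := by push_cast; linear_combination hx - hx'
          rw [this]; exact side.mem ⟨by linarith, by linarith⟩
        · refine toR _ side'.corner_end ?_
          have : p' + -e = p + ((a + a' - 1 : ℝ) : ℂ) * e := by
            push_cast; linear_combination hx - hx'
          rw [this]; exact side.mem ⟨by linarith, by linarith⟩
    · refine toR x ?_ hxR
      rw [hx']; simpa using side'.corner_start
    · refine toR x ?_ hxR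
      rw [hx']; simpa using side'.corner_end
  · refine toS x ?_ hxS
    rw [hx]; simpa using side.corner_start
  · refine toS x ?_ hxS
    rw [hx]; simpa using side.corner_end

/-! ### Area bounds, local finiteness and connectedness. -/

section Counting

open MeasureTheory

variable {T}

theorem ball_center_subset {ε : ℝ} {R : Rhombus} (hε : 0 < ε) (h : ε ≤ wedge R.right R.left) :
    Metric.ball R.center (ε / 2) ⊆ R.openRegion := by
  intro z hz
  rw [Metric.mem_ball, dist_eq_norm] at hz
  have h1 := R.coordR_bound (z - R.center)
  have h2 := R.coordL_bound (z - R.center)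
  have k1 : |R.coordR (z - R.center)| < 1 / 2 := by
    nlinarith [abs_nonneg (R.coordR (z - R.center))]
  have k2 : |R.coordL (z - R.center)| < 1 / 2 := by
    nlinarith [abs_nonneg (R.coordL (z - R.center))]
  rw [Rhombus.mem_openRegion]
  have e : z - R.white = (z - R.center) + ((1 / 2 : ℝ) * R.right + (1 / 2 : ℝ) * R.left) := by
    simp only [Rhombus.center]; ring
  rw [e, R.coordR_add, R.coordL_add, R.coordR_comb, R.coordL_comb]
  rw [abs_lt] at k1 k2
  exact ⟨⟨by linarith, by linarith⟩, by linarith, by linarith⟩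

theorem center_dist_white (R : Rhombus) : ‖R.center - R.white‖ ≤ 1 := by
  have e : R.center - R.white = (1 / 2 : ℝ) * R.right + (1 / 2 : ℝ) * R.left := by
    simp only [Rhombus.center]; ring
  rw [e]
  refine (norm_add_le _ _).trans ?_
  rw [norm_mul, norm_mul, R.norm_right, R.norm_left, Complex.norm_real]
  norm_num

/-- The coordinates are bounded by the norm divided by `ε`, so every open rhombus contains the disc
of radius `ε / 2` about its centre. These discs are pairwise disjoint. -/
theorem card_mul_volume_le {ε : ℝ} (hε : 0 < ε) (h : ∀ R ∈ T.rhombi, ε ≤ wedge R.right R.left)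
    (Z : Finset Rhombus) (hZ : ∀ R ∈ Z, R ∈ T.rhombi) (U : Set ℂ)
    (hU : ∀ R ∈ Z, Metric.ball R.center (ε / 2) ⊆ U) :
    (Z.card : ENNReal) * (ENNReal.ofReal (ε / 2) ^ 2 * NNReal.pi) ≤ volume U := by
  have h1 : volume (⋃ R ∈ Z, Metric.ball R.center (ε / 2)) =
      ∑ R ∈ Z, volume (Metric.ball R.center (ε / 2)) := by
    refine measure_biUnion_finset ?_ fun _ _ => measurableSet_ball
    intro R hR S hS hRS
    rw [Function.onFun, Set.disjoint_left]
    intro z hz hz'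
    exact hRS (T.no_overlap R (hZ R hR) S (hZ S hS)
      ⟨z, ball_center_subset hε (h R (hZ R hR)) hz, ball_center_subset hε (h S (hZ S hS)) hz'⟩)
  have h2 : volume (⋃ R ∈ Z, Metric.ball R.center (ε / 2)) ≤ volume U :=
    measure_mono (Set.iUnion₂_subset hU)
  rw [h1] at h2
  simpa [Complex.volume_ball] using h2

theorem BoundedAngles.exists_le_one (hT : T.BoundedAngles) :
    ∃ ε : ℝ, 0 < ε ∧ ε ≤ 1 ∧ ∀ R ∈ T.rhombi, ε ≤ wedge R.right R.left := by
  obtain ⟨ε, h1, h2⟩ := hT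
  refine ⟨min ε 1, lt_min h1 one_pos, min_le_right _ _, fun R hR => (min_le_left _ _).trans ?_⟩
  rw [← wedge_eq_im]
  exact h2 R hR

/-- The number of rhombi in an annulus of bounded width is at most linear in the radius. -/
theorem BoundedAngles.exists_card_annulus_le (hT : T.BoundedAngles) :
    ∃ C : ℝ, 0 < C ∧ ∀ r : ℝ, 4 ≤ r → ∀ Z : Finset Rhombus, (∀ R ∈ Z, R ∈ T.rhombi ∧
      r - 2 ≤ ‖R.white‖ ∧ ‖R.white‖ ≤ r + 2) → (Z.card : ℝ) ≤ C * r := by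
  obtain ⟨ε, hε, hε1, h⟩ := hT.exists_le_one
  -- The discs lie in the annulus between the radii `r - 4` and `r + 4`, whose area is 16πr.
  refine ⟨16 / (ε / 2) ^ 2, by positivity, fun r hr Z hZ => ?_⟩
  have hU := card_mul_volume_le hε h Z (fun R hR => (hZ R hR).1)
    (Metric.ball 0 (r + 4) \ Metric.ball 0 (r - 4)) ?_
  · rw [measure_sdiff (Metric.ball_subset_ball (by linarith)) measurableSet_ball.nullMeasurableSet
      measure_ball_lt_top.ne, Complex.volume_ball, Complex.volume_ball] at hU
    rw [← ENNReal.ofReal_pow (by linarith), ← ENNReal.ofReal_pow (by linarith),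
      ← ENNReal.ofReal_pow (by linarith), show (NNReal.pi : ENNReal) = ENNReal.ofReal Real.pi from by
        rw [ENNReal.ofReal, ← NNReal.coe_real_pi, Real.toNNReal_coe],
      ← ENNReal.ofReal_natCast, ← ENNReal.ofReal_mul (by positivity),
      ← ENNReal.ofReal_mul (by positivity), ← ENNReal.ofReal_mul (by positivity),
      ← ENNReal.ofReal_mul (by positivity), ← ENNReal.ofReal_sub _ (by positivity),
      ENNReal.ofReal_le_ofReal_iff (by nlinarith [Real.pi_pos])] at hU
    have h3 : (Z.card : ℝ) * (ε / 2) ^ 2 ≤ 16 * r := by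
      have : ((Z.card : ℝ) * (ε / 2) ^ 2) * Real.pi ≤ (16 * r) * Real.pi := by linarith
      exact le_of_mul_le_mul_right this Real.pi_pos
    rw [div_mul_eq_mul_div, le_div_iff₀ (by positivity)]
    exact h3
  · intro R hR z hz
    obtain ⟨-, h1, h2⟩ := hZ R hR
    rw [Metric.mem_ball, dist_eq_norm] at hz
    have h3 := center_dist_white R
    have h4 : ‖z - R.white‖ ≤ ‖z - R.center‖ + ‖R.center - R.white‖ := norm_sub_le_norm_sub_add_norm_sub ..
    have h5 : ‖z‖ ≤ ‖z - R.white‖ + ‖R.white‖ := by simpa using norm_add_le (z - R.white) R.white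
    have h6 : ‖R.white‖ ≤ ‖z - R.white‖ + ‖z‖ := by
      rw [norm_sub_rev]; simpa using norm_add_le (R.white - z) z
    simp only [Set.mem_sdiff, Metric.mem_ball, dist_zero_right, not_lt]
    constructor <;> linarith

theorem BoundedAngles.finite_white (hT : T.BoundedAngles) (r : ℝ) :
    {R | R ∈ T.rhombi ∧ ‖R.white‖ ≤ r}.Finite := by
  obtain ⟨ε, hε, hε1, h⟩ := hT.exists_le_one
  by_contra hinf
  have hpos : (ENNReal.ofReal (ε / 2) ^ 2 * NNReal.pi) ≠ 0 := by
    simp [hε, NNReal.pi_ne_zero]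
  have hlt : volume (Metric.ball (0 : ℂ) (r + 3)) ≠ ⊤ := measure_ball_lt_top.ne
  obtain ⟨n, hn⟩ := ENNReal.exists_nat_mul_gt hpos hlt
  obtain ⟨Z, hZ, hc⟩ := Set.Infinite.exists_subset_card_eq hinf n
  have := card_mul_volume_le hε h Z (fun R hR => (hZ hR).1) (Metric.ball 0 (r + 3)) ?_
  · rw [hc] at this
    exact absurd hn (not_lt.2 this)
  · intro R hR z hz
    have h2 := (hZ hR).2
    rw [Metric.mem_ball, dist_eq_norm] at hz
    have h3 := center_dist_white R
    have h4 : ‖z - R.white‖ ≤ ‖z - R.center‖ + ‖R.center - R.white‖ := norm_sub_le_norm_sub_add_norm_sub ..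
    have h5 : ‖z‖ ≤ ‖z - R.white‖ + ‖R.white‖ := by simpa using norm_add_le (z - R.white) R.white
    simp only [Metric.mem_ball, dist_zero_right]
    linarith

theorem BoundedAngles.finite_meet (hT : T.BoundedAngles) (r : ℝ) :
    {R | R ∈ T.rhombi ∧ ∃ z ∈ R.closedRegion, ‖z‖ ≤ r}.Finite := by
  refine (hT.finite_white (r + 2)).subset ?_
  rintro R ⟨hR, z, hz, hzr⟩
  refine ⟨hR, ?_⟩
  have h2 := R.dist_white_le hz
  have h6 : ‖R.white‖ ≤ ‖z - R.white‖ + ‖z‖ := by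
    rw [norm_sub_rev]; simpa using norm_add_le (R.white - z) z
  linarith

/-- A small ball around `p` meets only rhombi that contain `p`. -/
theorem BoundedAngles.exists_star (hT : T.BoundedAngles) (p : ℂ) :
    ∃ δ > 0, ∀ R ∈ T.rhombi, ∀ y ∈ Metric.ball p δ, y ∈ R.closedRegion → p ∈ R.closedRegion := by
  have hfin : {R | (R ∈ T.rhombi ∧ ∃ z ∈ R.closedRegion, ‖z‖ ≤ ‖p‖ + 1) ∧
      p ∉ R.closedRegion}.Finite :=
    (hT.finite_meet (‖p‖ + 1)).subset fun R hR => hR.1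
  have hcl : IsClosed (⋃ R ∈ {R | (R ∈ T.rhombi ∧
      ∃ z ∈ R.closedRegion, ‖z‖ ≤ ‖p‖ + 1) ∧ p ∉ R.closedRegion}, R.closedRegion) :=
    hfin.isClosed_biUnion fun R _ => R.isClosed_closedRegion
  have hp : p ∈ (⋃ R ∈ {R | (R ∈ T.rhombi ∧
      ∃ z ∈ R.closedRegion, ‖z‖ ≤ ‖p‖ + 1) ∧ p ∉ R.closedRegion}, R.closedRegion)ᶜ := by
    simp only [Set.mem_compl_iff, Set.mem_iUnion, not_exists]
    exact fun R hR hp => hR.2 hp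
  obtain ⟨δ, hδ, hball⟩ := Metric.isOpen_iff.1 hcl.isOpen_compl p hp
  refine ⟨min δ 1, lt_min hδ one_pos, fun R hR y hy hyR => ?_⟩
  rw [Metric.mem_ball, lt_min_iff] at hy
  by_contra hpR
  refine hball hy.1 ?_
  simp only [Set.mem_iUnion]
  refine ⟨R, ⟨⟨hR, y, hyR, ?_⟩, hpR⟩, hyR⟩
  have := hy.2
  rw [dist_eq_norm] at this
  have h5 : ‖y‖ ≤ ‖y - p‖ + ‖p‖ := by simpa using norm_add_le (y - p) p
  linarith

/-- A function that is constant on every rhombus is constant on preconnected sets. -/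
theorem BoundedAngles.eq_of_eq_on_rhombi (hT : T.BoundedAngles) {α : Type*} (f : ℂ → α) {U : Set ℂ}
    (hU : IsPreconnected U)
    (hf : ∀ R ∈ T.rhombi, ∀ x ∈ R.closedRegion ∩ U, ∀ y ∈ R.closedRegion ∩ U, f x = f y)
    {x y : ℂ} (hx : x ∈ U) (hy : y ∈ U) : f x = f y := by
  have hpc : PreconnectedSpace U := isPreconnected_iff_preconnectedSpace.1 hU
  have hlc : IsLocallyConstant (fun z : U => f z) := by
    rw [IsLocallyConstant.iff_eventually_eq]
    intro p
    obtain ⟨δ, hδ, hs⟩ := hT.exists_star (p : ℂ)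
    filter_upwards [Metric.ball_mem_nhds p hδ] with z hz
    obtain ⟨R, hR, hzR⟩ := T.covers (z : ℂ)
    exact hf R hR _ ⟨hzR, z.2⟩ _ ⟨hs R hR z hz hzR, p.2⟩
  exact hlc.apply_eq_of_preconnectedSpace ⟨x, hx⟩ ⟨y, hy⟩

end Counting

end RhombusGraph

/-! ### Fans: the rhombi around a white or a black vertex. -/

theorem exists_pos_mul_add_pos {a b : ℝ} (ha : 0 < a) (hb : 0 < b) (a' b' : ℝ) :
    ∃ K : ℝ, 0 < K ∧ 0 < K * a + a' ∧ 0 < K * b + b' := by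
  refine ⟨(|a'| + 1) / a + (|b'| + 1) / b, by positivity, ?_, ?_⟩
  · have : ((|a'| + 1) / a + (|b'| + 1) / b) * a = |a'| + 1 + (|b'| + 1) / b * a := by
      field_simp
    have h2 : 0 ≤ (|b'| + 1) / b * a := by positivity
    rw [this]; linarith [neg_abs_le a']
  · have : ((|a'| + 1) / a + (|b'| + 1) / b) * b = (|a'| + 1) / a * b + (|b'| + 1) := by
      field_simp
    have h2 : 0 ≤ (|a'| + 1) / a * b := by positivity
    rw [this]; linarith [neg_abs_le b']

theorem wedge_exp (a b : ℝ) :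
    wedge (Complex.exp (a * Complex.I)) (Complex.exp (b * Complex.I)) = Real.sin (b - a) := by
  simp only [wedge, Complex.exp_ofReal_mul_I_re, Complex.exp_ofReal_mul_I_im, Real.sin_sub]
  ring

theorem exp_eq_exp_iff_mod {a b : ℝ} :
    Complex.exp (a * Complex.I) = Complex.exp (b * Complex.I) ↔ ∃ n : ℤ, a = b + n * (2 * Real.pi) := by
  rw [Complex.exp_eq_exp_iff_exists_int]
  refine exists_congr fun n => ?_
  constructor
  · intro h
    have := congrArg Complex.im h
    simpa using this
  · intro h
    rw [h]; push_cast; ring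

namespace Rhombus

variable (R : Rhombus)

/-- The angle of the rhombus at its white (and black) corner. -/
noncomputable def angle : ℝ := (starRingEnd ℂ R.right * R.left).arg

theorem conj_right_mul_left : starRingEnd ℂ R.right * R.left = Complex.exp (R.angle * Complex.I) := by
  have := Complex.norm_mul_exp_arg_mul_I (starRingEnd ℂ R.right * R.left)
  rw [norm_mul, Complex.norm_conj, R.norm_right, R.norm_left] at this
  simpa [angle] using this.symm

theorem angle_pos : 0 < R.angle := by
  refine lt_of_le_of_ne (Complex.arg_nonneg_iff.2 R.ccw.le) fun h => ?_
  have h1 := R.ccw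
  rw [conj_right_mul_left, ← h] at h1
  simp at h1

theorem angle_lt_pi : R.angle < Real.pi := by
  refine lt_of_le_of_ne (Complex.arg_le_pi _) fun h => ?_
  have h1 := R.ccw
  rw [conj_right_mul_left, h] at h1
  simp at h1

theorem right_mul_conj : R.right * starRingEnd ℂ R.right = 1 := by
  rw [Complex.mul_conj, Complex.normSq_eq_norm_sq, R.norm_right]; simp

theorem left_eq : R.left = R.right * Complex.exp (R.angle * Complex.I) := by
  rw [← conj_right_mul_left, ← mul_assoc, right_mul_conj, one_mul]

theorem left_eq_exp {α : ℝ} (h : R.right = Complex.exp (α * Complex.I)) :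
    R.left = Complex.exp (((α + R.angle : ℝ) : ℂ) * Complex.I) := by
  rw [left_eq, h, ← Complex.exp_add]; congr 1; push_cast; ring

theorem right_eq_exp {β : ℝ} (h : R.left = Complex.exp (β * Complex.I)) :
    R.right = Complex.exp (((β - R.angle : ℝ) : ℂ) * Complex.I) := by
  have h1 := R.left_eq
  have h2 : R.right = R.left * Complex.exp (-(R.angle * Complex.I)) := by
    rw [h1, mul_assoc, ← Complex.exp_add]; simp
  rw [h2, h, ← Complex.exp_add]; congr 1; push_cast; ring

theorem angle_eq_of_exp {α β : ℝ} (hr : R.right = Complex.exp (α * Complex.I))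
    (hl : R.left = Complex.exp (β * Complex.I)) (h1 : α < β) (h2 : β < α + 2 * Real.pi) :
    β = α + R.angle := by
  have h3 := R.left_eq_exp hr
  rw [hl, exp_eq_exp_iff_mod] at h3
  obtain ⟨n, hn⟩ := h3
  have := R.angle_pos
  have := R.angle_lt_pi
  have hp := Real.pi_pos
  have h4 : n = 0 := by
    have a1 : (n : ℝ) < 1 := by
      by_contra! h
      nlinarith
    have a2 : (-1 : ℝ) < n := by
      by_contra! h
      nlinarith
    have b1 : n < 1 := by exact_mod_cast a1
    have b2 : -1 < n := by exact_mod_cast a2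
    omega
  rw [hn, h4]; simp

theorem coord_exp_pos {α γ : ℝ} (hr : R.right = Complex.exp (α * Complex.I))
    (h1 : α < γ) (h2 : γ < α + R.angle) :
    0 < R.coordR (Complex.exp (γ * Complex.I)) ∧ 0 < R.coordL (Complex.exp (γ * Complex.I)) := by
  have hl := R.left_eq_exp hr
  have := R.angle_lt_pi
  constructor
  · refine div_pos ?_ R.wedge_pos
    rw [hl, wedge_exp]
    exact Real.sin_pos_of_pos_of_lt_pi (by linarith) (by linarith)
  · refine div_pos ?_ R.wedge_pos
    rw [hr, wedge_exp]
    exact Real.sin_pos_of_pos_of_lt_pi (by linarith) (by linarith)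

end Rhombus

/-- A finite family of rhombi that have, up to a common sign, a white corner in common, with
sectors that cover the plane without overlap. -/
structure IsFan (F : Finset Rhombus) : Prop where
  cover : ∀ ρ : ℂ, ∃ R ∈ F, 0 ≤ R.coordR ρ ∧ 0 ≤ R.coordL ρ
  disjoint : ∀ R ∈ F, ∀ S ∈ F, ∀ ρ : ℂ, 0 < R.coordR ρ → 0 < R.coordL ρ →
    0 < S.coordR ρ → 0 < S.coordL ρ → R = S

namespace IsFan

variable {F : Finset Rhombus} (hF : IsFan F)
include hF

/-- Two sectors ending at the same left side overlap just before it: a large multiple of the common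
side plus `R.right` is interior to both. -/
theorem left_injOn : Set.InjOn Rhombus.left (F : Set Rhombus) := by
  intro R hR S hS h
  obtain ⟨K, hK, h1, -⟩ := exists_pos_mul_add_pos one_pos one_pos (S.coordL R.right) 0
  refine hF.disjoint R hR S hS (R.right + K * R.left) ?_ ?_ ?_ ?_
  · simp [R.coordR_add, R.coordR_mul]
  · simpa [R.coordL_add, R.coordL_mul] using hK
  · rw [h, S.coordR_add, S.coordR_mul, S.coordR_left, mul_zero, add_zero]
    refine div_pos ?_ S.wedge_pos
    rw [← h]; exact R.wedge_pos
  · rw [h, S.coordL_add, S.coordL_mul, S.coordL_left]; linarith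

theorem right_injOn : Set.InjOn Rhombus.right (F : Set Rhombus) := by
  intro R hR S hS h
  obtain ⟨K, hK, h1, -⟩ := exists_pos_mul_add_pos one_pos one_pos (S.coordR R.left) 0
  refine hF.disjoint R hR S hS (R.left + K * R.right) ?_ ?_ ?_ ?_
  · simpa [R.coordR_add, R.coordR_mul] using hK
  · simp [R.coordL_add, R.coordL_mul]
  · rw [h, S.coordR_add, S.coordR_mul, S.coordR_right]; linarith
  · rw [h, S.coordL_add, S.coordL_mul, S.coordL_right, mul_zero, add_zero]
    refine div_pos ?_ S.wedge_pos
    rw [← h]; exact R.wedge_pos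

/-- Otherwise a slight turn from `R.left` towards `R.right` would be a direction interior to both
sectors, so `R = S`; but a left side is not interior to its own sector. -/
theorem not_left_interior {R S : Rhombus} (hR : R ∈ F) (hS : S ∈ F) :
    ¬(0 < S.coordR R.left ∧ 0 < S.coordL R.left) := by
  rintro ⟨h1, h2⟩
  obtain ⟨K, hK, h3, h4⟩ := exists_pos_mul_add_pos h1 h2 (S.coordR R.right) (S.coordL R.right)
  have := hF.disjoint R hR S hS (K * R.left + R.right) (by simp [R.coordR_add, R.coordR_mul])
    (by simpa [R.coordL_add, R.coordL_mul] using hK) (by rwa [S.coordR_add, S.coordR_mul])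
    (by rwa [S.coordL_add, S.coordL_mul])
  rw [← this, R.coordR_left] at h1
  exact lt_irrefl _ h1

/-- The vectors `k * R.left - R.right` point just beyond the left side of `R`. Since the fan is
finite, one sector `S` contains them for infinitely many `k`, so its closure contains `R.left`. The
interior of `S` is excluded by disjointness, and the left side of `S` by injectivity since `S ≠ R`;
the right side remains. -/
theorem exists_right_eq_left {R : Rhombus} (hR : R ∈ F) : ∃ S ∈ F, S.right = R.left := by
  have hfr : ∃ S ∈ F, ∃ᶠ k : ℕ in Filter.atTop, 0 ≤ S.coordR ((k : ℝ) * R.left - R.right) ∧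
      0 ≤ S.coordL ((k : ℝ) * R.left - R.right) := by
    by_contra! h
    have h2 : ∀ᶠ k : ℕ in Filter.atTop, ∀ S ∈ F, ¬(0 ≤ S.coordR ((k : ℝ) * R.left - R.right) ∧
        0 ≤ S.coordL ((k : ℝ) * R.left - R.right)) := by
      rw [Filter.eventually_all_finset]
      intro S hS
      exact (h S hS).mono fun k hk h' => absurd h'.2 (not_le.2 (hk h'.1))
    obtain ⟨k, hk⟩ := h2.exists
    obtain ⟨S, hS, h3⟩ := hF.cover ((k : ℝ) * R.left - R.right)
    exact hk S hS h3
  obtain ⟨S, hS, hfr⟩ := hfr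
  have lim : ∀ c d : ℝ, (∃ᶠ k : ℕ in Filter.atTop, 0 ≤ (k : ℝ) * c - d) → 0 ≤ c := by
    intro c d h
    by_contra! hc
    obtain ⟨N, hN⟩ := exists_nat_gt (d / c)
    obtain ⟨k, hk, h1⟩ := Filter.frequently_atTop.1 h N
    have : (N : ℝ) ≤ k := by exact_mod_cast hk
    rw [div_lt_iff_of_neg hc] at hN
    nlinarith
  have hc1 : 0 ≤ S.coordR R.left := lim _ (S.coordR R.right) (hfr.mono fun k hk => by
    simpa only [S.coordR_sub, S.coordR_mul] using hk.1)
  have hc2 : 0 ≤ S.coordL R.left := lim _ (S.coordL R.right) (hfr.mono fun k hk => by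
    simpa only [S.coordL_sub, S.coordL_mul] using hk.2)
  have hne : R ≠ S := by
    rintro rfl
    obtain ⟨k, hk⟩ := hfr.exists
    have := hk.1
    rw [R.coordR_sub, R.coordR_mul] at this
    norm_num at this
  have hS' := S.eq_coord R.left
  rcases hc1.eq_or_lt with h0 | h0
  · exfalso
    rw [← h0, Complex.ofReal_zero, zero_mul, zero_add] at hS'
    have hn := congrArg norm hS'
    rw [norm_mul, R.norm_left, S.norm_left, Complex.norm_real, Real.norm_of_nonneg hc2] at hn
    rw [show S.coordL R.left = 1 by linarith, Complex.ofReal_one, one_mul] at hS'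
    exact hne (hF.left_injOn hR hS hS')
  · rcases hc2.eq_or_lt with h0' | h0'
    · rw [← h0', Complex.ofReal_zero, zero_mul, add_zero] at hS'
      have hn := congrArg norm hS'
      rw [norm_mul, R.norm_left, S.norm_right, Complex.norm_real, Real.norm_of_nonneg hc1] at hn
      rw [show S.coordR R.left = 1 by linarith, Complex.ofReal_one, one_mul] at hS'
      exact ⟨S, hS, hS'.symm⟩
    · exact absurd ⟨h0, h0'⟩ (hF.not_left_interior hR hS)

-- One inclusion is the existence of the next rhombus; equality follows because both images have as
-- many elements as `F`. Hence each side of the fan is the left side of exactly one rhombus and the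
-- right side of exactly one, which is the source of every cancellation around a vertex.
open Classical in
theorem image_left_eq_image_right : F.image Rhombus.left = F.image Rhombus.right := by
  refine Finset.eq_of_subset_of_card_le ?_ ?_
  · intro e he
    obtain ⟨R, hR, rfl⟩ := Finset.mem_image.1 he
    obtain ⟨S, hS, h⟩ := hF.exists_right_eq_left hR
    exact Finset.mem_image.2 ⟨S, hS, h⟩
  · rw [Finset.card_image_of_injOn hF.left_injOn, Finset.card_image_of_injOn hF.right_injOn]

theorem exists_left_eq_right {R : Rhombus} (hR : R ∈ F) : ∃ S ∈ F, S.left = R.right := by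
  classical
  have : R.right ∈ F.image Rhombus.left := by
    rw [hF.image_left_eq_image_right]; exact Finset.mem_image_of_mem _ hR
  obtain ⟨S, hS, h⟩ := Finset.mem_image.1 this
  exact ⟨S, hS, h⟩

theorem sum_left_eq_sum_right {M : Type*} [AddCommMonoid M] (f : ℂ → M) :
    ∑ R ∈ F, f R.left = ∑ R ∈ F, f R.right := by
  classical
  rw [← Finset.sum_image (f := f) hF.left_injOn, hF.image_left_eq_image_right,
    Finset.sum_image hF.right_injOn]

/-- No side of the fan lies strictly inside one of its sectors. -/
theorem angle_le_of_side {R S : Rhombus} (hR : R ∈ F) (hS : S ∈ F) {α γ : ℝ}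
    (hr : R.right = Complex.exp (α * Complex.I)) (hγ : S.left = Complex.exp (γ * Complex.I))
    (h : α < γ) : α + R.angle ≤ γ := by
  by_contra! h2
  apply hF.not_left_interior hS hR
  rw [hγ]
  exact R.coord_exp_pos hr h h2

/-- The rhombi in the sector from the side of direction `a` to the side of direction `b`. -/
theorem sum_sector {M : Type*} [AddCommGroup M] (f : ℂ → M) {a b : ℝ} (hab : a < b)
    (hab' : b < a + 2 * Real.pi)
    (ha : ∃ R ∈ F, R.right = Complex.exp (a * Complex.I))
    (hb : ∃ R ∈ F, R.left = Complex.exp (b * Complex.I))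
    (Z : Finset Rhombus) (hZ : ∀ R, R ∈ Z ↔ R ∈ F ∧ ∃ α β : ℝ, α < β ∧
      R.right = Complex.exp (α * Complex.I) ∧ R.left = Complex.exp (β * Complex.I) ∧
      a ≤ α ∧ β ≤ b) :
    ∑ R ∈ Z, (f R.left - f R.right) =
      f (Complex.exp (b * Complex.I)) - f (Complex.exp (a * Complex.I)) := by
  classical
  have hZF : Z ⊆ F := fun R hR => ((hZ R).1 hR).1
  obtain ⟨Ra, hRa, hRa'⟩ := ha
  obtain ⟨Rb, hRb, hRb'⟩ := hb
  have hp := Real.pi_pos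
  have nomod : ∀ x y : ℝ, x < y → y < x + 2 * Real.pi →
      Complex.exp (x * Complex.I) ≠ Complex.exp (y * Complex.I) := by
    intro x y h1 h2 h
    obtain ⟨n, hn⟩ := exp_eq_exp_iff_mod.1 h
    have a1 : (n : ℝ) < 0 := by
      by_contra! h
      nlinarith
    have a2 : (-1 : ℝ) < n := by
      by_contra! h
      nlinarith
    have b1 : n < 0 := by exact_mod_cast a1
    have b2 : -1 < n := by exact_mod_cast a2
    omega
  have hright : ∀ R ∈ F, ∀ α : ℝ, R.right = Complex.exp (α * Complex.I) → a ≤ α → α < b → R ∈ Z := by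
    intro R hR α h1 h2 h3
    exact (hZ R).2 ⟨hR, α, α + R.angle, by linarith [R.angle_pos], h1, R.left_eq_exp h1, h2,
      hF.angle_le_of_side hR hRb h1 hRb' h3⟩
  have hleft : ∀ R ∈ F, ∀ β : ℝ, R.left = Complex.exp (β * Complex.I) → a < β → β ≤ b → R ∈ Z := by
    intro R hR β h1 h2 h3
    have h4 := R.right_eq_exp h1
    refine (hZ R).2 ⟨hR, β - R.angle, β, by linarith [R.angle_pos], h4, h1, ?_, h3⟩
    by_contra! h5
    obtain ⟨S, hS, hS'⟩ := hF.exists_left_eq_right hRa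
    have := hF.angle_le_of_side hR hS h4 (hS'.trans hRa') h5
    linarith
  -- A side strictly inside the sector is a left side and a right side of rhombi in `Z`; only the
  -- two extreme sides are unpaired. Comparing the sums of `f` over the two sets gives the
  -- telescoped value.
  have hset : insert (Complex.exp (a * Complex.I)) (Z.image Rhombus.left) =
      insert (Complex.exp (b * Complex.I)) (Z.image Rhombus.right) := by
    apply Finset.Subset.antisymm
    · intro e he
      rw [Finset.mem_insert] at he
      rcases he with rfl | he
      · exact Finset.mem_insert_of_mem (Finset.mem_image.2 ⟨Ra, hright Ra hRa a hRa' le_rfl hab, hRa'⟩)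
      · obtain ⟨R, hR, rfl⟩ := Finset.mem_image.1 he
        obtain ⟨hRF, α, β, h1, h2, h3, h4, h5⟩ := (hZ R).1 hR
        rcases h5.eq_or_lt with rfl | h5
        · rw [h3]; exact Finset.mem_insert_self _ _
        · obtain ⟨S, hS, hS'⟩ := hF.exists_right_eq_left hRF
          exact Finset.mem_insert_of_mem (Finset.mem_image.2
            ⟨S, hright S hS β (hS'.trans h3) (by linarith) h5, hS'⟩)
    · intro e he
      rw [Finset.mem_insert] at he
      rcases he with rfl | he
      · exact Finset.mem_insert_of_mem (Finset.mem_image.2 ⟨Rb, hleft Rb hRb b hRb' hab le_rfl, hRb'⟩)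
      · obtain ⟨R, hR, rfl⟩ := Finset.mem_image.1 he
        obtain ⟨hRF, α, β, h1, h2, h3, h4, h5⟩ := (hZ R).1 hR
        rcases h4.eq_or_lt with rfl | h4
        · rw [h2]; exact Finset.mem_insert_self _ _
        · obtain ⟨S, hS, hS'⟩ := hF.exists_left_eq_right hRF
          exact Finset.mem_insert_of_mem (Finset.mem_image.2
            ⟨S, hleft S hS α (hS'.trans h2) h4 (by linarith), hS'⟩)
  have hna : Complex.exp (a * Complex.I) ∉ Z.image Rhombus.left := by
    intro h
    obtain ⟨R, hR, h⟩ := Finset.mem_image.1 h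
    obtain ⟨hRF, α, β, h1, h2, h3, h4, h5⟩ := (hZ R).1 hR
    exact nomod a β (by linarith) (by linarith) (h.symm.trans h3)
  have hnb : Complex.exp (b * Complex.I) ∉ Z.image Rhombus.right := by
    intro h
    obtain ⟨R, hR, h⟩ := Finset.mem_image.1 h
    obtain ⟨hRF, α, β, h1, h2, h3, h4, h5⟩ := (hZ R).1 hR
    exact nomod α b (by linarith) (by linarith) (h2.symm.trans h)
  have hs := congrArg (fun s => ∑ e ∈ s, f e) hset
  simp only [Finset.sum_insert hna, Finset.sum_insert hnb] at hs
  rw [Finset.sum_image (hF.left_injOn.mono (by exact_mod_cast hZF)),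
    Finset.sum_image (hF.right_injOn.mono (by exact_mod_cast hZF))] at hs
  rw [Finset.sum_sub_distrib]
  rw [sub_eq_sub_iff_add_eq_add, add_comm, hs, add_comm]

/-- Measure arguments in [a, a + 2π), where `a` is the direction of a chosen side. Then the angle of
each rhombus is the argument of its left side minus that of its right side, except for the one
rhombus `S₀` ending at the chosen side, where 2π has to be added. The differences cancel in the sum.
-/
theorem sum_angle : ∑ R ∈ F, R.angle = 2 * Real.pi := by
  classical
  obtain ⟨R₀, hR₀, -⟩ := hF.cover 0
  obtain ⟨S₀, hS₀, hS₀'⟩ := hF.exists_left_eq_right hR₀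
  have hp := Real.two_pi_pos
  set a := R₀.right.arg with ha
  have hRa : R₀.right = Complex.exp (a * Complex.I) := by
    have := Complex.norm_mul_exp_arg_mul_I R₀.right
    rw [R₀.norm_right] at this
    simpa using this.symm
  set f : ℂ → ℝ := fun e => toIcoMod hp a e.arg with hf
  have hfexp : ∀ x : ℝ, a ≤ x → x < a + 2 * Real.pi → f (Complex.exp (x * Complex.I)) = x := by
    intro x h1 h2
    have h3 : Complex.exp (((Complex.exp (x * Complex.I)).arg : ℂ) * Complex.I) =
        Complex.exp (x * Complex.I) := by
      have := Complex.norm_mul_exp_arg_mul_I (Complex.exp (x * Complex.I))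
      rw [Complex.norm_exp_ofReal_mul_I] at this
      simpa using this
    obtain ⟨n, hn⟩ := exp_eq_exp_iff_mod.1 h3
    simp only [hf, hn]
    rw [← zsmul_eq_mul, toIcoMod_add_zsmul]
    exact (toIcoMod_eq_self hp).2 ⟨h1, h2⟩
  have hfval : ∀ e : ℂ, ‖e‖ = 1 → ∃ x : ℝ, a ≤ x ∧ x < a + 2 * Real.pi ∧
      e = Complex.exp (x * Complex.I) := by
    intro e he
    have h1 : e = Complex.exp (e.arg * Complex.I) := by
      have := Complex.norm_mul_exp_arg_mul_I e
      rw [he] at this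
      simpa using this.symm
    refine ⟨toIcoMod hp a e.arg, (toIcoMod_mem_Ico hp a _).1, (toIcoMod_mem_Ico hp a _).2, ?_⟩
    refine h1.trans (exp_eq_exp_iff_mod.2 ⟨toIcoDiv hp a e.arg, ?_⟩)
    rw [← zsmul_eq_mul, toIcoMod_add_toIcoDiv_zsmul]
  have key : ∀ R ∈ F, R.angle = f R.left - f R.right + if R = S₀ then 2 * Real.pi else 0 := by
    intro R hR
    obtain ⟨x, h1, h2, h3⟩ := hfval R.right R.norm_right
    have hl := R.left_eq_exp h3
    have hfr : f R.right = x := by rw [h3]; exact hfexp x h1 h2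
    rcases lt_trichotomy (x + R.angle) (a + 2 * Real.pi) with h | h | h
    · have hfl : f R.left = x + R.angle := by
        rw [hl]; exact hfexp _ (by linarith [R.angle_pos]) h
      rw [if_neg, hfl, hfr]
      · ring
      · rintro rfl
        rw [hS₀', hRa] at hfl
        rw [hfexp a le_rfl (by linarith)] at hfl
        linarith [R.angle_pos]
    · have hl' : R.left = Complex.exp (a * Complex.I) := by
        rw [hl, h]; exact exp_eq_exp_iff_mod.2 ⟨1, by simp⟩
      have : R = S₀ := hF.left_injOn hR hS₀ (hl'.trans (hRa.symm.trans hS₀'.symm))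
      rw [if_pos this, hfr, hl', hfexp a le_rfl (by linarith)]
      linarith
    · exfalso
      have hγ : S₀.left = Complex.exp (((a + 2 * Real.pi : ℝ) : ℂ) * Complex.I) := by
        rw [hS₀', hRa]; exact exp_eq_exp_iff_mod.2 ⟨-1, by push_cast; ring⟩
      have := hF.angle_le_of_side hR hS₀ h3 hγ (by linarith)
      linarith
  rw [Finset.sum_congr rfl key, Finset.sum_add_distrib, Finset.sum_sub_distrib,
    hF.sum_left_eq_sum_right f, sub_self, zero_add, Finset.sum_ite_eq' F S₀, if_pos hS₀]

end IsFan

namespace RhombusGraph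

variable {T : RhombusGraph}

theorem BoundedAngles.finite_white_eq (hT : T.BoundedAngles) (v : ℂ) :
    {R | R ∈ T.rhombi ∧ R.white = v}.Finite :=
  (hT.finite_white ‖v‖).subset fun R hR => ⟨hR.1, by rw [hR.2]⟩

theorem BoundedAngles.finite_black_eq (hT : T.BoundedAngles) (v : ℂ) :
    {R | R ∈ T.rhombi ∧ R.black = v}.Finite :=
  (hT.finite_meet ‖v‖).subset fun R hR => ⟨hR.1, v, hR.2 ▸ R.black_mem, le_rfl⟩

/-- The rhombi around a white vertex. -/
noncomputable def BoundedAngles.whiteFan (hT : T.BoundedAngles) (v : ℂ) : Finset Rhombus :=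
  (hT.finite_white_eq v).toFinset

/-- The rhombi around a black vertex. -/
noncomputable def BoundedAngles.blackFan (hT : T.BoundedAngles) (v : ℂ) : Finset Rhombus :=
  (hT.finite_black_eq v).toFinset

theorem BoundedAngles.mem_whiteFan (hT : T.BoundedAngles) {v : ℂ} {R : Rhombus} :
    R ∈ hT.whiteFan v ↔ R ∈ T.rhombi ∧ R.white = v := by simp [whiteFan]

theorem BoundedAngles.mem_blackFan (hT : T.BoundedAngles) {v : ℂ} {R : Rhombus} :
    R ∈ hT.blackFan v ↔ R ∈ T.rhombi ∧ R.black = v := by simp [blackFan]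

theorem exists_small (a b c d : ℝ) (ha : 0 < a) (hb : 0 < b) (hc : 0 < c) (hd : 0 < d) :
    ∃ t : ℝ, 0 < t ∧ t * a < 1 ∧ t * b < 1 ∧ t * c < 1 ∧ t * d < 1 := by
  refine ⟨1 / (a + b + c + d), by positivity, ?_, ?_, ?_, ?_⟩ <;>
    rw [one_div_mul_eq_div, div_lt_one (by positivity)] <;> linarith

/-- A short displacement from `v` in any direction lands in a rhombus that contains `v`, and by the
colouring `v` is its white corner; rescaling reads off the signs of the coordinates. Overlapping
sectors would give overlapping open rhombi near `v`. -/
theorem BoundedAngles.isFan_white (hT : T.BoundedAngles) {v : ℂ} (hv : T.IsWhite v) :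
    IsFan (hT.whiteFan v) := by
  obtain ⟨R₀, hR₀, hv⟩ := hv
  constructor
  · intro ρ
    obtain ⟨δ, hδ, hs⟩ := hT.exists_star v
    set t : ℝ := δ / (2 * (‖ρ‖ + 1)) with ht
    have htpos : 0 < t := by positivity
    obtain ⟨R, hR, hm⟩ := T.covers (v + t * ρ)
    have hball : v + t * ρ ∈ Metric.ball v δ := by
      rw [Metric.mem_ball, dist_eq_norm, add_sub_cancel_left, norm_mul, Complex.norm_real,
        Real.norm_of_nonneg htpos.le, ht, div_mul_eq_mul_div, div_lt_iff₀ (by positivity)]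
      nlinarith [norm_nonneg ρ]
    have hw : v = R.white := hv ▸ T.white_mem R hR R₀ hR₀ (hv ▸ hs R hR _ hball hm)
    refine ⟨R, hT.mem_whiteFan.2 ⟨hR, hw.symm⟩, ?_⟩
    rw [Rhombus.mem_closedRegion, ← hw, add_sub_cancel_left, R.coordR_mul, R.coordL_mul] at hm
    exact ⟨nonneg_of_mul_nonneg_right hm.1.1 htpos, nonneg_of_mul_nonneg_right hm.2.1 htpos⟩
  · intro R hR S hS ρ h1 h2 h3 h4
    rw [hT.mem_whiteFan] at hR hS
    obtain ⟨t, ht, k1, k2, k3, k4⟩ := exists_small _ _ _ _ h1 h2 h3 h4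
    refine T.no_overlap R hR.1 S hS.1 ⟨v + t * ρ, ?_, ?_⟩
    · rw [Rhombus.mem_openRegion, hR.2, add_sub_cancel_left, R.coordR_mul, R.coordL_mul]
      exact ⟨⟨by positivity, k1⟩, by positivity, k2⟩
    · rw [Rhombus.mem_openRegion, hS.2, add_sub_cancel_left, S.coordR_mul, S.coordL_mul]
      exact ⟨⟨by positivity, k3⟩, by positivity, k4⟩

theorem BoundedAngles.isFan_black (hT : T.BoundedAngles) {v : ℂ} (hv : T.IsBlack v) :
    IsFan (hT.blackFan v) := by
  obtain ⟨R₀, hR₀, hv⟩ := hv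
  -- Seen from the black corner the sides point inwards, so displacements are taken as `v - x`; this
  -- is the common sign allowed in the notion of a fan.
  have hsub : ∀ R : Rhombus, R.black = v → ∀ x : ℂ,
      R.coordR (v - x - R.white) = 1 - R.coordR x ∧ R.coordL (v - x - R.white) = 1 - R.coordL x := by
    rintro R rfl x
    simp only [Rhombus.black, R.coordR_sub, R.coordL_sub, R.coordR_add, R.coordL_add,
      R.coordR_right, R.coordR_left, R.coordL_right, R.coordL_left]
    constructor <;> ring
  constructor
  · intro ρ
    obtain ⟨δ, hδ, hs⟩ := hT.exists_star v
    set t : ℝ := δ / (2 * (‖ρ‖ + 1)) with ht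
    have htpos : 0 < t := by positivity
    obtain ⟨R, hR, hm⟩ := T.covers (v - t * ρ)
    have hball : v - t * ρ ∈ Metric.ball v δ := by
      rw [Metric.mem_ball, dist_eq_norm, sub_sub_cancel_left, norm_neg, norm_mul, Complex.norm_real,
        Real.norm_of_nonneg htpos.le, ht, div_mul_eq_mul_div, div_lt_iff₀ (by positivity)]
      nlinarith [norm_nonneg ρ]
    have hw : v = R.black := hv ▸ T.black_mem R hR R₀ hR₀ (hv ▸ hs R hR _ hball hm)
    refine ⟨R, hT.mem_blackFan.2 ⟨hR, hw.symm⟩, ?_⟩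
    rw [Rhombus.mem_closedRegion, (hsub R hw.symm _).1, (hsub R hw.symm _).2,
      R.coordR_mul, R.coordL_mul] at hm
    exact ⟨nonneg_of_mul_nonneg_right (by linarith [hm.1.2]) htpos,
      nonneg_of_mul_nonneg_right (by linarith [hm.2.2]) htpos⟩
  · intro R hR S hS ρ h1 h2 h3 h4
    rw [hT.mem_blackFan] at hR hS
    obtain ⟨t, ht, k1, k2, k3, k4⟩ := exists_small _ _ _ _ h1 h2 h3 h4
    have p1 := mul_pos ht h1
    have p2 := mul_pos ht h2
    have p3 := mul_pos ht h3
    have p4 := mul_pos ht h4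
    refine T.no_overlap R hR.1 S hS.1 ⟨v - t * ρ, ?_, ?_⟩
    · rw [Rhombus.mem_openRegion, (hsub R hR.2 _).1, (hsub R hR.2 _).2, R.coordR_mul, R.coordL_mul]
      exact ⟨⟨by linarith, by linarith⟩, by linarith, by linarith⟩
    · rw [Rhombus.mem_openRegion, (hsub S hS.2 _).1, (hsub S hS.2 _).2, S.coordR_mul, S.coordL_mul]
      exact ⟨⟨by linarith, by linarith⟩, by linarith, by linarith⟩

end RhombusGraph

/-! ### The lift of the tiling to the free vector space on side directions. -/

namespace RhombusGraph

variable {T : RhombusGraph}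

open Classical in
/-- Potential of the family `Rhombus.lin` near `p`, normalized to vanish at `p`. -/
noncomputable def localPotential (T : RhombusGraph) (p y : ℂ) : ℂ →₀ ℝ :=
  if h : ∃ R ∈ T.rhombi, p ∈ R.closedRegion ∧ y ∈ R.closedRegion then h.choose.lin (y - p) else 0

theorem localPotential_eq {R : Rhombus} (hR : R ∈ T.rhombi) {p y : ℂ} (hp : p ∈ R.closedRegion)
    (hy : y ∈ R.closedRegion) : T.localPotential p y = R.lin (y - p) := by
  have h : ∃ R ∈ T.rhombi, p ∈ R.closedRegion ∧ y ∈ R.closedRegion := ⟨R, hR, hp, hy⟩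
  rw [localPotential, dif_pos h]
  obtain ⟨h1, h2, h3⟩ := h.choose_spec
  exact T.lin_compat h1 hR h2 h3 hp hy

/-- Radius of a ball around `p` that meets only rhombi containing `p`. -/
noncomputable def BoundedAngles.starRadius (hT : T.BoundedAngles) (p : ℂ) : ℝ :=
  (hT.exists_star p).choose

theorem BoundedAngles.starRadius_pos (hT : T.BoundedAngles) (p : ℂ) : 0 < hT.starRadius p :=
  (hT.exists_star p).choose_spec.1

theorem BoundedAngles.localPotential_sub (hT : T.BoundedAngles) {R : Rhombus} (hR : R ∈ T.rhombi)
    {p y z : ℂ} (hy : y ∈ R.closedRegion) (hz : z ∈ R.closedRegion)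
    (hyp : y ∈ Metric.ball p (hT.starRadius p)) :
    T.localPotential p z - T.localPotential p y = R.lin (z - y) := by
  have hp := (hT.exists_star p).choose_spec.2 R hR y hyp hy
  rw [localPotential_eq hR hp hz, localPotential_eq hR hp hy, ← R.lin_sub]
  congr 1; ring

/-- The difference of the two local potentials is constant on each rhombus within the intersection
of the two balls, and that intersection is convex, hence connected. -/
theorem BoundedAngles.localPotential_compat (hT : T.BoundedAngles) {p q y z : ℂ}
    (hyp : y ∈ Metric.ball p (hT.starRadius p)) (hyq : y ∈ Metric.ball q (hT.starRadius q))
    (hzp : z ∈ Metric.ball p (hT.starRadius p)) (hzq : z ∈ Metric.ball q (hT.starRadius q)) :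
    T.localPotential p z - T.localPotential p y = T.localPotential q z - T.localPotential q y := by
  have h := hT.eq_of_eq_on_rhombi (fun x => T.localPotential p x - T.localPotential q x)
    (U := Metric.ball p (hT.starRadius p) ∩ Metric.ball q (hT.starRadius q))
    ((convex_ball _ _).inter (convex_ball _ _)).isPreconnected ?_ ⟨hyp, hyq⟩ ⟨hzp, hzq⟩
  · rw [sub_eq_sub_iff_add_eq_add] at h ⊢
    rw [← h, add_comm]
  · rintro R hR x ⟨hx, hxp, hxq⟩ y ⟨hy, -, -⟩
    have h1 := hT.localPotential_sub hR hx hy hxp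
    have h2 := hT.localPotential_sub hR hx hy hxq
    rw [← h2, sub_eq_sub_iff_add_eq_add] at h1
    rw [sub_eq_sub_iff_add_eq_add, add_comm, ← h1, add_comm]

/-- A closed cocycle on a disc is exact. With a Lebesgue number `δ` at hand, the increments `c x y`
add up for points closer than `δ`, and the potential is the sum of increments along the radial
segment from 0 cut into `N` short pieces. -/
theorem BoundedAngles.exists_potential_closedBall (hT : T.BoundedAngles) (r : ℝ) (hr : 0 ≤ r) :
    ∃ Φ : ℂ → (ℂ →₀ ℝ), ∀ R ∈ T.rhombi, ∀ x ∈ R.closedRegion, ∀ y ∈ R.closedRegion,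
      ‖x‖ ≤ r → ‖y‖ ≤ r → Φ y - Φ x = R.lin (y - x) := by
  obtain ⟨δ, hδ, hleb⟩ := lebesgue_number_lemma_of_metric (isCompact_closedBall (0 : ℂ) r)
    (c := fun p : ℂ => Metric.ball p (hT.starRadius p)) (fun p => Metric.isOpen_ball)
    (fun x _ => Set.mem_iUnion.2 ⟨x, Metric.mem_ball_self (hT.starRadius_pos x)⟩)
  choose! P hP using hleb
  set c : ℂ → ℂ → (ℂ →₀ ℝ) := fun x y => T.localPotential (P x) y - T.localPotential (P x) x with hc
  have hself : ∀ x, c x x = 0 := fun x => sub_self _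
  have hadd : ∀ x y z : ℂ, ‖x‖ ≤ r → ‖y‖ ≤ r → dist y x < δ → dist z x < δ → dist z y < δ →
      c x y + c y z = c x z := by
    intro x y z hx hy h1 h2 h3
    have hx' := hP x (by simpa using hx)
    have hy' := hP y (by simpa using hy)
    have : c y z = T.localPotential (P x) z - T.localPotential (P x) y :=
      hT.localPotential_compat (hy' (Metric.mem_ball_self hδ)) (hx' h1) (hy' h3) (hx' h2)
    rw [this]
    simp only [hc]; abel
  obtain ⟨N, hN⟩ := exists_nat_gt (r / (δ / 4))
  rw [div_lt_iff₀ (by positivity)] at hN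
  have hN0 : (0 : ℝ) < N := by
    rcases Nat.eq_zero_or_pos N with rfl | h
    · simp only [Nat.cast_zero, zero_mul] at hN; linarith
    · exact_mod_cast h
  set s : ℂ → ℕ → ℂ := fun x k => ((k / N : ℝ) : ℂ) * x with hs
  have hsnorm : ∀ x k, k ≤ N → ‖s x k‖ ≤ ‖x‖ := by
    intro x k hk
    have hk' : (k : ℝ) ≤ N := by exact_mod_cast hk
    simp only [hs]
    rw [norm_mul, Complex.norm_real, Real.norm_of_nonneg (by positivity)]
    exact mul_le_of_le_one_left (norm_nonneg _) (by rwa [div_le_one hN0])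
  have hstep : ∀ x k, ‖x‖ ≤ r → dist (s x (k + 1)) (s x k) < δ / 4 := by
    intro x k hx
    rw [dist_eq_norm]
    have : s x (k + 1) - s x k = ((1 / N : ℝ) : ℂ) * x := by
      simp only [hs]; push_cast; field_simp; ring
    rw [this, norm_mul, Complex.norm_real, Real.norm_of_nonneg (by positivity),
      one_div_mul_eq_div, div_lt_iff₀ hN0]
    linarith
  have hsd : ∀ x y k, k ≤ N → dist (s y k) (s x k) ≤ dist y x := by
    intro x y k hk
    have := hsnorm (y - x) k hk
    rw [dist_eq_norm, dist_eq_norm]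
    have e : s y k - s x k = s (y - x) k := by simp only [hs]; ring
    rw [e]; exact this
  set Φ : ℂ → (ℂ →₀ ℝ) := fun x => ∑ k ∈ Finset.range N, c (s x k) (s x (k + 1)) with hΦ
  have hloc : ∀ x y : ℂ, ‖x‖ ≤ r → ‖y‖ ≤ r → dist y x < δ / 2 → Φ y - Φ x = c x y := by
    intro x y hx hy hxy
    -- The subdivided radii to `x` and to `y` form a ladder whose rungs and diagonals are shorter
    -- than `δ`, so the increments add up around each cell. The last rung is `c x y`.
    have ind : ∀ m ≤ N, ∑ k ∈ Finset.range m, c (s y k) (s y (k + 1)) =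
        ∑ k ∈ Finset.range m, c (s x k) (s x (k + 1)) + c (s x m) (s y m) := by
      intro m
      induction m with
      | zero => intro _; simp [hs, hself]
      | succ m ih =>
        intro hm
        have hx1 := hstep x m hx
        have hy1 := hstep y m hy
        have hd := hsd x y m (by omega)
        have hd1 := hsd x y (m + 1) hm
        have hd2 : dist (s y (m + 1)) (s x m) < δ :=
          (dist_triangle _ (s y m) _).trans_lt (by linarith)
        rw [Finset.sum_range_succ, Finset.sum_range_succ, ih (by omega), add_assoc, add_assoc,
          hadd (s x m) (s y m) (s y (m + 1)) ((hsnorm x m (by omega)).trans hx)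
            ((hsnorm y m (by omega)).trans hy) (by linarith) hd2 (by linarith),
          hadd (s x m) (s x (m + 1)) (s y (m + 1)) ((hsnorm x m (by omega)).trans hx)
            ((hsnorm x (m + 1) hm).trans hx) (by linarith) hd2 (by linarith)]
    have hsN : ∀ x, s x N = x := by
      intro x; simp only [hs]; rw [div_self hN0.ne']; simp
    have h := ind N le_rfl
    rw [hsN, hsN] at h
    simp only [hΦ]
    rw [h]; abel
  refine ⟨Φ, fun R hR x hx y hy hxr hyr => ?_⟩
  -- The increment formula is so far known only for nearby points. The intersection of a rhombus
  -- with the disc is convex, hence connected, so a locally constant difference is constant on it.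
  have hU : Convex ℝ (R.closedRegion ∩ Metric.closedBall (0 : ℂ) r) :=
    R.convex_closedRegion.inter (convex_closedBall _ _)
  have hpc : PreconnectedSpace ↥(R.closedRegion ∩ Metric.closedBall (0 : ℂ) r) :=
    isPreconnected_iff_preconnectedSpace.1 hU.isPreconnected
  have hlc : IsLocallyConstant
      (fun z : ↥(R.closedRegion ∩ Metric.closedBall (0 : ℂ) r) => Φ z - R.lin z) := by
    rw [IsLocallyConstant.iff_eventually_eq]
    rintro ⟨p, hpR, hpr⟩
    filter_upwards [Metric.ball_mem_nhds _ (half_pos hδ)] with z hz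
    obtain ⟨z, hzR, hzr⟩ := z
    have hd : dist z p < δ / 2 := hz
    simp only [Metric.mem_closedBall, dist_zero_right] at hpr hzr
    have h1 := hloc p z hpr hzr hd
    have h2 : c p z = R.lin (z - p) := hT.localPotential_sub hR hpR hzR
      (hP p (by simpa using hpr) (Metric.mem_ball_self hδ))
    rw [h2, R.lin_sub, sub_eq_sub_iff_add_eq_add] at h1
    dsimp only
    rw [sub_eq_sub_iff_add_eq_add, h1, add_comm]
  have h := hlc.apply_eq_of_preconnectedSpace ⟨x, hx, by simpa using hxr⟩ ⟨y, hy, by simpa using hyr⟩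
  dsimp only at h
  rw [R.lin_sub, sub_eq_sub_iff_add_eq_add]
  rw [sub_eq_sub_iff_add_eq_add] at h
  rw [add_comm (R.lin y), h]

/-- The lift of the tiling: each rhombus is mapped affinely, the image of each oriented side of
direction `e` being the basis vector of index `e`. -/
def IsPotential (T : RhombusGraph) (Φ : ℂ → (ℂ →₀ ℝ)) : Prop :=
  ∀ R ∈ T.rhombi, ∀ x ∈ R.closedRegion, ∀ y ∈ R.closedRegion, Φ y - Φ x = R.lin (y - x)

/-- Potentials on nested discs differ by a constant, so after normalization at 0 they agree. The
value at `x` can be taken from any disc containing `x`, here the one of radius `⌈‖x‖⌉₊`. -/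
theorem BoundedAngles.exists_isPotential (hT : T.BoundedAngles) : ∃ Φ, T.IsPotential Φ := by
  have h := fun n : ℕ => hT.exists_potential_closedBall n (Nat.cast_nonneg n)
  choose Ψ hΨ using h
  have hcompat : ∀ m n : ℕ, m ≤ n → ∀ x : ℂ, ‖x‖ ≤ m → Ψ n x - Ψ n 0 = Ψ m x - Ψ m 0 := by
    intro m n hmn x hx
    have hmn' : (m : ℝ) ≤ n := by exact_mod_cast hmn
    have h := hT.eq_of_eq_on_rhombi (fun x => Ψ n x - Ψ m x) (U := Metric.closedBall (0 : ℂ) m)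
      (convex_closedBall _ _).isPreconnected ?_ (x := x) (y := 0) (by simpa using hx) (by simp)
    · rw [sub_eq_sub_iff_add_eq_add] at h ⊢
      rw [h, add_comm]
    · rintro R hR x ⟨hx, hxm⟩ y ⟨hy, hym⟩
      simp only [Metric.mem_closedBall, dist_zero_right] at hxm hym
      have h1 := hΨ n R hR x hx y hy (hxm.trans hmn') (hym.trans hmn')
      rw [← hΨ m R hR x hx y hy hxm hym, sub_eq_sub_iff_add_eq_add] at h1
      rw [sub_eq_sub_iff_add_eq_add, add_comm, ← h1, add_comm]
  refine ⟨fun x => Ψ ⌈‖x‖⌉₊ x - Ψ ⌈‖x‖⌉₊ 0, fun R hR x hx y hy => ?_⟩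
  dsimp only
  set n := max ⌈‖x‖⌉₊ ⌈‖y‖⌉₊ with hn
  rw [← hcompat _ n (le_max_left _ _) x (Nat.le_ceil _),
    ← hcompat _ n (le_max_right _ _) y (Nat.le_ceil _), sub_sub_sub_cancel_right]
  refine hΨ n R hR x hx y hy ((Nat.le_ceil _).trans ?_) ((Nat.le_ceil _).trans ?_)
  · exact_mod_cast le_max_left _ _
  · exact_mod_cast le_max_right _ _

end RhombusGraph

/-- The real inner product of the plane. -/
def dot (a b : ℂ) : ℝ := a.re * b.re + a.im * b.im

theorem wedge_add_left (a b c : ℂ) : wedge (a + b) c = wedge a c + wedge b c := by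
  simp [wedge]; ring

theorem wedge_real_mul_left (a : ℂ) (x : ℝ) (b : ℂ) : wedge (x * a) b = x * wedge a b := by
  simp [wedge]; ring

/-! ### Deformations of the tiling. -/

namespace RhombusGraph

variable {T : RhombusGraph}

/-- Gluing of Lipschitz bounds along a curve. -/
theorem BoundedAngles.norm_sub_le_of_curve (hT : T.BoundedAngles) {E : Type*}
    [NormedAddCommGroup E] (γ : ℝ → ℂ) (hγ : ContinuousOn γ (Set.Icc 0 1)) (h : ℂ → E) (L : ℝ)
    (hL : ∀ R ∈ T.rhombi, ∀ s ∈ Set.Icc (0 : ℝ) 1, ∀ t ∈ Set.Icc (0 : ℝ) 1,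
      γ s ∈ R.closedRegion → γ t ∈ R.closedRegion → ‖h (γ t) - h (γ s)‖ ≤ L * |t - s|) :
    ‖h (γ 1) - h (γ 0)‖ ≤ L := by
  have loc : ∀ s ∈ Set.Icc (0 : ℝ) 1, ∀ᶠ t in nhdsWithin s (Set.Icc 0 1),
      ‖h (γ t) - h (γ s)‖ ≤ L * |t - s| := by
    intro s hs
    obtain ⟨δ, hδ, hstar⟩ := hT.exists_star (γ s)
    filter_upwards [hγ s hs (Metric.ball_mem_nhds _ hδ), self_mem_nhdsWithin] with t ht htI
    obtain ⟨R, hR, hm⟩ := T.covers (γ t)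
    exact hL R hR s hs t htI (hstar R hR _ ht hm) hm
  have hcont : ContinuousOn (fun t => ‖h (γ t) - h (γ 0)‖) (Set.Icc 0 1) := by
    refine ContinuousOn.norm (ContinuousOn.sub ?_ continuousOn_const)
    intro s hs
    rw [ContinuousWithinAt, tendsto_iff_norm_sub_tendsto_zero]
    have hlim : Filter.Tendsto (fun t : ℝ => L * |t - s|) (nhdsWithin s (Set.Icc 0 1)) (nhds 0) := by
      have : Continuous fun t : ℝ => L * |t - s| := by fun_prop
      have := this.tendsto s
      simp only [sub_self, abs_zero, mul_zero] at this
      exact this.mono_left nhdsWithin_le_nhds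
    exact squeeze_zero' (Filter.Eventually.of_forall fun _ => norm_nonneg _) (loc s hs) hlim
  have := image_le_of_liminf_slope_right_le_deriv_boundary hcont (B := fun t => L * t)
    (B' := fun _ => L) (by simp) (by fun_prop)
    (fun x _ => by simpa using ((hasDerivAt_id x).const_mul L).hasDerivWithinAt) ?_
    (Set.right_mem_Icc.2 zero_le_one)
  · simpa using this
  · intro x hx r hr
    apply Filter.Eventually.frequently
    have hle : nhdsWithin x (Set.Ioo x 1) ≤ nhdsWithin x (Set.Icc 0 1) :=
      nhdsWithin_mono _ fun y hy => ⟨hx.1.trans hy.1.le, hy.2.le⟩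
    rw [← nhdsWithin_Ioo_eq_nhdsGT hx.2]
    filter_upwards [hle (loc x ⟨hx.1, hx.2.le⟩), self_mem_nhdsWithin] with z hz hzI
    have hpos : 0 < z - x := sub_pos.2 hzI.1
    rw [slope_def_field, div_lt_iff₀ hpos]
    rw [abs_of_pos hpos] at hz
    have h1 : ‖h (γ z) - h (γ 0)‖ - ‖h (γ x) - h (γ 0)‖ ≤ ‖h (γ z) - h (γ x)‖ := by
      have := norm_sub_norm_le (h (γ z) - h (γ 0)) (h (γ x) - h (γ 0))
      simpa using this
    nlinarith

theorem BoundedAngles.norm_sub_le (hT : T.BoundedAngles) {E : Type*} [NormedAddCommGroup E]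
    (h : ℂ → E) (L : ℝ)
    (hL : ∀ R ∈ T.rhombi, ∀ x ∈ R.closedRegion, ∀ y ∈ R.closedRegion,
      ‖h y - h x‖ ≤ L * ‖y - x‖) (x y : ℂ) : ‖h y - h x‖ ≤ L * ‖y - x‖ := by
  have := hT.norm_sub_le_of_curve (fun t : ℝ => x + t * (y - x)) (by fun_prop) h (L * ‖y - x‖) ?_
  · simpa using this
  · intro R hR s _ t _ h1 h2
    refine (hL R hR _ h1 _ h2).trans_eq ?_
    have e : x + t * (y - x) - (x + s * (y - x)) = ((t - s : ℝ) : ℂ) * (y - x) := by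
      push_cast; ring
    rw [e, norm_mul, Complex.norm_real, Real.norm_eq_abs]; ring

section Deformation

variable {Φ : ℂ → (ℂ →₀ ℝ)}

/-- The tiling deformed by replacing each side of direction `d` by the vector `D d`. -/
noncomputable def deform (Φ : ℂ → (ℂ →₀ ℝ)) (D : ℂ → ℂ) (x : ℂ) : ℂ :=
  Finsupp.linearCombination ℝ D (Φ x)

theorem deform_sub (D : ℂ → ℂ) (x y : ℂ) :
    deform Φ D y - deform Φ D x = Finsupp.linearCombination ℝ D (Φ y - Φ x) := by
  rw [deform, deform, map_sub]

theorem IsPotential.deform_sub (hΦ : T.IsPotential Φ) (D : ℂ → ℂ) {R : Rhombus} (hR : R ∈ T.rhombi)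
    {x y : ℂ} (hx : x ∈ R.closedRegion) (hy : y ∈ R.closedRegion) :
    deform Φ D y - deform Φ D x =
      (R.coordR (y - x) : ℂ) * D R.right + (R.coordL (y - x) : ℂ) * D R.left := by
  rw [RhombusGraph.deform_sub, hΦ R hR x hx y hy, Rhombus.lin, map_add,
    Finsupp.linearCombination_single, Finsupp.linearCombination_single, Complex.real_smul,
    Complex.real_smul]

/-- A deformation through nondegenerate tilings remains injective. -/
theorem BoundedAngles.deform_injective (hT : T.BoundedAngles) (hΦ : T.IsPotential Φ)
    (D : ℝ → ℂ → ℂ) (hD0 : ∀ d, D 0 d = d) {m C : ℝ} (hm : 0 < m) (hC : 0 < C)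
    (hDm : ∀ τ ∈ Set.Icc (0 : ℝ) 1, ∀ R ∈ T.rhombi, m ≤ wedge (D τ R.right) (D τ R.left))
    (hDC : ∀ τ ∈ Set.Icc (0 : ℝ) 1, ∀ d : ℂ, ‖d‖ = 1 → ‖D τ d‖ ≤ C)
    (hDL : ∀ τ ∈ Set.Icc (0 : ℝ) 1, ∀ τ' ∈ Set.Icc (0 : ℝ) 1, ∀ d : ℂ, ‖d‖ = 1 →
      ‖D τ' d - D τ d‖ ≤ C * |τ' - τ|) :
    Function.Injective (deform Φ (D 1)) := by
  obtain ⟨ε, hε, -, hεR⟩ := hT.exists_le_one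
  -- `2 * C / m` bounds the inverse of every deformed rhombus; the maximum with 1 covers `τ = 0`,
  -- where the map is a translation.
  set Λ : ℝ := max (2 * C / m) 1 with hΛ
  have hΛ1 : 1 ≤ Λ := le_max_right _ _
  have hΛ0 : 0 < Λ := by linarith
  have lower : ∀ τ ∈ Set.Icc (0 : ℝ) 1, ∀ R ∈ T.rhombi, ∀ x ∈ R.closedRegion,
      ∀ y ∈ R.closedRegion, ‖y - x‖ ≤ Λ * ‖deform Φ (D τ) y - deform Φ (D τ) x‖ := by
    intro τ hτ R hR x hx y hy
    rw [hΦ.deform_sub _ hR hx hy]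
    set a := R.coordR (y - x)
    set b := R.coordL (y - x)
    set v := (a : ℂ) * D τ R.right + (b : ℂ) * D τ R.left with hv
    have hw := hDm τ hτ R hR
    have h1 : |a| * m ≤ ‖v‖ * C := by
      have : wedge v (D τ R.left) = a * wedge (D τ R.right) (D τ R.left) := by
        simp [hv, wedge_add_left, wedge_real_mul_left]
      have h2 := abs_wedge_le v (D τ R.left)
      rw [this, abs_mul, abs_of_pos (hm.trans_le hw)] at h2
      have h3 := hDC τ hτ _ R.norm_left
      nlinarith [abs_nonneg a, norm_nonneg v]
    have h2 : |b| * m ≤ ‖v‖ * C := by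
      have : wedge (D τ R.right) v = b * wedge (D τ R.right) (D τ R.left) := by
        simp [hv, wedge_add_right, wedge_real_mul_right]
      have h2 := abs_wedge_le (D τ R.right) v
      rw [this, abs_mul, abs_of_pos (hm.trans_le hw)] at h2
      have h3 := hDC τ hτ _ R.norm_right
      nlinarith [abs_nonneg b, norm_nonneg v]
    have h3 : ‖y - x‖ ≤ |a| + |b| := by
      conv_lhs => rw [R.eq_coord (y - x)]
      refine (norm_add_le _ _).trans ?_
      rw [norm_mul, norm_mul, R.norm_right, R.norm_left, Complex.norm_real, Complex.norm_real]
      simp [a, b]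
    have h4 : ‖y - x‖ ≤ 2 * C / m * ‖v‖ := by
      rw [div_mul_eq_mul_div, le_div_iff₀ hm]
      nlinarith
    exact h4.trans (mul_le_mul_of_nonneg_right (le_max_left _ _) (norm_nonneg _))
  have diff : ∀ τ ∈ Set.Icc (0 : ℝ) 1, ∀ τ' ∈ Set.Icc (0 : ℝ) 1, ∀ x y : ℂ,
      ‖(deform Φ (D τ') y - deform Φ (D τ) y) - (deform Φ (D τ') x - deform Φ (D τ) x)‖ ≤
        2 * C / ε * |τ' - τ| * ‖y - x‖ := by
    intro τ hτ τ' hτ' x y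
    refine hT.norm_sub_le (fun x => deform Φ (D τ') x - deform Φ (D τ) x) _ ?_ x y
    intro R hR x hx y hy
    have e : (deform Φ (D τ') y - deform Φ (D τ) y) - (deform Φ (D τ') x - deform Φ (D τ) x) =
        (R.coordR (y - x) : ℂ) * (D τ' R.right - D τ R.right) +
        (R.coordL (y - x) : ℂ) * (D τ' R.left - D τ R.left) := by
      have h1 := hΦ.deform_sub (D τ) hR hx hy
      have h2 := hΦ.deform_sub (D τ') hR hx hy
      linear_combination h2 - h1
    rw [e]
    refine (norm_add_le _ _).trans ?_
    rw [norm_mul, norm_mul, Complex.norm_real, Complex.norm_real, Real.norm_eq_abs,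
      Real.norm_eq_abs]
    have h1 := hDL τ hτ τ' hτ' _ R.norm_right
    have h2 := hDL τ hτ τ' hτ' _ R.norm_left
    have h3 := R.coordR_bound (y - x)
    have h4 := R.coordL_bound (y - x)
    have h5 := hεR R hR
    set a := |R.coordR (y - x)|
    set b := |R.coordL (y - x)|
    have ha : 0 ≤ a := abs_nonneg _
    have hb : 0 ≤ b := abs_nonneg _
    have h6 : a ≤ ‖y - x‖ / ε := by rw [le_div_iff₀ hε]; nlinarith
    have h7 : b ≤ ‖y - x‖ / ε := by rw [le_div_iff₀ hε]; nlinarith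
    have hK : 0 ≤ C * |τ' - τ| := by positivity
    calc _ ≤ a * (C * |τ' - τ|) + b * (C * |τ' - τ|) := by gcongr
      _ ≤ ‖y - x‖ / ε * (C * |τ' - τ|) + ‖y - x‖ / ε * (C * |τ' - τ|) := by gcongr
      _ = _ := by ring
  -- Continuation in `τ`: the property includes surjectivity, and its constant `Λ` is the one valid
  -- on single rhombi, so that it can be restored after every step and the step size stays fixed.
  set good : ℝ → Prop := fun τ => (∀ x y : ℂ, ‖y - x‖ ≤ Λ * ‖deform Φ (D τ) y - deform Φ (D τ) x‖) ∧
    Function.Surjective (deform Φ (D τ)) with hgood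
  have good0 : good 0 := by
    have h0 : ∀ x y : ℂ, deform Φ (D 0) y - deform Φ (D 0) x = y - x := by
      intro x y
      have := hT.norm_sub_le (fun x => deform Φ (D 0) x - x) 0 ?_ x y
      · rw [zero_mul, norm_le_zero_iff] at this
        linear_combination this
      · intro R hR x hx y hy
        have h1 := hΦ.deform_sub (D 0) hR hx hy
        rw [hD0, hD0, ← R.eq_coord] at h1
        have : deform Φ (D 0) y - y - (deform Φ (D 0) x - x) = 0 := by linear_combination h1
        rw [this]; simp
    refine ⟨fun x y => ?_, fun p => ⟨p - deform Φ (D 0) 0, ?_⟩⟩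
    · rw [h0]; nlinarith [norm_nonneg (y - x)]
    · have := h0 0 (p - deform Φ (D 0) 0)
      linear_combination this
  have step : ∀ τ ∈ Set.Icc (0 : ℝ) 1, ∀ τ' ∈ Set.Icc (0 : ℝ) 1,
      2 * C / ε * |τ' - τ| * Λ ≤ 1 / 2 → good τ → good τ' := by
    rintro τ hτ τ' hτ' hsmall ⟨hanti, hsurj⟩
    set κ := 2 * C / ε * |τ' - τ| with hκ
    have hκ0 : 0 ≤ κ := by positivity
    have hdiff := diff τ hτ τ' hτ'
    have hweak : ∀ x y : ℂ, ‖y - x‖ ≤ 2 * Λ * ‖deform Φ (D τ') y - deform Φ (D τ') x‖ := by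
      intro x y
      have h1 := hanti x y
      have h2 := hdiff x y
      have h3 : ‖deform Φ (D τ) y - deform Φ (D τ) x‖ ≤
          ‖deform Φ (D τ') y - deform Φ (D τ') x‖ + κ * ‖y - x‖ := by
        have e : deform Φ (D τ) y - deform Φ (D τ) x =
          (deform Φ (D τ') y - deform Φ (D τ') x) -
          ((deform Φ (D τ') y - deform Φ (D τ) y) - (deform Φ (D τ') x - deform Φ (D τ) x)) := by
            ring
        rw [e]
        exact (_root_.norm_sub_le _ _).trans (add_le_add le_rfl h2)
      have h4 : κ * Λ * ‖y - x‖ ≤ 1 / 2 * ‖y - x‖ :=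
        mul_le_mul_of_nonneg_right hsmall (norm_nonneg _)
      nlinarith
    have hsurj' : Function.Surjective (deform Φ (D τ')) := by
      intro p
      choose G hG using hsurj
      have hGl : ∀ q q' : ℂ, ‖G q' - G q‖ ≤ Λ * ‖q' - q‖ := by
        intro q q'
        have := hanti (G q) (G q')
        rwa [hG, hG] at this
      -- A fixed point `q` of this map satisfies `deform Φ (D τ') (G q) = p`, because `G` is a right
      -- inverse of the map at `τ`.
      set f : ℂ → ℂ := fun q => p - (deform Φ (D τ') (G q) - deform Φ (D τ) (G q)) with hf
      have hcon : ContractingWith (1 / 2 : NNReal) f := by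
        refine ⟨by rw [← NNReal.coe_lt_coe]; norm_num, LipschitzWith.of_dist_le_mul fun q q' => ?_⟩
        rw [dist_comm, dist_comm q, dist_eq_norm, dist_eq_norm]
        have e : f q' - f q = -((deform Φ (D τ') (G q') - deform Φ (D τ) (G q')) -
          (deform Φ (D τ') (G q) - deform Φ (D τ) (G q))) := by simp only [hf]; ring
        rw [e, norm_neg]
        refine (hdiff _ _).trans ?_
        have h1 := hGl q q'
        have h2 : κ * ‖G q' - G q‖ ≤ κ * (Λ * ‖q' - q‖) := mul_le_mul_of_nonneg_left h1 hκ0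
        have h4 : κ * Λ * ‖q' - q‖ ≤ 1 / 2 * ‖q' - q‖ :=
          mul_le_mul_of_nonneg_right hsmall (norm_nonneg _)
        push_cast
        linarith
      refine ⟨G (hcon.fixedPoint f), ?_⟩
      have h1 : f (hcon.fixedPoint f) = hcon.fixedPoint f := hcon.fixedPoint_isFixedPt
      have h2 := hG (hcon.fixedPoint f)
      simp only [hf] at h1 h2 ⊢
      linear_combination h2 - h1
    refine ⟨fun x y => ?_, hsurj'⟩
    choose G hG using hsurj'
    have hGl : ∀ q q' : ℂ, ‖G q' - G q‖ ≤ 2 * Λ * ‖q' - q‖ := by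
      intro q q'
      have := hweak (G q) (G q')
      rwa [hG, hG] at this
    have hGinv : ∀ x, G (deform Φ (D τ') x) = x := by
      intro x
      have := hweak x (G (deform Φ (D τ') x))
      rw [hG, sub_self, norm_zero, mul_zero, norm_le_zero_iff] at this
      linear_combination this
    have hGc : Continuous G := by
      refine LipschitzWith.continuous (K := (2 * Λ).toNNReal) (LipschitzWith.of_dist_le_mul fun q q' => ?_)
      rw [dist_comm, dist_comm q, dist_eq_norm, dist_eq_norm, Real.coe_toNNReal _ (by positivity)]
      exact hGl q q'
    set p := deform Φ (D τ') x
    set q := deform Φ (D τ') y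
    -- The perturbation argument only gives the constant 2Λ. The preimage of the segment from `p` to
    -- `q` is a continuous curve, and along it the bounds `Λ` on the single rhombi glue to the
    -- global bound `Λ`.
    have := hT.norm_sub_le_of_curve (fun t : ℝ => G (p + t * (q - p)))
      (hGc.comp (by fun_prop)).continuousOn id (Λ * ‖q - p‖) ?_
    · simpa [p, q, hGinv] using this
    · intro R hR s _ t _ h1 h2
      have h3 := lower τ' hτ' R hR _ h1 _ h2
      rw [hG, hG] at h3
      have e : p + t * (q - p) - (p + s * (q - p)) = ((t - s : ℝ) : ℂ) * (q - p) := by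
        push_cast; ring
      rw [e, norm_mul, Complex.norm_real, Real.norm_eq_abs] at h3
      exact h3.trans_eq (by ring)
  obtain ⟨N, hN⟩ := exists_nat_gt (2 * C / ε * Λ * 2)
  have hN0 : (0 : ℝ) < N := lt_trans (by positivity) hN
  have all : ∀ k : ℕ, k ≤ N → good (k / N) := by
    intro k
    induction k with
    | zero => intro _; simpa using good0
    | succ k ih =>
      intro hk
      have hk' : ((k + 1 : ℕ) : ℝ) ≤ N := by exact_mod_cast hk
      have hk2 : (k : ℝ) ≤ N := by push_cast at hk'; linarith
      refine step (k / N) ⟨by positivity, by rwa [div_le_one hN0]⟩ _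
        ⟨by positivity, by rwa [div_le_one hN0]⟩ ?_ (ih (by omega))
      have e : (((k + 1 : ℕ) : ℝ) / N - k / N) = 1 / N := by push_cast; field_simp; ring
      rw [e, abs_of_pos (by positivity)]
      have : 2 * C / ε * (1 / N) * Λ = (2 * C / ε * Λ) / N := by ring
      rw [this, div_le_iff₀ hN0]
      linarith
  have h1 := all N le_rfl
  rw [div_self hN0.ne'] at h1
  intro x y hxy
  have := h1.1 y x
  rw [hxy, sub_self, norm_zero, mul_zero, norm_le_zero_iff] at this
  linear_combination this

/-- The sum is the displacement from the image of `x` to that of `y` once each side `d` is replaced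
by `W d * (d + η d)`. The homotopy (1 − τ + τ W d)(d + τ η d) joins this deformation to the original
tiling: the bound ε/8 on `η` keeps the determinants of the perturbed sides above ε/2, and the
weights stay between 1/M and M. The deformation is therefore injective. -/
theorem BoundedAngles.weighted_sum_ne_zero (hT : T.BoundedAngles) (hΦ : T.IsPotential Φ) {ε : ℝ}
    (hε : 0 < ε) (hε1 : ε ≤ 1) (hεR : ∀ R ∈ T.rhombi, ε ≤ wedge R.right R.left)
    (W : ℂ → ℝ) (η : ℂ → ℂ) {M : ℝ} (hM : 1 ≤ M) (hW : ∀ d, 1 / M ≤ W d ∧ W d ≤ M)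
    (hη : ∀ d, ‖η d‖ ≤ ε / 8) {x y : ℂ} (hxy : x ≠ y) :
    Finsupp.linearCombination ℝ (fun d => (W d : ℂ) * (d + η d)) (Φ y - Φ x) ≠ 0 := by
  have hM0 : 0 < M := by linarith
  have hw : ∀ τ ∈ Set.Icc (0 : ℝ) 1, ∀ d, 1 / M ≤ 1 - τ + τ * W d ∧ 1 - τ + τ * W d ≤ M := by
    rintro τ ⟨h0, h1⟩ d
    obtain ⟨h2, h3⟩ := hW d
    have : 1 / M ≤ 1 := by rw [div_le_one hM0]; exact hM
    constructor <;> nlinarith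
  have hinv : 0 < 1 / M := by positivity
  have hnorm : ∀ τ ∈ Set.Icc (0 : ℝ) 1, ∀ d : ℂ, ‖d‖ = 1 → ‖d + (τ : ℂ) * η d‖ ≤ 2 := by
    rintro τ ⟨h0, h1⟩ d hd
    refine (norm_add_le _ _).trans ?_
    rw [norm_mul, Complex.norm_real, Real.norm_of_nonneg h0, hd]
    nlinarith [hη d, norm_nonneg (η d)]
  have hinj := hT.deform_injective hΦ
    (fun τ d => ((1 - τ + τ * W d : ℝ) : ℂ) * (d + (τ : ℂ) * η d)) (by simp)
    (m := ε / (2 * M ^ 2)) (C := 3 * M) (by positivity) (by positivity) ?_ ?_ ?_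
  · intro h0
    apply hxy
    apply hinj
    rw [eq_comm, ← sub_eq_zero, RhombusGraph.deform_sub]
    simpa using h0
  · intro τ hτ R hR
    rw [wedge_real_mul_left, wedge_real_mul_right]
    have a1 := hw τ hτ R.right
    have a2 := hw τ hτ R.left
    set w1 := 1 - τ + τ * W R.right
    set w2 := 1 - τ + τ * W R.left
    obtain ⟨h0, h1⟩ := hτ
    have e1 : ∀ d, ‖(τ : ℂ) * η d‖ ≤ ε / 8 := by
      intro d
      rw [norm_mul, Complex.norm_real, Real.norm_of_nonneg h0]
      nlinarith [hη d, norm_nonneg (η d)]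
    have hbig : ε / 2 ≤ wedge (R.right + (τ : ℂ) * η R.right) (R.left + (τ : ℂ) * η R.left) := by
      rw [wedge_add_left, wedge_add_right, wedge_add_right]
      have b1 := abs_le.1 (abs_wedge_le R.right ((τ : ℂ) * η R.left))
      have b2 := abs_le.1 (abs_wedge_le ((τ : ℂ) * η R.right) R.left)
      have b3 := abs_le.1 (abs_wedge_le ((τ : ℂ) * η R.right) ((τ : ℂ) * η R.left))
      rw [R.norm_right] at b1
      rw [R.norm_left] at b2
      have c1 := e1 R.right
      have c2 := e1 R.left
      have c3 := mul_le_mul c1 c2 (norm_nonneg _) (by positivity)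
      have := hεR R hR
      nlinarith
    have hw12 : 1 / M * (1 / M) ≤ w1 * w2 := mul_le_mul a1.1 a2.1 hinv.le (hinv.le.trans a1.1)
    calc ε / (2 * M ^ 2) = 1 / M * (1 / M) * (ε / 2) := by field_simp
      _ ≤ w1 * w2 * wedge (R.right + (τ : ℂ) * η R.right) (R.left + (τ : ℂ) * η R.left) :=
        mul_le_mul hw12 hbig (by positivity) (le_trans (by positivity) hw12)
      _ = _ := by ring
  · intro τ hτ d hd
    rw [norm_mul, Complex.norm_real, Real.norm_of_nonneg (hinv.le.trans (hw τ hτ d).1)]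
    nlinarith [hnorm τ hτ d hd, (hw τ hτ d).2, norm_nonneg (d + (τ : ℂ) * η d), (hw τ hτ d).1]
  · intro τ hτ τ' hτ' d hd
    have e : ((1 - τ' + τ' * W d : ℝ) : ℂ) * (d + (τ' : ℂ) * η d) -
        ((1 - τ + τ * W d : ℝ) : ℂ) * (d + (τ : ℂ) * η d) =
        (((τ' - τ) * (W d - 1) : ℝ) : ℂ) * (d + (τ' : ℂ) * η d) +
        ((1 - τ + τ * W d : ℝ) : ℂ) * (((τ' - τ : ℝ) : ℂ) * η d) := by push_cast; ring
    rw [e]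
    refine (norm_add_le _ _).trans ?_
    rw [norm_mul, norm_mul, norm_mul, Complex.norm_real, Complex.norm_real, Complex.norm_real,
      Real.norm_of_nonneg (hinv.le.trans (hw τ hτ d).1), Real.norm_eq_abs, Real.norm_eq_abs, abs_mul]
    have h1 : |W d - 1| ≤ M := by
      rw [abs_le]; constructor <;> linarith [(hW d).1, (hW d).2]
    have h2 := hnorm τ' hτ' d hd
    have h3 := (hw τ hτ d).2
    have h4 : ‖η d‖ ≤ 1 := (hη d).trans (by linarith)
    have h5 : 0 ≤ |τ' - τ| := abs_nonneg _
    calc _ ≤ |τ' - τ| * M * 2 + M * (|τ' - τ| * 1) := by gcongr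
      _ = _ := by ring

end Deformation

end RhombusGraph

/-! ### The half plane of directions separating two points. -/

/-- The open convex cone generated by a disc. -/
def discCone (a : ℂ) (δ : ℝ) : Set ℂ := {v | ∃ w : ℝ, 0 < w ∧ ‖v - w * a‖ < w * δ}

theorem isOpen_discCone (a : ℂ) (δ : ℝ) : IsOpen (discCone a δ) := by
  have : discCone a δ = ⋃ w : ℝ, ⋃ _ : 0 < w, Metric.ball ((w : ℂ) * a) (w * δ) := by
    ext v; simp [discCone, dist_eq_norm]
  rw [this]
  exact isOpen_iUnion fun w => isOpen_iUnion fun _ => Metric.isOpen_ball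

theorem discCone_add {a u v : ℂ} {δ : ℝ} (hu : u ∈ discCone a δ) (hv : v ∈ discCone a δ) :
    u + v ∈ discCone a δ := by
  obtain ⟨w, hw, h1⟩ := hu
  obtain ⟨w', hw', h2⟩ := hv
  refine ⟨w + w', by positivity, ?_⟩
  have e : u + v - ((w + w' : ℝ) : ℂ) * a = (u - w * a) + (v - w' * a) := by push_cast; ring
  rw [e]
  exact (norm_add_le _ _).trans_lt (by linarith)

theorem discCone_smul {a u : ℂ} {δ t : ℝ} (ht : 0 < t) (hu : u ∈ discCone a δ) :
    (t : ℂ) * u ∈ discCone a δ := by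
  obtain ⟨w, hw, h1⟩ := hu
  refine ⟨t * w, by positivity, ?_⟩
  have e : (t : ℂ) * u - ((t * w : ℝ) : ℂ) * a = t * (u - w * a) := by push_cast; ring
  rw [e, norm_mul, Complex.norm_real, Real.norm_of_nonneg ht.le, mul_assoc]
  exact mul_lt_mul_of_pos_left h1 ht

theorem dot_add_left (a b c : ℂ) : dot (a + b) c = dot a c + dot b c := by simp [dot]; ring

theorem dot_real_mul_left (x : ℝ) (a c : ℂ) : dot (x * a) c = x * dot a c := by simp [dot]; ring

theorem dot_neg_left (a c : ℂ) : dot (-a) c = -dot a c := by simp [dot]; ring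

theorem dot_self (a : ℂ) : dot a a = ‖a‖ ^ 2 := by
  rw [← Complex.normSq_eq_norm_sq, Complex.normSq_apply, dot]

theorem strongDual_eq_dot (f : ℂ →L[ℝ] ℝ) (z : ℂ) :
    f z = dot z (f 1 + f Complex.I * Complex.I) := by
  conv_lhs => rw [← Complex.re_add_im z]
  have h1 : f ((z.re : ℂ) + z.im * Complex.I) = z.re * f 1 + z.im * f Complex.I := by
    have e : (z.re : ℂ) + z.im * Complex.I = z.re • (1 : ℂ) + z.im • Complex.I := by simp
    rw [e, map_add, map_smul, map_smul]; simp
  rw [h1]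
  simp [dot]

/-- If no choice of vectors in thickened rays adds up to zero then the rays lie in a half-plane. -/
theorem exists_direction_of_sum_ne_zero {ι : Type*} (s : Finset ι) (hs : s.Nonempty) (a : ι → ℂ)
    {δ : ℝ} (hδ : 0 < δ)
    (h0 : ∀ c : ι → ℂ, (∀ i ∈ s, c i ∈ discCone (a i) δ) → ∑ i ∈ s, c i ≠ 0) :
    ∃ u : ℂ, ‖u‖ = 1 ∧ ∀ i ∈ s, δ / 2 ≤ dot (a i) u := by
  classical
  -- The sums form an open convex set that misses 0, so a linear functional is positive on it.
  set C : Set ℂ := {v | ∃ c : ι → ℂ, (∀ i ∈ s, c i ∈ discCone (a i) δ) ∧ v = ∑ i ∈ s, c i} with hC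
  have hconv : Convex ℝ C := by
    rw [convex_iff_forall_pos]
    rintro x ⟨c, hc, rfl⟩ y ⟨c', hc', rfl⟩ t t' ht ht' -
    refine ⟨fun i => t * c i + t' * c' i, fun i hi =>
      discCone_add (discCone_smul ht (hc i hi)) (discCone_smul ht' (hc' i hi)), ?_⟩
    rw [Finset.sum_add_distrib, ← Finset.mul_sum, ← Finset.mul_sum]
    simp
  have hopen : IsOpen C := by
    obtain ⟨j, hj⟩ := hs
    have hU : C = ⋃ r ∈ {r : ℂ | ∃ c : ι → ℂ, (∀ i ∈ s.erase j, c i ∈ discCone (a i) δ) ∧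
        r = ∑ i ∈ s.erase j, c i}, (fun z => z - r) ⁻¹' discCone (a j) δ := by
      ext v
      simp only [hC, Set.mem_ofPred_eq, Set.mem_iUnion, Set.mem_preimage, exists_prop]
      constructor
      · rintro ⟨c, hc, rfl⟩
        refine ⟨∑ i ∈ s.erase j, c i, ⟨c, fun i hi => hc i (Finset.mem_of_mem_erase hi), rfl⟩, ?_⟩
        rw [← Finset.add_sum_erase s c hj, add_sub_cancel_right]
        exact hc j hj
      · rintro ⟨r, ⟨c, hc, rfl⟩, hv⟩
        refine ⟨Function.update c j (v - ∑ i ∈ s.erase j, c i), ?_, ?_⟩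
        · intro i hi
          rcases eq_or_ne i j with rfl | hij
          · simpa using hv
          · rw [Function.update_of_ne hij]; exact hc i (Finset.mem_erase.2 ⟨hij, hi⟩)
        · rw [← Finset.add_sum_erase s _ hj, Function.update_self]
          have : ∑ i ∈ s.erase j, Function.update c j (v - ∑ i ∈ s.erase j, c i) i =
              ∑ i ∈ s.erase j, c i :=
            Finset.sum_congr rfl fun i hi => Function.update_of_ne (Finset.ne_of_mem_erase hi) _ _
          rw [this]; ring
    rw [hU]
    exact isOpen_biUnion fun r _ => (isOpen_discCone _ _).preimage (by fun_prop)
  obtain ⟨f, hf⟩ := geometric_hahn_banach_open_point (x := (0 : ℂ)) hconv hopen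
    (fun ⟨c, hc, h⟩ => h0 c hc h.symm)
  rw [map_zero] at hf
  set g : ℂ →L[ℝ] ℝ := -f with hg
  have hg0 : ∀ v ∈ C, 0 < g v := fun v hv => by simpa [hg] using hf v hv
  have ha : ∀ i, a i ∈ discCone (a i) δ := fun i => ⟨1, one_pos, by simpa using hδ⟩
  -- If the functional were negative on one summand, enlarging that summand alone would make the
  -- whole sum negative.
  have hcone : ∀ i ∈ s, ∀ v ∈ discCone (a i) δ, 0 ≤ g v := by
    intro i hi v hv
    by_contra! hneg
    set G := ∑ k ∈ s.erase i, g (a k) with hGd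
    set t : ℝ := (|G| + 1) / (-g v) with ht
    have htpos : 0 < t := div_pos (by positivity) (by linarith)
    have := hg0 (∑ k ∈ s, Function.update a i (t * v) k) ⟨_, fun k hk => ?_, rfl⟩
    · rw [← Finset.add_sum_erase s _ hi, Function.update_self, map_add, map_sum,
        ← Complex.real_smul, map_smul, smul_eq_mul] at this
      have h2 : ∑ k ∈ s.erase i, g (Function.update a i (t • v) k) = G :=
        Finset.sum_congr rfl fun k hk => by rw [Function.update_of_ne (Finset.ne_of_mem_erase hk)]
      rw [h2] at this
      have h3 : t * g v = -(|G| + 1) := by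
        rw [ht, div_mul_eq_mul_div, div_eq_iff (by linarith)]; ring
      rw [h3] at this
      linarith [le_abs_self G]
    · rcases eq_or_ne k i with rfl | hki
      · rw [Function.update_self]; exact discCone_smul htpos hv
      · rw [Function.update_of_ne hki]; exact ha k
  set u₀ : ℂ := g 1 + g Complex.I * Complex.I with hu₀
  have hgdot : ∀ z, g z = dot z u₀ := strongDual_eq_dot g
  have hu₀ne : u₀ ≠ 0 := by
    intro h
    have := hg0 _ ⟨a, fun i _ => ha i, rfl⟩
    rw [hgdot, h] at this
    simp [dot] at this
  have hnpos : 0 < ‖u₀‖ := norm_pos_iff.2 hu₀ne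
  have hdotu : ∀ z, dot z (((1 / ‖u₀‖ : ℝ) : ℂ) * u₀) = dot z u₀ / ‖u₀‖ := by
    intro z; simp [dot]; ring
  refine ⟨((1 / ‖u₀‖ : ℝ) : ℂ) * u₀, ?_, fun i hi => ?_⟩
  · rw [norm_mul, Complex.norm_real, Real.norm_of_nonneg (by positivity)]; field_simp
  -- Moving `a i` by δ/2 against the unit normal stays in the thickened ray, and nonnegativity there
  -- is the margin δ/2.
  · have h1 := hcone i hi (a i + ((-(δ / 2 / ‖u₀‖) : ℝ) : ℂ) * u₀) ⟨1, one_pos, ?_⟩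
    · rw [hgdot, dot_add_left, dot_real_mul_left, dot_self] at h1
      rw [hdotu, le_div_iff₀ hnpos]
      have : -(δ / 2 / ‖u₀‖) * ‖u₀‖ ^ 2 = -(δ / 2 * ‖u₀‖) := by field_simp
      linarith
    · rw [Complex.ofReal_one, one_mul, add_sub_cancel_left, one_mul, norm_mul, Complex.norm_real,
        norm_neg, Real.norm_of_nonneg (by positivity)]
      field_simp
      linarith

namespace RhombusGraph

variable {T : RhombusGraph} {Φ : ℂ → (ℂ →₀ ℝ)}

/-- The directions, with signs, of the train tracks separating two points lie in a half-plane. -/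
theorem BoundedAngles.exists_direction (hT : T.BoundedAngles) (hΦ : T.IsPotential Φ) :
    ∃ c : ℝ, 0 < c ∧ c ≤ 1 ∧ ∀ x y : ℂ, x ≠ y → ∃ u : ℂ, ‖u‖ = 1 ∧ ∀ d : ℂ,
      (0 < (Φ y - Φ x) d → c ≤ dot d u) ∧ ((Φ y - Φ x) d < 0 → dot d u ≤ -c) := by
  obtain ⟨ε, hε, hε1, hεR⟩ := hT.exists_le_one
  refine ⟨ε / 8 / 2, by positivity, by linarith, fun x y hxy => ?_⟩
  set n := Φ y - Φ x with hn
  set σ : ℂ → ℝ := fun d => if 0 < n d then 1 else -1 with hσ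
  have hσ2 : ∀ d, σ d * σ d = 1 := fun d => by simp only [hσ]; split_ifs <;> norm_num
  have hσn : ∀ d, σ d * |n d| = n d := by
    intro d
    simp only [hσ]
    split_ifs with h
    · rw [abs_of_pos h, one_mul]
    · rw [abs_of_nonpos (not_lt.1 h)]; ring
  have hne : n.support.Nonempty := by
    rw [Finset.nonempty_iff_ne_empty]
    intro h
    rw [Finsupp.support_eq_empty] at h
    have := hT.weighted_sum_ne_zero hΦ hε hε1 hεR (fun _ => 1) (fun _ => 0) le_rfl (by simp)
      (by intro; simp; positivity) hxy
    rw [← hn, h] at this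
    simp at this
  have hdir := exists_direction_of_sum_ne_zero n.support hne (fun d => (σ d : ℂ) * d)
    (δ := ε / 8) (by positivity) ?_
  · obtain ⟨u, hu, h⟩ := hdir
    refine ⟨u, hu, fun d => ⟨fun hd => ?_, fun hd => ?_⟩⟩
    · have := h d (Finsupp.mem_support_iff.2 hd.ne')
      simpa [hσ, hd] using this
    · have := h d (Finsupp.mem_support_iff.2 hd.ne)
      rw [dot_real_mul_left] at this
      simp only [hσ, if_neg (not_lt.2 hd.le)] at this
      linarith
  · intro c hc hsum
    choose! w hw hcw using hc
    -- A vanishing sum of vectors `c d` is rewritten as a deformation that identifies `x` and `y`: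
    -- with these choices, `c d = n d * (W d * (d + η d))` on the support of `n`. Off the support
    -- the values 1 and 0 leave the sides unchanged.
    set W : ℂ → ℝ := fun d => if d ∈ n.support then w d / |n d| else 1 with hW
    set η : ℂ → ℂ := fun d => if d ∈ n.support then
      ((σ d / w d : ℝ) : ℂ) * (c d - w d * ((σ d : ℂ) * d)) else 0 with hη
    have hnd : ∀ d ∈ n.support, 0 < |n d| := fun d hd => abs_pos.2 (Finsupp.mem_support_iff.1 hd)
    have hWpos : ∀ d, 0 < W d := by
      intro d
      simp only [hW]
      split_ifs with hd
      · exact div_pos (hw d hd) (hnd d hd)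
      · exact one_pos
    -- This dominates `W d` and `1 / W d` for each of the finitely many directions in the support,
    -- and is at least 1 for the others.
    set M : ℝ := 1 + ∑ d ∈ n.support, (W d + 1 / W d) with hM
    have hterm : ∀ d, 0 ≤ W d + 1 / W d := fun d => by have := hWpos d; positivity
    have hM1 : 1 ≤ M := by
      have : 0 ≤ ∑ d ∈ n.support, (W d + 1 / W d) := Finset.sum_nonneg fun d _ => hterm d
      linarith
    refine hT.weighted_sum_ne_zero hΦ hε hε1 hεR W η hM1 ?_ ?_ hxy ?_
    · intro d
      by_cases hd : d ∈ n.support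
      · have h1 : W d + 1 / W d ≤ M := by
          have := Finset.single_le_sum (f := fun d => W d + 1 / W d) (fun d _ => hterm d) hd
          linarith
        have h2 := hWpos d
        have h3 : 0 < 1 / W d := by positivity
        constructor
        · rw [div_le_iff₀ (by linarith)]
          have : W d * (1 / W d) = 1 := by field_simp
          nlinarith
        · linarith
      · have : W d = 1 := by simp only [hW, if_neg hd]
        rw [this]
        exact ⟨by rw [div_le_one (by linarith)]; exact hM1, hM1⟩
    · intro d
      simp only [hη]
      split_ifs with hd
      · rw [norm_mul, Complex.norm_real, Real.norm_eq_abs, abs_div, abs_of_pos (hw d hd)]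
        have : |σ d| = 1 := by simp only [hσ]; split_ifs <;> simp
        rw [this, one_div_mul_eq_div, div_le_iff₀ (hw d hd)]
        have := hcw d hd
        linarith
      · simp; positivity
    · rw [Finsupp.linearCombination_apply, Finsupp.sum, ← hsum]
      refine Finset.sum_congr rfl fun d hd => ?_
      simp only [hW, hη, if_pos hd, Complex.real_smul]
      have h1 := hw d hd
      have h2 := hnd d hd
      have h1' : (w d : ℂ) ≠ 0 := by exact_mod_cast h1.ne'
      have h2' : ((|n d| : ℝ) : ℂ) ≠ 0 := by exact_mod_cast h2.ne'
      have h3 : (n d : ℂ) = σ d * ((|n d| : ℝ) : ℂ) := by exact_mod_cast (hσn d).symm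
      have h4 : (σ d : ℂ) * σ d = 1 := by exact_mod_cast hσ2 d
      rw [← hn, h3]
      push_cast
      field_simp
      linear_combination (c d - w d * d * σ d) * h4

end RhombusGraph

/-! ### Exponent vectors and their rational functions. -/

/-- The product of the factors `(z - d) ^ (-n d)`. -/
noncomputable def expEval (n : ℂ →₀ ℤ) (z : ℂ) : ℂ := n.prod fun d k => (z - d) ^ (-k)

/-- The rational function `∏ (X - d) ^ (-n d)`. -/
noncomputable def expRat (n : ℂ →₀ ℤ) : RatFunc ℂ :=
  n.prod fun d k => (RatFunc.X - RatFunc.C d) ^ (-k)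

theorem RatFunc.X_sub_C_ne_zero (d : ℂ) : (RatFunc.X - RatFunc.C d : RatFunc ℂ) ≠ 0 := by
  have : (RatFunc.X - RatFunc.C d : RatFunc ℂ) =
      algebraMap (Polynomial ℂ) (RatFunc ℂ) (Polynomial.X - Polynomial.C d) := by
    simp
  rw [this]
  exact RatFunc.algebraMap_ne_zero (Polynomial.X_sub_C_ne_zero d)

theorem expRat_zero : expRat 0 = 1 := Finsupp.prod_zero_index

theorem expRat_add (n m : ℂ →₀ ℤ) : expRat (n + m) = expRat n * expRat m := by
  classical
  refine Finsupp.prod_add_index (by simp) fun d _ a b => ?_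
  rw [neg_add, zpow_add₀ (RatFunc.X_sub_C_ne_zero d)]

theorem expRat_single (d : ℂ) (k : ℤ) :
    expRat (Finsupp.single d k) = (RatFunc.X - RatFunc.C d) ^ (-k) :=
  Finsupp.prod_single_index (by simp)

theorem expEval_zero (z : ℂ) : expEval 0 z = 1 := Finsupp.prod_zero_index

theorem expEval_single (d : ℂ) (k : ℤ) (z : ℂ) : expEval (Finsupp.single d k) z = (z - d) ^ (-k) :=
  Finsupp.prod_single_index (by simp)

/-- The hypotheses matter: at a point `z` where a zero of one function cancels a pole of the other,
the product of the two values is 0 and multiplicativity fails. -/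
theorem expEval_add {n m : ℂ →₀ ℤ} {z : ℂ} (hn : n z = 0) (hm : m z = 0) :
    expEval (n + m) z = expEval n z * expEval m z := by
  classical
  refine Finsupp.prod_add_index (by simp) fun d hd a b => ?_
  rw [neg_add, zpow_add₀]
  rw [sub_ne_zero]
  rintro rfl
  simp [hn, hm] at hd

theorem differentiableAt_expEval {n : ℂ →₀ ℤ} {z : ℂ} (hn : n z ≤ 0) :
    DifferentiableAt ℂ (expEval n) z := by
  have : expEval n = fun z => ∏ d ∈ n.support, (z - d) ^ (-n d) := rfl
  rw [this]
  refine DifferentiableAt.fun_finsetProd fun d _ => ?_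
  refine DifferentiableAt.zpow (by fun_prop) ?_
  rcases eq_or_ne z d with rfl | h
  · right; omega
  · left; exact sub_ne_zero.2 h

namespace RatFunc

/-- `f` is a fraction of polynomials whose denominator does not vanish at `z`, with value `c`. -/
def HasValue (z : ℂ) (f : RatFunc ℂ) (c : ℂ) : Prop :=
  ∃ p q : Polynomial ℂ, q.eval z ≠ 0 ∧
    f = algebraMap (Polynomial ℂ) (RatFunc ℂ) p / algebraMap (Polynomial ℂ) (RatFunc ℂ) q ∧
    c = p.eval z / q.eval z

/-- `RatFunc.eval` uses the reduced fraction. Its denominator divides `q`, hence does not vanish at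
`z`, and evaluation respects the product of the fraction with `q`. -/
theorem HasValue.eval {z : ℂ} {f : RatFunc ℂ} {c : ℂ} (h : HasValue z f c) :
    RatFunc.eval (RingHom.id ℂ) z f = c := by
  obtain ⟨p, q, hq, rfl, rfl⟩ := h
  have hq0 : q ≠ 0 := by rintro rfl; simp at hq
  have hqa : algebraMap (Polynomial ℂ) (RatFunc ℂ) q ≠ 0 := RatFunc.algebraMap_ne_zero hq0
  have hd : (Polynomial.eval₂ (RingHom.id ℂ) z (RatFunc.denom
      (algebraMap (Polynomial ℂ) (RatFunc ℂ) p / algebraMap (Polynomial ℂ) (RatFunc ℂ) q))) ≠ 0 := by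
    obtain ⟨r, hr⟩ := RatFunc.denom_div_dvd p q
    intro h0
    apply hq
    rw [hr, Polynomial.eval_mul]
    rw [show Polynomial.eval z _ = Polynomial.eval₂ (RingHom.id ℂ) z _ from rfl, h0, zero_mul]
  have h := RatFunc.eval_mul (f := RingHom.id ℂ) (a := z) hd
    (y := algebraMap (Polynomial ℂ) (RatFunc ℂ) q) (by simp [RatFunc.denom_algebraMap])
  rw [div_mul_cancel₀ _ hqa, RatFunc.eval_algebraMap, RatFunc.eval_algebraMap] at h
  rw [eq_div_iff hq]
  simpa [Polynomial.eval₂_id] using h.symm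

theorem HasValue.mul {z : ℂ} {f g : RatFunc ℂ} {c d : ℂ} (hf : HasValue z f c)
    (hg : HasValue z g d) : HasValue z (f * g) (c * d) := by
  obtain ⟨p, q, hq, rfl, rfl⟩ := hf
  obtain ⟨p', q', hq', rfl, rfl⟩ := hg
  refine ⟨p * p', q * q', by simp [hq, hq'], ?_, ?_⟩
  · simp [div_mul_div_comm]
  · simp [div_mul_div_comm]

theorem hasValue_one (z : ℂ) : HasValue z 1 1 := ⟨1, 1, by simp, by simp, by simp⟩

theorem HasValue.inv {z : ℂ} {f : RatFunc ℂ} {c : ℂ} (hf : HasValue z f c) (hc : c ≠ 0) :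
    HasValue z f⁻¹ c⁻¹ := by
  obtain ⟨p, q, hq, rfl, rfl⟩ := hf
  exact ⟨q, p, fun h => hc (by rw [h, zero_div]), by rw [inv_div], by rw [inv_div]⟩

theorem HasValue.pow {z : ℂ} {f : RatFunc ℂ} {c : ℂ} (hf : HasValue z f c) (k : ℕ) :
    HasValue z (f ^ k) (c ^ k) := by
  induction k with
  | zero => simpa using hasValue_one z
  | succ k ih => rw [pow_succ, pow_succ]; exact ih.mul hf

theorem HasValue.zpow {z : ℂ} {f : RatFunc ℂ} {c : ℂ} (hf : HasValue z f c) (hc : c ≠ 0) (k : ℤ) :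
    HasValue z (f ^ k) (c ^ k) := by
  cases k with
  | ofNat k => simpa using hf.pow k
  | negSucc k =>
    rw [zpow_negSucc, zpow_negSucc]
    exact (hf.pow _).inv (pow_ne_zero _ hc)

end RatFunc

theorem eval_expRat {n : ℂ →₀ ℤ} {z : ℂ} (hn : n z = 0) :
    RatFunc.eval (RingHom.id ℂ) z (expRat n) = expEval n z := by
  classical
  apply RatFunc.HasValue.eval
  rw [expRat, expEval, Finsupp.prod, Finsupp.prod]
  have h : ∀ s : Finset ℂ, z ∉ s → RatFunc.HasValue z
      (∏ d ∈ s, (RatFunc.X - RatFunc.C d) ^ (-n d)) (∏ d ∈ s, (z - d) ^ (-n d)) := by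
    intro s
    induction s using Finset.induction_on with
    | empty => intro _; simpa using RatFunc.hasValue_one z
    | insert d s hd ih =>
      intro hz
      rw [Finset.mem_insert, not_or] at hz
      rw [Finset.prod_insert hd, Finset.prod_insert hd]
      refine RatFunc.HasValue.mul (RatFunc.HasValue.zpow ?_ (sub_ne_zero.2 hz.1) _) (ih hz.2)
      exact ⟨Polynomial.X - Polynomial.C d, 1, by simp, by simp, by simp⟩
  exact h _ (by simp [hn])

/-- Integer exponents as real exponents. -/
noncomputable def toRealExp : (ℂ →₀ ℤ) →+ (ℂ →₀ ℝ) :=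
  Finsupp.mapRange.addMonoidHom (Int.castAddHom ℝ)

@[simp] theorem toRealExp_apply (n : ℂ →₀ ℤ) (d : ℂ) : toRealExp n d = n d := rfl

theorem toRealExp_single (d : ℂ) (k : ℤ) :
    toRealExp (Finsupp.single d k) = Finsupp.single d (k : ℝ) := by
  simp [toRealExp]

theorem toRealExp_injective : Function.Injective toRealExp := by
  intro n m h
  ext d
  have := DFunLike.congr_fun h d
  simpa using this

/-! ### Path independence of the discrete exponential. -/

namespace RhombusGraph

variable (T : RhombusGraph)

open Classical in
/-- Exponent vector of a step. -/
noncomputable def stepExponents (u v : ℂ) : ℂ →₀ ℤ :=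
  if T.Arrow u v then Finsupp.single (v - u) 1 else Finsupp.single (u - v) (-1)

/-- Exponent vector of a walk. -/
noncomputable def walkExponents : {u v : ℂ} → T.graph.Walk u v → (ℂ →₀ ℤ)
  | _, _, SimpleGraph.Walk.nil => 0
  | _, _, SimpleGraph.Walk.cons (u := u) (v := v) _ p => T.stepExponents u v + walkExponents p

open Classical in
/-- Exponent vector of the discrete exponential `g_{u → v}`. -/
noncomputable def exponents (u v : ℂ) : ℂ →₀ ℤ :=
  if h : T.graph.Reachable u v then T.walkExponents h.some else 0

theorem walkExp_eq {u v : ℂ} (p : T.graph.Walk u v) : T.walkExp p = expRat (T.walkExponents p) := by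
  induction p with
  | nil => exact expRat_zero.symm
  | cons h p ih =>
    rw [walkExp, walkExponents, expRat_add, ih]
    congr 1
    rw [stepFactor, stepExponents]
    split_ifs <;> rw [expRat_single] <;> simp

variable {T}

theorem discreteExp_eq {u v z : ℂ} (h : T.graph.Reachable u v) (hz : T.exponents u v z = 0) :
    T.discreteExp u v z = expEval (T.exponents u v) z := by
  rw [discreteExp, discreteExpRat, dif_pos h, walkExp_eq]
  rw [exponents, dif_pos h] at hz ⊢
  exact eval_expRat hz

theorem IsPotential.arrow {Φ : ℂ → (ℂ →₀ ℝ)} (hΦ : T.IsPotential Φ) {u v : ℂ} (h : T.Arrow u v) :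
    Φ v - Φ u = Finsupp.single (v - u) 1 := by
  obtain ⟨R, hR, ⟨rfl, rfl⟩ | ⟨rfl, rfl⟩ | ⟨rfl, rfl⟩ | ⟨rfl, rfl⟩⟩ := h
  · rw [hΦ R hR _ R.white_mem _ R.faceR_mem]
    simp [Rhombus.faceR, Rhombus.lin]
  · rw [hΦ R hR _ R.white_mem _ R.faceL_mem]
    simp [Rhombus.faceL, Rhombus.lin]
  · rw [hΦ R hR _ R.faceR_mem _ R.black_mem]
    simp [Rhombus.faceR, Rhombus.black, Rhombus.lin]
  · rw [hΦ R hR _ R.faceL_mem _ R.black_mem]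
    have : R.black - R.faceL = R.right := by simp [Rhombus.faceL, Rhombus.black]
    simp [this, Rhombus.lin]

theorem IsPotential.stepExponents {Φ : ℂ → (ℂ →₀ ℝ)} (hΦ : T.IsPotential Φ) {u v : ℂ}
    (h : T.graph.Adj u v) : toRealExp (T.stepExponents u v) = Φ v - Φ u := by
  rw [RhombusGraph.stepExponents]
  split_ifs with h1
  · rw [toRealExp_single, hΦ.arrow h1]; simp
  · have h2 : T.Arrow v u := by
      rw [graph, SimpleGraph.fromRel_adj] at h
      exact h.2.resolve_left h1
    rw [toRealExp_single, ← neg_sub (Φ u) (Φ v), hΦ.arrow h2, ← Finsupp.single_neg]; simp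

theorem IsPotential.walkExponents {Φ : ℂ → (ℂ →₀ ℝ)} (hΦ : T.IsPotential Φ) {u v : ℂ}
    (p : T.graph.Walk u v) : toRealExp (T.walkExponents p) = Φ v - Φ u := by
  induction p with
  | nil => simp [RhombusGraph.walkExponents]
  | cons h p ih =>
    rw [RhombusGraph.walkExponents, map_add, ih, hΦ.stepExponents h]; abel

/-- The exponents of a walk are the increment of the potential, in which the walk no longer appears.
The arbitrary walk chosen in the definition is therefore immaterial, and exponents add along
successive vertices. -/
theorem IsPotential.exponents {Φ : ℂ → (ℂ →₀ ℝ)} (hΦ : T.IsPotential Φ) {u v : ℂ}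
    (h : T.graph.Reachable u v) : toRealExp (T.exponents u v) = Φ v - Φ u := by
  rw [RhombusGraph.exponents, dif_pos h, hΦ.walkExponents]

theorem Arrow.ne {u v : ℂ} (h : T.Arrow u v) : u ≠ v := by
  obtain ⟨R, hR, h | h | h | h⟩ := h <;> obtain ⟨rfl, rfl⟩ := h
  · exact (T.white_ne_face hR hR).1
  · exact (T.white_ne_face hR hR).2
  · exact (T.black_ne_face hR hR).1.symm
  · exact (T.black_ne_face hR hR).2.symm

theorem Arrow.adj {u v : ℂ} (h : T.Arrow u v) : T.graph.Adj u v := by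
  rw [graph, SimpleGraph.fromRel_adj]
  exact ⟨h.ne, Or.inl h⟩

theorem reachable_of_isCorner {R : Rhombus} (hR : R ∈ T.rhombi) {v : ℂ} (h : R.IsCorner v) :
    T.graph.Reachable R.white v := by
  have h1 : T.Arrow R.white R.faceR := ⟨R, hR, Or.inl ⟨rfl, rfl⟩⟩
  have h2 : T.Arrow R.white R.faceL := ⟨R, hR, Or.inr (Or.inl ⟨rfl, rfl⟩)⟩
  have h3 : T.Arrow R.faceR R.black := ⟨R, hR, Or.inr (Or.inr (Or.inl ⟨rfl, rfl⟩))⟩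
  rcases h with rfl | rfl | rfl | rfl
  · exact SimpleGraph.Reachable.refl _
  · exact h1.adj.reachable
  · exact h2.adj.reachable
  · exact h1.adj.reachable.trans h3.adj.reachable

/-- `v` is a vertex of the tiling. -/
def IsVertex (T : RhombusGraph) (v : ℂ) : Prop := ∃ R ∈ T.rhombi, R.IsCorner v

/-- Whether a point lies in a rhombus reachable from `R₀` is constant on every rhombus, since two
rhombi with a common point share a corner; the plane is connected. -/
theorem BoundedAngles.reachable (hT : T.BoundedAngles) {u v : ℂ} (hu : T.IsVertex u)
    (hv : T.IsVertex v) : T.graph.Reachable u v := by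
  obtain ⟨R₀, hR₀, hu⟩ := hu
  obtain ⟨S₀, hS₀, hv⟩ := hv
  have key : ∀ R ∈ T.rhombi, ∀ x ∈ R.closedRegion,
      (∃ S ∈ T.rhombi, x ∈ S.closedRegion ∧ T.graph.Reachable R₀.white S.white) ↔
        T.graph.Reachable R₀.white R.white := by
    intro R hR x hx
    constructor
    · rintro ⟨S, hS, hxS, h⟩
      obtain ⟨c, h1, h2⟩ := T.exists_common_corner hR hS hx hxS
      exact h.trans ((reachable_of_isCorner hS h2).trans (reachable_of_isCorner hR h1).symm)
    · exact fun h => ⟨R, hR, hx, h⟩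
  have h := hT.eq_of_eq_on_rhombi
    (fun x => ∃ S ∈ T.rhombi, x ∈ S.closedRegion ∧ T.graph.Reachable R₀.white S.white)
    isPreconnected_univ (fun R hR x hx y hy => propext ((key R hR x hx.1).trans (key R hR y hy.1).symm))
    (Set.mem_univ R₀.white) (Set.mem_univ S₀.white)
  have h1 := (key S₀ hS₀ _ S₀.white_mem).1 (h.mp ⟨R₀, hR₀, R₀.white_mem, SimpleGraph.Reachable.refl _⟩)
  exact (reachable_of_isCorner hR₀ hu).symm.trans (h1.trans (reachable_of_isCorner hS₀ hv))

theorem IsWhite.isVertex {v : ℂ} (h : T.IsWhite v) : T.IsVertex v := by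
  obtain ⟨R, hR, rfl⟩ := h; exact ⟨R, hR, Or.inl rfl⟩

theorem IsBlack.isVertex {v : ℂ} (h : T.IsBlack v) : T.IsVertex v := by
  obtain ⟨R, hR, rfl⟩ := h; exact ⟨R, hR, by simp [Rhombus.IsCorner]⟩

theorem IsFace.isVertex {v : ℂ} (h : T.IsFace v) : T.IsVertex v := by
  obtain ⟨R, hR, rfl | rfl⟩ := h <;> exact ⟨R, hR, by simp [Rhombus.IsCorner]⟩

section Exponents

variable (hT : T.BoundedAngles)
include hT

theorem BoundedAngles.exponents_add {u v w : ℂ} (hu : T.IsVertex u) (hv : T.IsVertex v)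
    (hw : T.IsVertex w) : T.exponents u v + T.exponents v w = T.exponents u w := by
  obtain ⟨Φ, hΦ⟩ := hT.exists_isPotential
  apply toRealExp_injective
  rw [map_add, hΦ.exponents (hT.reachable hu hv), hΦ.exponents (hT.reachable hv hw),
    hΦ.exponents (hT.reachable hu hw)]
  abel

theorem BoundedAngles.exponents_self {u : ℂ} (hu : T.IsVertex u) : T.exponents u u = 0 := by
  have := hT.exponents_add hu hu hu
  simpa using this

theorem BoundedAngles.exponents_arrow {u v : ℂ} (h : T.Arrow u v) (hu : T.IsVertex u)
    (hv : T.IsVertex v) : T.exponents u v = Finsupp.single (v - u) 1 := by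
  obtain ⟨Φ, hΦ⟩ := hT.exists_isPotential
  apply toRealExp_injective
  rw [hΦ.exponents (hT.reachable hu hv), hΦ.arrow h, toRealExp_single]; simp

theorem BoundedAngles.exponents_symm {u v : ℂ} (hu : T.IsVertex u)
    (hv : T.IsVertex v) : T.exponents v u = -T.exponents u v := by
  have h1 := hT.exponents_add hu hv hu
  rw [hT.exponents_self hu] at h1
  exact (neg_eq_of_add_eq_zero_right h1).symm

/-- The exponents, weighted by the directions, add up to the displacement. -/
theorem BoundedAngles.sum_exponents {u v : ℂ} (hu : T.IsVertex u) (hv : T.IsVertex v) :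
    (T.exponents u v).sum (fun d k => (k : ℂ) * d) = v - u := by
  have key : ∀ {u v : ℂ} (p : T.graph.Walk u v),
      (T.walkExponents p).sum (fun d k => (k : ℂ) * d) = v - u := by
    intro u v p
    induction p with
    | nil => simp [walkExponents]
    | cons h p ih =>
      rw [walkExponents, Finsupp.sum_add_index' (by simp) (by intros; push_cast; ring), ih,
        stepExponents]
      split_ifs <;> rw [Finsupp.sum_single_index (by simp)] <;> simp
  rw [exponents, dif_pos (hT.reachable hu hv)]
  exact key _

/-- Directions of sides are unit vectors. -/
theorem BoundedAngles.norm_of_exponents_ne_zero {u v d : ℂ} (hu : T.IsVertex u) (hv : T.IsVertex v)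
    (hd : T.exponents u v d ≠ 0) : ‖d‖ = 1 := by
  have harrow : ∀ {u v : ℂ}, T.Arrow u v → ‖v - u‖ = 1 := by
    rintro u v ⟨R, hR, ⟨rfl, rfl⟩ | ⟨rfl, rfl⟩ | ⟨rfl, rfl⟩ | ⟨rfl, rfl⟩⟩
    · simp [Rhombus.faceR, R.norm_right]
    · simp [Rhombus.faceL, R.norm_left]
    · simp [Rhombus.faceR, Rhombus.black, R.norm_left]
    · have : R.black - R.faceL = R.right := by simp [Rhombus.faceL, Rhombus.black]
      rw [this, R.norm_right]
  have key : ∀ {u v : ℂ} (p : T.graph.Walk u v), ∀ d, T.walkExponents p d ≠ 0 → ‖d‖ = 1 := by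
    intro u v p
    induction p with
    | nil => intro d hd; simp [walkExponents] at hd
    | cons h p ih =>
      rename_i a b c
      intro d hd
      by_contra hn
      apply hd
      have h1 : T.walkExponents p d = 0 := by
        by_contra h; exact hn (ih d h)
      rw [walkExponents, Finsupp.add_apply, h1, add_zero, stepExponents]
      rw [graph, SimpleGraph.fromRel_adj] at h
      split_ifs with h2
      · rw [Finsupp.single_apply, if_neg]
        rintro rfl; exact hn (harrow h2)
      · rw [Finsupp.single_apply, if_neg]
        rintro rfl; exact hn (harrow (h.2.resolve_left h2))
  rw [exponents, dif_pos (hT.reachable hu hv)] at hd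
  exact key _ d hd

/-- The margin `c` is independent of the two vertices. Its positivity locates the poles in a half
plane; its uniformity gives the decay of the kernel. -/
theorem BoundedAngles.exists_exponents_direction : ∃ c : ℝ, 0 < c ∧ c ≤ 1 ∧ ∀ x y : ℂ,
    T.IsVertex x → T.IsVertex y → x ≠ y → ∃ u : ℂ, ‖u‖ = 1 ∧ ∀ d : ℂ,
      (0 < T.exponents x y d → c ≤ dot d u) ∧ (T.exponents x y d < 0 → dot d u ≤ -c) := by
  obtain ⟨Φ, hΦ⟩ := hT.exists_isPotential
  obtain ⟨c, h0, h1, h⟩ := hT.exists_direction hΦ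
  refine ⟨c, h0, h1, fun x y hx hy hxy => ?_⟩
  obtain ⟨u, hu, hd⟩ := h x y hxy
  refine ⟨u, hu, fun d => ?_⟩
  have h2 := hd d
  rw [← hΦ.exponents (hT.reachable hx hy), toRealExp_apply] at h2
  exact_mod_cast h2

end Exponents

/-- The corners of a rhombus, in terms of exponents from the white corner to the black one. -/
theorem BoundedAngles.exponents_white_black (hT : T.BoundedAngles) {R : Rhombus} (hR : R ∈ T.rhombi) :
    T.exponents R.white R.black = Finsupp.single R.right 1 + Finsupp.single R.left 1 := by
  have hw : T.IsVertex R.white := ⟨R, hR, by simp [Rhombus.IsCorner]⟩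
  have hf : T.IsVertex R.faceR := ⟨R, hR, by simp [Rhombus.IsCorner]⟩
  have hb : T.IsVertex R.black := ⟨R, hR, by simp [Rhombus.IsCorner]⟩
  rw [← hT.exponents_add hw hf hb, hT.exponents_arrow ⟨R, hR, Or.inl ⟨rfl, rfl⟩⟩ hw hf,
    hT.exponents_arrow ⟨R, hR, Or.inr (Or.inr (Or.inl ⟨rfl, rfl⟩))⟩ hf hb]
  simp [Rhombus.faceR, Rhombus.black]

end RhombusGraph

/-! ### Integrals along rays: rotation, decay, and the value for one rhombus. -/

open MeasureTheory Filter Topology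

/-- Points of the convex cone spanned by two vectors. -/
def cone (a b : ℂ) : Set ℂ := {z | ∃ x y : ℝ, 0 ≤ x ∧ 0 ≤ y ∧ z = x * a + y * b}

theorem convex_cone (a b : ℂ) : Convex ℝ (cone a b) := by
  rintro _ ⟨x, y, hx, hy, rfl⟩ _ ⟨x', y', hx', hy', rfl⟩ p q hp hq -
  refine ⟨p * x + q * x', p * y + q * y', by positivity, by positivity, ?_⟩
  simp only [Complex.real_smul]
  push_cast
  ring

theorem left_mem_cone {a b : ℂ} {t : ℝ} (ht : 0 ≤ t) : (t : ℂ) * a ∈ cone a b :=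
  ⟨t, 0, ht, le_rfl, by simp⟩

theorem right_mem_cone {a b : ℂ} {t : ℝ} (ht : 0 ≤ t) : (t : ℂ) * b ∈ cone a b :=
  ⟨0, t, le_rfl, ht, by simp⟩

/-- A function with quadratic decay is integrable along a ray. -/
theorem integrableOn_ray {f : ℂ → ℂ} {ρ : ℂ} {C : ℝ} (hρ : ‖ρ‖ = 1)
    (hf : ContinuousOn (fun t : ℝ => f (t * ρ)) (Set.Ici 0))
    (hC : ∀ z : ℂ, 2 ≤ ‖z‖ → ‖f z‖ ≤ C / ‖z‖ ^ 2) :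
    IntegrableOn (fun t : ℝ => f (t * ρ)) (Set.Ioi 0) := by
  have h1 : IntegrableOn (fun t : ℝ => f (t * ρ)) (Set.Icc 0 2) :=
    (hf.mono Set.Icc_subset_Ici_self).integrableOn_Icc
  have h2 : IntegrableOn (fun t : ℝ => f (t * ρ)) (Set.Ioi 2) := by
    have h3 : IntegrableOn (fun t : ℝ => C * t ^ (-2 : ℝ)) (Set.Ioi 2) :=
      (integrableOn_Ioi_rpow_of_lt (by norm_num) (by norm_num)).const_mul C
    refine h3.mono' ?_ ?_
    · exact (hf.mono (fun t ht => by
        have : (2 : ℝ) < t := ht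
        exact (by linarith : (0 : ℝ) ≤ t))).aestronglyMeasurable measurableSet_Ioi
    · refine (ae_restrict_iff' measurableSet_Ioi).2 (Eventually.of_forall fun t ht => ?_)
      have ht2 : (2 : ℝ) < t := ht
      have hn : ‖(t : ℂ) * ρ‖ = t := by
        rw [norm_mul, hρ, mul_one, Complex.norm_real, Real.norm_of_nonneg (by linarith)]
      have := hC (t * ρ) (by rw [hn]; linarith)
      rw [hn] at this
      rw [Real.rpow_neg (by linarith), ← div_eq_mul_inv]
      exact_mod_cast this
  refine (h1.union h2).mono_set fun t ht => ?_
  rcases le_or_gt t 2 with h | h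
  · exact Or.inl ⟨le_of_lt ht, h⟩
  · exact Or.inr h

/-- The chord between unit vectors at an angle of at most π/2 stays at distance at least 1/√2 from
0. This bounds the segment that closes the contour when a ray is rotated. -/
theorem half_le_norm_sq {a b : ℂ} (ha : ‖a‖ = 1) (hb : ‖b‖ = 1) (hab : 0 ≤ dot a b) {x y : ℝ}
    (hx : 0 ≤ x) (hy : 0 ≤ y) (hxy : x + y = 1) : 1 / 2 ≤ ‖(x : ℂ) * a + y * b‖ ^ 2 := by
  have h1 : ‖(x : ℂ) * a + y * b‖ ^ 2 = x ^ 2 * ‖a‖ ^ 2 + y ^ 2 * ‖b‖ ^ 2 + 2 * (x * y) * dot a b := by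
    rw [← dot_self, ← dot_self, ← dot_self]
    simp [dot]; ring
  rw [h1, ha, hb]
  have := mul_nonneg (mul_nonneg hx hy) hab
  nlinarith [sq_nonneg (x - y)]

/-- A contour integral along a ray may be rotated through a sector where the integrand is
holomorphic. -/
theorem ray_rotate {f : ℂ → ℂ} {a b : ℂ} {C : ℝ} (ha : ‖a‖ = 1) (hb : ‖b‖ = 1)
    (hab : 0 ≤ dot a b) (hf : DifferentiableOn ℂ f (cone a b))
    (hC : ∀ z : ℂ, 2 ≤ ‖z‖ → ‖f z‖ ≤ C / ‖z‖ ^ 2) :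
    ∫ t in Set.Ioi (0 : ℝ), f (t * a) * a = ∫ t in Set.Ioi (0 : ℝ), f (t * b) * b := by
  have hC0 : 0 ≤ C := by
    have := hC 2 (by simp)
    have h2 := (norm_nonneg _).trans this
    simp only [Complex.norm_ofNat] at h2
    by_contra h
    have : C / 2 ^ 2 < 0 := by apply div_neg_of_neg_of_pos <;> [linarith; norm_num]
    linarith
  obtain ⟨G, hG⟩ := (convex_cone a b).exists_forall_hasDerivWithinAt hf
  have key : ∀ c : ℂ, ‖c‖ = 1 → (∀ t : ℝ, 0 ≤ t → (t : ℂ) * c ∈ cone a b) →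
      Tendsto (fun T : ℝ => G (T * c) - G 0) atTop (𝓝 (∫ t in Set.Ioi (0 : ℝ), f (t * c) * c)) := by
    intro c hc hmem
    have hcont : ContinuousOn (fun t : ℝ => f (t * c)) (Set.Ici 0) :=
      hf.continuousOn.comp (by fun_prop) fun t ht => hmem t ht
    have hint : IntegrableOn (fun t : ℝ => f (t * c) * c) (Set.Ioi 0) :=
      (integrableOn_ray hc hcont hC).mul_const c
    refine (intervalIntegral_tendsto_integral_Ioi 0 hint tendsto_id).congr' ?_
    filter_upwards [eventually_ge_atTop 0] with T hT
    have hd : ∀ t ∈ Set.Ici (0 : ℝ), HasDerivWithinAt (fun t : ℝ => G (t * c)) (f (t * c) * c)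
        (Set.Ici 0) t := by
      intro t ht
      have h1 : HasDerivWithinAt (fun t : ℝ => (t : ℂ) * c) c (Set.Ici 0) t := by
        simpa using ((Complex.ofRealCLM.hasDerivAt (x := t)).mul_const c).hasDerivWithinAt
      have h2 := (hG _ (hmem t ht)).scomp t h1 (fun t ht => hmem t ht)
      rw [smul_eq_mul, mul_comm] at h2
      exact h2
    have := intervalIntegral.integral_eq_sub_of_hasDeriv_right (a := 0) (b := T)
      (f := fun t : ℝ => G (t * c)) (f' := fun t : ℝ => f (t * c) * c) ?_ ?_ ?_
    · simpa using this
    · rw [Set.uIcc_of_le hT]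
      exact fun t ht => ((hd t ht.1).continuousWithinAt).mono Set.Icc_subset_Ici_self
    · intro t ht
      rw [min_eq_left hT] at ht
      exact (hd t ht.1.le).mono fun x hx => (ht.1.trans hx).le
    · refine ContinuousOn.intervalIntegrable ?_
      rw [Set.uIcc_of_le hT]
      exact (hcont.mono Set.Icc_subset_Ici_self).mul continuousOn_const
  have hA := key a ha fun t ht => left_mem_cone ht
  have hB := key b hb fun t ht => right_mem_cone ht
  have hAB := hA.sub hB
  -- A primitive exists on the convex cone, so only the chord from `T * b` to `T * a` matters. There
  -- the integrand is at most 2C/T² and the length at most 2T.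
  have hz : Tendsto (fun T : ℝ => (G (T * a) - G 0) - (G (T * b) - G 0)) atTop (𝓝 0) := by
    have h4 : Tendsto (fun T : ℝ => 4 * C / T) atTop (𝓝 0) := tendsto_const_nhds.div_atTop tendsto_id
    refine squeeze_zero_norm' ?_ h4
    filter_upwards [eventually_ge_atTop 4] with T hT
    have hT0 : 0 < T := by linarith
    have hseg : ∀ z ∈ segment ℝ ((T : ℂ) * b) (T * a), z ∈ cone a b ∧ T ^ 2 / 2 ≤ ‖z‖ ^ 2 := by
      rintro _ ⟨y, x, hy, hx, hyx, rfl⟩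
      refine ⟨⟨x * T, y * T, by positivity, by positivity, ?_⟩, ?_⟩
      · simp only [Complex.real_smul]; push_cast; ring
      · have h1 := half_le_norm_sq ha hb hab hx hy (by linarith)
        have h2 : y • ((T : ℂ) * b) + x • (T * a) = (T : ℂ) * (x * a + y * b) := by
          simp only [Complex.real_smul]; ring
        rw [h2, norm_mul, mul_pow, Complex.norm_real, Real.norm_of_nonneg hT0.le]
        nlinarith [sq_nonneg T]
    have h5 := Convex.norm_image_sub_le_of_norm_hasDerivWithin_le (f := G) (f' := f)
      (s := segment ℝ ((T : ℂ) * b) (T * a)) (x := T * b) (y := T * a) (C := 2 * C / T ^ 2)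
      (fun z hz => (hG z (hseg z hz).1).mono fun w hw => (hseg w hw).1) ?_ (convex_segment _ _)
      (left_mem_segment ℝ _ _) (right_mem_segment ℝ _ _)
    · rw [sub_sub_sub_cancel_right]
      refine h5.trans ?_
      have h6 : ‖(T : ℂ) * a - T * b‖ ≤ T * 2 := by
        rw [← mul_sub, norm_mul, Complex.norm_real, Real.norm_of_nonneg hT0.le]
        gcongr
        refine (norm_sub_le _ _).trans ?_
        rw [ha, hb]; norm_num
      calc 2 * C / T ^ 2 * ‖(T : ℂ) * a - T * b‖ ≤ 2 * C / T ^ 2 * (T * 2) := by gcongr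
        _ = 4 * C / T := by field_simp; ring
    · intro z hz
      have h7 := (hseg z hz).2
      have h8 : 2 ≤ ‖z‖ := by
        by_contra h
        push Not at h
        nlinarith [norm_nonneg z]
      refine (hC z h8).trans ?_
      have h9 : C / ‖z‖ ^ 2 ≤ C / (T ^ 2 / 2) := by gcongr
      refine h9.trans (le_of_eq ?_)
      field_simp
  have := tendsto_nhds_unique hAB hz
  exact sub_eq_zero.1 this

theorem degree_eq_sum (n : ℂ →₀ ℤ) : n.degree = ∑ d ∈ n.support, n d := Finsupp.degree_apply n

/-- Exponent vectors with unit directions decay at infinity with their degree. -/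
theorem exists_norm_expEval_le {n : ℂ →₀ ℤ} (hn : ∀ d, n d ≠ 0 → ‖d‖ = 1) (h2 : n.degree = 2) :
    ∃ C : ℝ, ∀ z : ℂ, 2 ≤ ‖z‖ → ‖expEval n z‖ ≤ C / ‖z‖ ^ 2 := by
  refine ⟨∏ d ∈ n.support, (2 : ℝ) ^ |n d|, fun z hz => ?_⟩
  have hz0 : 0 < ‖z‖ := by linarith
  have h1 : ∀ d ∈ n.support, ‖(z - d) ^ (-n d)‖ ≤ (2 : ℝ) ^ |n d| * ‖z‖ ^ (-n d) := by
    intro d hd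
    have hd1 := hn d (Finsupp.mem_support_iff.1 hd)
    have hlo : ‖z‖ / 2 ≤ ‖z - d‖ := by
      have := norm_sub_norm_le z d
      linarith
    have hhi : ‖z - d‖ ≤ 2 * ‖z‖ := by
      have := norm_sub_le z d
      linarith
    rw [norm_zpow]
    rcases le_total 0 (n d) with h | h
    · rw [abs_of_nonneg h]
      lift n d to ℕ using h with k
      rw [zpow_neg, zpow_neg, zpow_natCast, zpow_natCast, zpow_natCast, ← div_eq_mul_inv,
        ← inv_div, ← div_pow]
      gcongr
    · rw [abs_of_nonpos h]
      obtain ⟨k, hk⟩ := Int.eq_ofNat_of_zero_le (neg_nonneg.2 h)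
      rw [hk, zpow_natCast, zpow_natCast, zpow_natCast, ← mul_pow]
      gcongr
  calc ‖expEval n z‖ = ∏ d ∈ n.support, ‖(z - d) ^ (-n d)‖ := by
        rw [expEval, Finsupp.prod, norm_prod]
    _ ≤ ∏ d ∈ n.support, ((2 : ℝ) ^ |n d| * ‖z‖ ^ (-n d)) :=
        Finset.prod_le_prod (fun _ _ => norm_nonneg _) h1
    _ = (∏ d ∈ n.support, (2 : ℝ) ^ |n d|) * ‖z‖ ^ (-n.degree) := by
        rw [Finset.prod_mul_distrib, degree_eq_sum, ← Finset.sum_neg_distrib]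
        congr 1
        generalize n.support = s
        classical
        induction s using Finset.induction_on with
        | empty => simp
        | insert d s hd ih => rw [Finset.prod_insert hd, Finset.sum_insert hd, zpow_add₀ hz0.ne', ih]
    _ = _ := by
        rw [h2, zpow_neg, div_eq_mul_inv]; norm_cast

/-- The integral of `∏ (z - d) ^ (-n d)` along the ray from `0` through `ρ`. -/
noncomputable def rayInt (n : ℂ →₀ ℤ) (ρ : ℂ) : ℂ :=
  ∫ t in Set.Ioi (0 : ℝ), expEval n (t * ρ) * ρ

theorem continuousOn_expEval_ray {n : ℂ →₀ ℤ} {ρ : ℂ}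
    (h : ∀ t : ℝ, 0 ≤ t → n (t * ρ) ≤ 0) :
    ContinuousOn (fun t : ℝ => expEval n (t * ρ)) (Set.Ici 0) := fun t ht =>
  ContinuousAt.continuousWithinAt <|
    ContinuousAt.comp (f := fun t : ℝ => (t : ℂ) * ρ) (differentiableAt_expEval (h t ht)).continuousAt
      (by fun_prop)

theorem integrableOn_expEval_ray {n : ℂ →₀ ℤ} (hn : ∀ d, n d ≠ 0 → ‖d‖ = 1) (h2 : n.degree = 2)
    {ρ : ℂ} (hρ : ‖ρ‖ = 1) (h : ∀ t : ℝ, 0 ≤ t → n (t * ρ) ≤ 0) :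
    IntegrableOn (fun t : ℝ => expEval n (t * ρ)) (Set.Ioi 0) := by
  obtain ⟨C, hC⟩ := exists_norm_expEval_le hn h2
  exact integrableOn_ray hρ (continuousOn_expEval_ray h) hC

/-- A pole in the sector between −s and −p would have the form −(x s + y p) with x, y ≥ 0, and its
product with `s` would be nonpositive. The boundary case of `p` orthogonal to `s` is allowed; it is
needed for the zipper. -/
theorem rayInt_rotate {n : ℂ →₀ ℤ} (hn : ∀ d, n d ≠ 0 → ‖d‖ = 1) (h2 : n.degree = 2)
    {s p : ℂ} (hs : ‖s‖ = 1) (hp : ‖p‖ = 1) (hns : ∀ d, 0 < n d → 0 < dot d s)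
    (hps : 0 ≤ dot p s) : rayInt n (-s) = rayInt n (-p) := by
  obtain ⟨C, hC⟩ := exists_norm_expEval_le hn h2
  refine ray_rotate (by simpa using hs) (by simpa using hp) ?_ ?_ hC
  · simp only [dot, Complex.neg_re, Complex.neg_im] at hps ⊢
    linarith
  · rintro z ⟨x, y, hx, hy, rfl⟩
    refine (differentiableAt_expEval ?_).differentiableWithinAt
    by_contra h
    push Not at h
    have h3 := hns _ h
    rw [dot_add_left, dot_real_mul_left, dot_real_mul_left, dot_neg_left, dot_neg_left, dot_self,
      hs] at h3
    nlinarith [mul_nonneg hy hps]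

theorem expEval_ray_nonpos {n : ℂ →₀ ℤ} {s p : ℂ} (hns : ∀ d, 0 < n d → 0 < dot d s)
    (hps : 0 ≤ dot p s) (t : ℝ) (ht : 0 ≤ t) : n (t * -p) ≤ 0 := by
  by_contra h
  push Not at h
  have h3 := hns _ h
  rw [dot_real_mul_left, dot_neg_left] at h3
  nlinarith [mul_nonneg ht hps]

open MeasureTheory Filter Topology

theorem norm_sub_sq_of_ray {d s : ℂ} (hd : ‖d‖ = 1) (hs : ‖s‖ = 1) (t : ℝ) :
    ‖(t : ℂ) * -s - d‖ ^ 2 = 1 + t ^ 2 + 2 * t * dot d s := by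
  have h1 : ‖(t : ℂ) * -s - d‖ ^ 2 = t ^ 2 * ‖s‖ ^ 2 + ‖d‖ ^ 2 + 2 * t * dot d s := by
    rw [← dot_self, ← dot_self, ← dot_self]
    simp [dot]; ring
  rw [h1, hd, hs]; ring

/-- Exponents with margin `c` give a function that is small on the opposite ray. -/
theorem norm_expEval_ray_le {n : ℂ →₀ ℤ} (hn : ∀ d, n d ≠ 0 → ‖d‖ = 1) (h2 : n.degree = 2)
    {s : ℂ} (hs : ‖s‖ = 1) {c : ℝ} (hc : 0 < c)
    (hns : ∀ d, (0 < n d → c ≤ dot d s) ∧ (n d < 0 → dot d s ≤ -c))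
    {N : ℕ} (hN : (N : ℤ) = ∑ d ∈ n.support, |n d|) (hN4 : 4 ≤ N) {t : ℝ} (ht : 0 ≤ t) :
    ‖expEval n (t * -s)‖ ≤ (1 + t ^ 2) / (1 + t ^ 2 + N * c / 2 * t) ^ 2 := by
  set q := 1 + t ^ 2 with hq
  have hq0 : 0 < q := by positivity
  set y := q + 2 * t * c with hy
  have hy0 : 0 < y := by positivity
  -- On the ray, the square of the distance to `d` is q + 2t⟨d, s⟩. It is at least `y` at a pole and
  -- at most q − 2tc ≤ q²/y at a zero, so each unit of exponent gains the factor q/y over the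
  -- neutral value.
  have hfac : ∀ d ∈ n.support,
      ‖((t : ℂ) * -s - d) ^ (-n d)‖ ^ 2 ≤ q ^ (-n d) * (q / y) ^ |n d| := by
    intro d hd
    rw [Finsupp.mem_support_iff] at hd
    have hnorm := norm_sub_sq_of_ray (hn d hd) hs t
    rw [← hq] at hnorm
    rw [norm_zpow, ← zpow_natCast, zpow_comm, zpow_natCast, hnorm]
    rcases lt_or_gt_of_ne hd with h | h
    · rw [abs_of_neg h]
      obtain ⟨k, hk⟩ := Int.eq_ofNat_of_zero_le (neg_nonneg.2 h.le)
      rw [hk, zpow_natCast, zpow_natCast, zpow_natCast, ← mul_pow]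
      have h3 : 0 ≤ q + 2 * t * dot d s := by rw [← hnorm]; positivity
      gcongr
      have h4 : t * dot d s ≤ t * -c := mul_le_mul_of_nonneg_left ((hns d).2 h) ht
      rw [← mul_div_assoc, le_div_iff₀ hy0]
      calc (q + 2 * t * dot d s) * y ≤ (q - 2 * t * c) * y := by gcongr; linarith
        _ ≤ q * q := by rw [hy]; nlinarith [sq_nonneg (t * c)]
    · rw [abs_of_pos h]
      obtain ⟨k, hk⟩ := Int.eq_ofNat_of_zero_le h.le
      rw [hk, zpow_neg, zpow_neg, zpow_natCast, zpow_natCast, zpow_natCast]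
      have h4 : t * c ≤ t * dot d s := mul_le_mul_of_nonneg_left ((hns d).1 h) ht
      have h5 : y ≤ q + 2 * t * dot d s := by rw [hy]; linarith
      calc ((q + 2 * t * dot d s) ^ k)⁻¹ ≤ (y ^ k)⁻¹ := by gcongr
        _ = (q ^ k)⁻¹ * (q / y) ^ k := by rw [div_pow]; field_simp
  have hsq : ‖expEval n (t * -s)‖ ^ 2 ≤ (q ^ 2)⁻¹ * (q / y) ^ N := by
    calc ‖expEval n (t * -s)‖ ^ 2 = ∏ d ∈ n.support, ‖((t : ℂ) * -s - d) ^ (-n d)‖ ^ 2 := by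
          rw [expEval, Finsupp.prod, norm_prod, Finset.prod_pow]
      _ ≤ ∏ d ∈ n.support, (q ^ (-n d) * (q / y) ^ |n d|) :=
          Finset.prod_le_prod (fun _ _ => by positivity) hfac
      _ = q ^ (-n.degree) * (q / y) ^ (N : ℤ) := by
          rw [Finset.prod_mul_distrib, degree_eq_sum, hN, ← Finset.sum_neg_distrib]
          have hprod : ∀ (x : ℝ) (_ : 0 < x) (f : ℂ → ℤ) (S : Finset ℂ),
              ∏ d ∈ S, x ^ f d = x ^ ∑ d ∈ S, f d := by
            intro x hx f S
            classical
            induction S using Finset.induction_on with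
            | empty => simp
            | insert d S hd ih =>
              rw [Finset.prod_insert hd, Finset.sum_insert hd, zpow_add₀ hx.ne', ih]
          rw [hprod q hq0, hprod (q / y) (by positivity)]
      _ = _ := by rw [h2, zpow_neg, zpow_natCast]; norm_cast
  set A := N * c / 2 with hA
  have hA0 : 0 ≤ A := by positivity
  have hpow : (q / y) ^ N ≤ (q / (q + A * t)) ^ 4 := by
    have hx0 : 0 ≤ 2 * t * c / q := by positivity
    -- Bernoulli's inequality with exponent N/4, which is where `4 ≤ N` enters; the remaining fourth
    -- power is what the square of the claimed bound requires.
    have h1 := one_add_mul_self_le_rpow_one_add (s := 2 * t * c / q) (by linarith)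
      (p := (N : ℝ) / 4) (by
        rw [le_div_iff₀ (by norm_num)]
        exact_mod_cast hN4)
    have h3 : (y / q) ^ N = ((1 + 2 * t * c / q) ^ ((N : ℝ) / 4)) ^ 4 := by
      have h4 : y / q = 1 + 2 * t * c / q := by rw [hy]; field_simp
      rw [h4, ← Real.rpow_natCast _ 4, ← Real.rpow_mul (by positivity), ← Real.rpow_natCast]
      congr 1
      push_cast; ring
    have h5 : ((q + A * t) / q) ^ 4 ≤ (y / q) ^ N := by
      rw [h3]
      have h6 : (q + A * t) / q = 1 + (N : ℝ) / 4 * (2 * t * c / q) := by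
        rw [hA]; field_simp; ring
      rw [h6]
      gcongr
    rw [← inv_div y q, ← inv_div (q + A * t) q, inv_pow, inv_pow]
    gcongr
  have hfin : ‖expEval n (t * -s)‖ ^ 2 ≤ (q / (q + A * t) ^ 2) ^ 2 := by
    refine hsq.trans ?_
    calc (q ^ 2)⁻¹ * (q / y) ^ N ≤ (q ^ 2)⁻¹ * (q / (q + A * t)) ^ 4 := by gcongr
      _ = _ := by field_simp
  exact (pow_le_pow_iff_left₀ (norm_nonneg _) (by positivity) two_ne_zero).1 hfin

/-- With A = Nc/2 the integrand is at most 1/(1 + At)² + 1/(t + A)², and each of the two terms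
integrates to 1/A. -/
theorem norm_rayInt_le {n : ℂ →₀ ℤ} (hn : ∀ d, n d ≠ 0 → ‖d‖ = 1) (h2 : n.degree = 2)
    {s : ℂ} (hs : ‖s‖ = 1) {c : ℝ} (hc : 0 < c)
    (hns : ∀ d, (0 < n d → c ≤ dot d s) ∧ (n d < 0 → dot d s ≤ -c))
    {N : ℕ} (hN : (N : ℤ) = ∑ d ∈ n.support, |n d|) (hN4 : 4 ≤ N) :
    ‖rayInt n (-s)‖ ≤ 4 / (N * c) := by
  set A := N * c / 2 with hA
  have hN0 : (4 : ℝ) ≤ N := by exact_mod_cast hN4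
  have hA0 : 0 < A := by positivity
  have hderiv : ∀ t ∈ Set.Ici (0 : ℝ), HasDerivAt
      (fun t : ℝ => -(A * (1 + A * t))⁻¹ - (t + A)⁻¹)
      (((1 + A * t) ^ 2)⁻¹ + ((t + A) ^ 2)⁻¹) t := by
    intro t ht
    have ht0 : 0 ≤ t := ht
    have e1 : HasDerivAt (fun t : ℝ => A * (1 + A * t)) (A * A) t := by
      simpa using (((hasDerivAt_id t).const_mul A).const_add 1).const_mul A
    have e2 : HasDerivAt (fun t : ℝ => t + A) 1 t := (hasDerivAt_id t).add_const A
    have e3 := (e1.fun_inv (by positivity)).neg.sub (e2.fun_inv (by positivity))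
    refine e3.congr_deriv ?_
    field_simp
    ring
  have hlim : Tendsto (fun t : ℝ => -(A * (1 + A * t))⁻¹ - (t + A)⁻¹) atTop (𝓝 0) := by
    have e1 : Tendsto (fun t : ℝ => A * (1 + A * t)) atTop atTop :=
      (tendsto_atTop_add_const_left _ _ (tendsto_id.const_mul_atTop hA0)).const_mul_atTop hA0
    have e2 : Tendsto (fun t : ℝ => t + A) atTop atTop := tendsto_atTop_add_const_right _ _ tendsto_id
    simpa using e1.inv_tendsto_atTop.neg.sub e2.inv_tendsto_atTop
  have hnonneg : ∀ t ∈ Set.Ioi (0 : ℝ), 0 ≤ ((1 + A * t) ^ 2)⁻¹ + ((t + A) ^ 2)⁻¹ :=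
    fun t _ => by positivity
  have hint := integrableOn_Ioi_deriv_of_nonneg' hderiv hnonneg hlim
  have hval := integral_Ioi_of_hasDerivAt_of_nonneg' hderiv hnonneg hlim
  have hle : ‖rayInt n (-s)‖ ≤ ∫ t in Set.Ioi (0 : ℝ), ((1 + A * t) ^ 2)⁻¹ + ((t + A) ^ 2)⁻¹ := by
    refine norm_integral_le_of_norm_le hint ?_
    refine (ae_restrict_iff' measurableSet_Ioi).2 (Eventually.of_forall fun t ht => ?_)
    have ht0 : 0 < t := ht
    rw [norm_mul, norm_neg, hs, mul_one]
    refine (norm_expEval_ray_le hn h2 hs hc hns hN hN4 ht0.le).trans ?_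
    rw [← hA, add_div]
    refine add_le_add ?_ ?_
    · rw [one_div]
      gcongr
      nlinarith
    · have : t ^ 2 / (1 + t ^ 2 + A * t) ^ 2 ≤ t ^ 2 / (t * (t + A)) ^ 2 := by
        gcongr
        nlinarith
      refine this.trans (le_of_eq ?_)
      field_simp
  rw [hval] at hle
  refine hle.trans (le_of_eq ?_)
  rw [hA]
  field_simp
  ring

/-- By partial fractions the integrand has the primitive log(1 + t ā s) − log(1 + t b̄ s). Both
arguments have positive real part, so the principal branch applies, and the common growth log t
cancels at infinity. -/
theorem log_sub_log_ray {a b s : ℂ} (ha : ‖a‖ = 1) (hb : ‖b‖ = 1) (hs : ‖s‖ = 1)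
    (has : 0 < dot a s) (hbs : 0 < dot b s) :
    (a - b) * rayInt (Finsupp.single b 1 + Finsupp.single a 1) (-s) =
      Complex.log (starRingEnd ℂ a * s) - Complex.log (starRingEnd ℂ b * s) := by
  have hre : ∀ {d : ℂ}, 0 < dot d s → 0 < (starRingEnd ℂ d * s).re := by
    intro d hd
    simpa [dot] using hd
  have hinv : ∀ {d : ℂ}, ‖d‖ = 1 → d * starRingEnd ℂ d = 1 := by
    intro d hd
    rw [Complex.mul_conj, Complex.normSq_eq_norm_sq, hd]; simp
  have hray : ∀ {d : ℂ}, 0 < dot d s → ∀ t : ℝ, 0 ≤ t → (t : ℂ) * -s - d ≠ 0 := by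
    intro d hd t ht h
    rw [sub_eq_zero] at h
    rw [← h, dot_real_mul_left, dot_neg_left, dot_self, hs] at hd
    linarith
  have hslit : ∀ {d : ℂ}, 0 < dot d s → ∀ t : ℝ, 0 ≤ t →
      (1 + (t : ℂ) * (starRingEnd ℂ d * s)) ∈ Complex.slitPlane := by
    intro d hd t ht
    left
    rw [Complex.add_re, Complex.re_ofReal_mul, Complex.one_re]
    have := mul_nonneg ht (hre hd).le
    linarith
  have hval : ∀ t : ℝ, 0 ≤ t → expEval (Finsupp.single b 1 + Finsupp.single a 1) (t * -s) =
      ((t : ℂ) * -s - b)⁻¹ * ((t : ℂ) * -s - a)⁻¹ := by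
    intro t ht
    rw [expEval_add, expEval_single, expEval_single, zpow_neg_one, zpow_neg_one]
    · rw [Finsupp.single_apply, if_neg (fun h => hray hbs t ht (by rw [h, sub_self]))]
    · rw [Finsupp.single_apply, if_neg (fun h => hray has t ht (by rw [h, sub_self]))]
  have hderiv : ∀ t ∈ Set.Ici (0 : ℝ), HasDerivAt
      (fun t : ℝ => Complex.log (1 + (t : ℂ) * (starRingEnd ℂ a * s)) -
        Complex.log (1 + (t : ℂ) * (starRingEnd ℂ b * s)))
      ((a - b) * (expEval (Finsupp.single b 1 + Finsupp.single a 1) (t * -s) * -s)) t := by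
    intro t ht
    have hone : ∀ {d : ℂ}, ‖d‖ = 1 → 0 < dot d s → HasDerivAt
        (fun t : ℝ => Complex.log (1 + (t : ℂ) * (starRingEnd ℂ d * s)))
        (-s / ((t : ℂ) * -s - d)) t := by
      intro d hd hds
      have e1 : HasDerivAt (fun t : ℝ => 1 + (t : ℂ) * (starRingEnd ℂ d * s))
          (starRingEnd ℂ d * s) t := by
        simpa using ((Complex.ofRealCLM.hasDerivAt (x := t)).mul_const
          (starRingEnd ℂ d * s)).const_add 1
      have e2 := e1.clog_real (hslit hds t ht)
      convert e2 using 1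
      have h3 := hinv hd
      have h4 := Complex.slitPlane_ne_zero (hslit hds t ht)
      rw [div_eq_div_iff (hray hds t ht) h4]
      linear_combination s * h3
    refine ((hone ha has).sub (hone hb hbs)).congr_deriv ?_
    rw [hval t ht]
    have h3 := hray has t ht
    have h4 := hray hbs t ht
    have h5 : a - b = ((t : ℂ) * -s - b) - ((t : ℂ) * -s - a) := by ring
    rw [h5]
    generalize (t : ℂ) * -s - b = B at h4 ⊢
    generalize (t : ℂ) * -s - a = A at h3 ⊢
    field_simp
    ring
  have hlim : Tendsto (fun t : ℝ => Complex.log (1 + (t : ℂ) * (starRingEnd ℂ a * s)) -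
        Complex.log (1 + (t : ℂ) * (starRingEnd ℂ b * s))) atTop
        (𝓝 (Complex.log (starRingEnd ℂ a * s) - Complex.log (starRingEnd ℂ b * s))) := by
    have hone : ∀ {d : ℂ}, 0 < dot d s → Tendsto
        (fun t : ℝ => Complex.log (((t⁻¹ : ℝ) : ℂ) + starRingEnd ℂ d * s)) atTop
        (𝓝 (Complex.log (starRingEnd ℂ d * s))) := by
      intro d hd
      have e1 : Tendsto (fun t : ℝ => ((t⁻¹ : ℝ) : ℂ) + starRingEnd ℂ d * s) atTop
          (𝓝 (starRingEnd ℂ d * s)) := by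
        have := (Complex.continuous_ofReal.tendsto 0).comp tendsto_inv_atTop_zero
        simpa using this.add_const (starRingEnd ℂ d * s)
      exact e1.clog (Or.inl (hre hd))
    refine ((hone has).sub (hone hbs)).congr' ?_
    filter_upwards [eventually_gt_atTop 0] with t ht
    have hfac : ∀ {d : ℂ}, 0 < dot d s → Complex.log (1 + (t : ℂ) * (starRingEnd ℂ d * s)) =
        Real.log t + Complex.log (((t⁻¹ : ℝ) : ℂ) + starRingEnd ℂ d * s) := by
      intro d hd
      rw [← Complex.log_ofReal_mul ht]
      · congr 1
        push_cast
        have : (t : ℂ) ≠ 0 := by exact_mod_cast ht.ne'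
        field_simp
      · intro h
        have := congrArg Complex.re h
        rw [Complex.add_re, Complex.ofReal_re, Complex.zero_re] at this
        have h5 := hre hd
        have := inv_pos.2 ht
        linarith
    rw [hfac has, hfac hbs]
    ring
  have hn : ∀ d, (Finsupp.single b 1 + Finsupp.single a 1 : ℂ →₀ ℤ) d ≠ 0 → ‖d‖ = 1 := by
    intro d hd
    rw [Finsupp.add_apply, Finsupp.single_apply, Finsupp.single_apply] at hd
    split_ifs at hd with h1 h2 h2 <;> first | (rw [← h1]; exact hb) | (rw [← h2]; exact ha) | simp at hd
  have hpos : ∀ d, 0 < (Finsupp.single b 1 + Finsupp.single a 1 : ℂ →₀ ℤ) d → 0 < dot d s := by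
    intro d hd
    rw [Finsupp.add_apply, Finsupp.single_apply, Finsupp.single_apply] at hd
    split_ifs at hd with h1 h2 h2 <;> first | (rw [← h1]; exact hbs) | (rw [← h2]; exact has) | simp at hd
  have hdeg : (Finsupp.single b 1 + Finsupp.single a 1 : ℂ →₀ ℤ).degree = 2 := by
    rw [map_add, Finsupp.degree_single, Finsupp.degree_single]; norm_num
  have hint := integrableOn_expEval_ray hn hdeg (by simpa using hs)
    (expEval_ray_nonpos hpos (by rw [dot_self, hs]; norm_num))
  have := integral_Ioi_of_hasDerivAt_of_tendsto' hderiv ((hint.mul_const (-s)).const_mul (a - b)) hlim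
  rw [integral_const_mul] at this
  rw [rayInt, this]
  simp

theorem Rhombus.log_sub_log (R : Rhombus) {s : ℂ} (hr : 0 < dot R.right s)
    (hl : 0 < dot R.left s) :
    Complex.log (starRingEnd ℂ R.right * s) - Complex.log (starRingEnd ℂ R.left * s) =
      R.angle * Complex.I := by
  have hre : ∀ {d : ℂ}, 0 < dot d s → 0 < (starRingEnd ℂ d * s).re := by
    intro d hd
    simpa [dot] using hd
  have hr' := hre hr
  have hl' := hre hl
  have hr0 : starRingEnd ℂ R.right * s ≠ 0 := fun h => by rw [h] at hr'; simp at hr'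
  have hl0 : starRingEnd ℂ R.left * s ≠ 0 := fun h => by rw [h] at hl'; simp at hl'
  have ar := abs_lt.1 (Complex.abs_arg_lt_pi_div_two_iff.2 (Or.inl hr'))
  have al := abs_lt.1 (Complex.abs_arg_lt_pi_div_two_iff.2 (Or.inl hl'))
  have hs0 : ‖s‖ ≠ 0 := by
    intro h; rw [norm_eq_zero.1 h] at hr0; simp at hr0
  have harg : R.angle = Complex.arg (starRingEnd ℂ R.right * s) -
      Complex.arg (starRingEnd ℂ R.left * s) := by
    have hinv : Complex.arg (starRingEnd ℂ (starRingEnd ℂ R.left * s)) =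
        -Complex.arg (starRingEnd ℂ R.left * s) := by
      rw [Complex.arg_conj, if_neg]
      intro h; linarith [al.2, Real.pi_pos]
    rw [sub_eq_add_neg, ← hinv, ← Complex.arg_mul hr0 (by simpa using hl0)]
    · have : starRingEnd ℂ R.right * s * starRingEnd ℂ (starRingEnd ℂ R.left * s) =
          ((‖s‖ ^ 2 : ℝ) : ℂ) * (starRingEnd ℂ R.right * R.left) := by
        rw [map_mul, Complex.conj_conj, ← Complex.normSq_eq_norm_sq, ← Complex.mul_conj]
        ring
      rw [this, Complex.arg_real_mul _ (by positivity)]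
      rfl
    · rw [hinv]
      constructor <;> linarith [al.1, al.2, ar.1, ar.2]
  rw [harg]
  apply Complex.ext
  · rw [Complex.sub_re, Complex.log_re, Complex.log_re, norm_mul, norm_mul]
    simp [R.norm_left, R.norm_right]
  · rw [Complex.sub_im, Complex.log_im, Complex.log_im]
    simp

/-- The normalization of ∂̄ turns the local integral into the rhombus angle, so that the diagonal of
the product with the inverse is an angle sum. -/
theorem Rhombus.mul_rayInt (R : Rhombus) {s : ℂ} (hs : ‖s‖ = 1) (hr : 0 < dot R.right s)
    (hl : 0 < dot R.left s) :
    Complex.I * (R.left - R.right) *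
      rayInt (Finsupp.single R.right 1 + Finsupp.single R.left 1) (-s) = R.angle := by
  rw [mul_assoc, log_sub_log_ray R.norm_left R.norm_right hs hl hr, ← neg_sub, R.log_sub_log hr hl]
  linear_combination (-(R.angle : ℂ)) * Complex.I_mul_I

/-! ### Cancellation around a fan. -/

open MeasureTheory Filter Topology

/-- The sum of the ray integrals around a fan of rhombi. -/
theorem IsFan.sum_rayInt {F : Finset Rhombus} (hF : IsFan F) {m : ℂ →₀ ℤ} (hm0 : m.degree = 0)
    (hm : ∀ d, m d ≠ 0 → ‖d‖ = 1) {s : Rhombus → ℂ} (hs : ∀ R ∈ F, ‖s R‖ = 1)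
    (hpos : ∀ R ∈ F, ∀ d,
      0 < (m + (Finsupp.single R.right 1 + Finsupp.single R.left 1) : ℂ →₀ ℤ) d →
      0 < dot d (s R)) :
    ∑ R ∈ F, Complex.I * (R.left - R.right) *
      rayInt (m + (Finsupp.single R.right 1 + Finsupp.single R.left 1)) (-s R) =
        if m = 0 then 2 * (Real.pi : ℂ) else 0 := by
  have hsides : ∀ R : Rhombus, ∀ d : ℂ, 0 ≤ (Finsupp.single R.right 1 + Finsupp.single R.left 1 : ℂ →₀ ℤ) d := by
    intro R d
    rw [Finsupp.add_apply, Finsupp.single_apply, Finsupp.single_apply]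
    split_ifs <;> norm_num
  have hunit : ∀ R : Rhombus, ∀ d,
      (m + (Finsupp.single R.right 1 + Finsupp.single R.left 1) : ℂ →₀ ℤ) d ≠ 0 → ‖d‖ = 1 := by
    intro R d hd
    by_cases h : m d = 0
    · rw [Finsupp.add_apply, h, Finsupp.add_apply, Finsupp.single_apply, Finsupp.single_apply] at hd
      split_ifs at hd with h1 h2 h2
      · rw [← h1]; exact R.norm_right
      · rw [← h1]; exact R.norm_right
      · rw [← h2]; exact R.norm_left
      · simp at hd
    · exact hm d h
  have hdeg : ∀ R : Rhombus,
      (m + (Finsupp.single R.right 1 + Finsupp.single R.left 1)).degree = 2 := by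
    intro R
    rw [map_add, map_add, hm0, Finsupp.degree_single, Finsupp.degree_single]; norm_num
  split_ifs with h0
  · subst h0
    have : ∀ R ∈ F, Complex.I * (R.left - R.right) *
        rayInt (0 + (Finsupp.single R.right 1 + Finsupp.single R.left 1)) (-s R) = R.angle := by
      intro R hR
      rw [zero_add]
      refine R.mul_rayInt (hs R hR) (hpos R hR _ ?_) (hpos R hR _ ?_)
      · rw [zero_add, Finsupp.add_apply, Finsupp.single_eq_same, Finsupp.single_apply]
        split_ifs <;> norm_num
      · rw [zero_add, Finsupp.add_apply, Finsupp.single_eq_same, Finsupp.single_apply]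
        split_ifs <;> norm_num
    rw [Finset.sum_congr rfl this]
    have h1 := hF.sum_angle
    exact_mod_cast congrArg (fun x : ℝ => (x : ℂ)) h1
  -- A nonzero vector of degree 0 has a positive entry `p`. It lies in all the half planes at once,
  -- so every ray may be rotated to −p, and on this common ray the integrands already add up to
  -- zero.
  · obtain ⟨p, hp⟩ : ∃ p, 0 < m p := by
      by_contra! h
      apply h0
      ext d
      rw [degree_eq_sum] at hm0
      by_cases hd : d ∈ m.support
      · exact (Finset.sum_eq_zero_iff_of_nonpos fun i _ => h i).1 hm0 d hd
      · simpa using hd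
    have hp1 := hm p hp.ne'
    have hpR : ∀ R ∈ F, 0 < dot p (s R) := by
      intro R hR
      refine hpos R hR p ?_
      rw [Finsupp.add_apply]
      linarith [hsides R p]
    have hrot : ∀ R ∈ F, Complex.I * (R.left - R.right) *
        rayInt (m + (Finsupp.single R.right 1 + Finsupp.single R.left 1)) (-s R) =
        ∫ t in Set.Ioi (0 : ℝ), Complex.I * (R.left - R.right) *
          (expEval (m + (Finsupp.single R.right 1 + Finsupp.single R.left 1)) (t * -p) * -p) := by
      intro R hR
      rw [rayInt_rotate (hunit R) (hdeg R) (hs R hR) hp1 (hpos R hR) (hpR R hR).le, rayInt,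
        integral_const_mul]
    have hint : ∀ R ∈ F, Integrable (fun t : ℝ => Complex.I * (R.left - R.right) *
          (expEval (m + (Finsupp.single R.right 1 + Finsupp.single R.left 1)) (t * -p) * -p))
          (volume.restrict (Set.Ioi 0)) := by
      intro R hR
      exact ((integrableOn_expEval_ray (hunit R) (hdeg R) (by simpa using hp1)
        (expEval_ray_nonpos (hpos R hR) (hpR R hR).le)).mul_const (-p)).const_mul _
    rw [Finset.sum_congr rfl hrot, ← integral_finsetSum F hint]
    refine integral_eq_zero_of_ae ?_
    -- The ray meets the unit circle at `t = 1`, where factors may vanish and products of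
    -- exponentials need not split; this is a null set.
    have hne : ∀ᵐ t : ℝ ∂(volume.restrict (Set.Ioi 0)), t ≠ 1 :=
      ae_restrict_of_ae (Measure.ae_ne volume 1)
    filter_upwards [hne, ae_restrict_mem measurableSet_Ioi] with t ht1 ht0
    have hz : ∀ d : ℂ, ‖d‖ = 1 → (t : ℂ) * -p ≠ d := by
      rintro d hd rfl
      rw [norm_mul, norm_neg, hp1, mul_one, Complex.norm_real,
        Real.norm_of_nonneg (le_of_lt ht0)] at hd
      exact ht1 hd
    generalize (t : ℂ) * -p = z at hz
    have hmz : m z = 0 := by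
      by_contra h
      exact hz z (hm z h) rfl
    have hsingle : ∀ d : ℂ, ‖d‖ = 1 → (Finsupp.single d 1 : ℂ →₀ ℤ) z = 0 := fun d hd => by
      rw [Finsupp.single_apply, if_neg (Ne.symm (hz d hd))]
    have hterm : ∀ R ∈ F, Complex.I * (R.left - R.right) *
          (expEval (m + (Finsupp.single R.right 1 + Finsupp.single R.left 1)) z * -p) =
        Complex.I * expEval m z * -p * ((z - R.left)⁻¹ - (z - R.right)⁻¹) := by
      intro R _
      have h1 := hsingle _ R.norm_right
      have h2 := hsingle _ R.norm_left
      rw [expEval_add hmz (by rw [Finsupp.add_apply, h1, h2, add_zero]), expEval_add h1 h2,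
        expEval_single, expEval_single, zpow_neg_one, zpow_neg_one]
      have h3 := sub_ne_zero.2 (hz _ R.norm_right)
      have h4 := sub_ne_zero.2 (hz _ R.norm_left)
      rw [inv_sub_inv h4 h3]
      field_simp
      ring
    rw [Finset.sum_congr rfl hterm, ← Finset.mul_sum, Finset.sum_sub_distrib,
      hF.sum_left_eq_sum_right fun d => (z - d)⁻¹]
    simp

/-! ### The kernel: independence of the ray, decay, and local identities. -/

namespace RhombusGraph

variable {T : RhombusGraph}

theorem eq_of_white_black {R S : Rhombus} (hR : R ∈ T.rhombi) (hS : S ∈ T.rhombi)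
    (hw : R.white = S.white) (hb : R.black = S.black) : R = S := by
  refine T.no_overlap R hR S hS ⟨R.center, R.center_mem, ?_⟩
  have : R.center = S.center := by
    simp only [Rhombus.black, Rhombus.center] at *
    push_cast
    linear_combination (1 / 2 : ℂ) * hw + (1 / 2 : ℂ) * hb
  rw [this]
  exact S.center_mem

theorem dbar_eq {R : Rhombus} (hR : R ∈ T.rhombi) (b : T.Black) (w : T.White)
    (hb : R.black = b) (hw : R.white = w) : T.dbar b w = Complex.I * (R.left - R.right) := by
  have h : ∃ R ∈ T.rhombi, R.white = w ∧ R.black = b := ⟨R, hR, hw, hb⟩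
  have h2 : h.choose = R :=
    eq_of_white_black h.choose_spec.1 hR (h.choose_spec.2.1.trans hw.symm)
      (h.choose_spec.2.2.trans hb.symm)
  rw [dbar, dif_pos h, h2]

theorem exists_of_dbar_ne_zero {b : T.Black} {w : T.White} (h : T.dbar b w ≠ 0) :
    ∃ R ∈ T.rhombi, R.white = w ∧ R.black = b := by
  by_contra h2
  exact h (dif_neg h2)

/-- Level of a vertex: the arrows increase it by one. -/
noncomputable def level (T : RhombusGraph) (v : ℂ) : ℤ :=
  open Classical in if T.IsWhite v then 0 else if T.IsBlack v then 2 else 1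

theorem level_white {v : ℂ} (h : T.IsWhite v) : T.level v = 0 := if_pos h

theorem level_black {v : ℂ} (h : T.IsBlack v) : T.level v = 2 := by
  rw [level, if_neg, if_pos h]
  rintro ⟨R, hR, rfl⟩
  obtain ⟨S, hS, h⟩ := h
  exact T.white_ne_black hS hR h.symm

theorem level_face {v : ℂ} (h : T.IsFace v) : T.level v = 1 := by
  obtain ⟨S, hS, h⟩ := h
  rw [level, if_neg, if_neg]
  · rintro ⟨R, hR, rfl⟩
    rcases h with h | h
    · exact (T.black_ne_face hS hR).1 h.symm
    · exact (T.black_ne_face hS hR).2 h.symm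
  · rintro ⟨R, hR, rfl⟩
    rcases h with h | h
    · exact (T.white_ne_face hS hR).1 h.symm
    · exact (T.white_ne_face hS hR).2 h.symm

theorem Arrow.level_eq {u v : ℂ} (h : T.Arrow u v) : T.level v = T.level u + 1 := by
  obtain ⟨R, hR, ⟨rfl, rfl⟩ | ⟨rfl, rfl⟩ | ⟨rfl, rfl⟩ | ⟨rfl, rfl⟩⟩ := h
  · rw [level_face ⟨R, hR, Or.inl rfl⟩, level_white ⟨R, hR, rfl⟩]; rfl
  · rw [level_face ⟨R, hR, Or.inr rfl⟩, level_white ⟨R, hR, rfl⟩]; rfl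
  · rw [level_face ⟨R, hR, Or.inl rfl⟩, level_black ⟨R, hR, rfl⟩]; rfl
  · rw [level_face ⟨R, hR, Or.inr rfl⟩, level_black ⟨R, hR, rfl⟩]; rfl

theorem BoundedAngles.degree_exponents (hT : T.BoundedAngles) {u v : ℂ} (hu : T.IsVertex u)
    (hv : T.IsVertex v) : (T.exponents u v).degree = T.level v - T.level u := by
  have key : ∀ {u v : ℂ} (p : T.graph.Walk u v),
      (T.walkExponents p).degree = T.level v - T.level u := by
    intro u v p
    induction p with
    | nil => simp [walkExponents]
    | cons h p ih =>
      rw [walkExponents, map_add, ih, stepExponents]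
      rw [graph, SimpleGraph.fromRel_adj] at h
      split_ifs with h1
      · rw [Finsupp.degree_single, h1.level_eq]; ring
      · rw [Finsupp.degree_single, (h.2.resolve_left h1).level_eq]; ring
  rw [exponents, dif_pos (hT.reachable hu hv)]
  exact key _

/-- Exponents determine the displacement, which is the sum of the directions weighted by them. -/
theorem BoundedAngles.exponents_eq_zero_iff (hT : T.BoundedAngles) {u v : ℂ} (hu : T.IsVertex u)
    (hv : T.IsVertex v) : T.exponents u v = 0 ↔ u = v := by
  constructor
  · intro h
    have := hT.sum_exponents hu hv
    rw [h, Finsupp.sum_zero_index] at this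
    exact (sub_eq_zero.1 this.symm).symm
  · rintro rfl
    exact hT.exponents_self hu

/-- The kernel inverting `dbar`, as a function on the plane: an integral along a ray opposite to a
half plane that contains the poles of the discrete exponential. -/
noncomputable def kernel (T : RhombusGraph) (w b : ℂ) : ℂ :=
  1 / (2 * Real.pi) * rayInt (T.exponents w b) (-Classical.epsilon fun s : ℂ =>
    ‖s‖ = 1 ∧ ∀ d, 0 < T.exponents w b d → 0 < dot d s)

section Kernel

variable (hT : T.BoundedAngles)
include hT

theorem BoundedAngles.exists_half_plane {w b : ℂ} (hw : T.IsWhite w) (hb : T.IsBlack b) :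
    ∃ s : ℂ, ‖s‖ = 1 ∧ ∀ d, 0 < T.exponents w b d → 0 < dot d s := by
  obtain ⟨c, hc, -, h⟩ := hT.exists_exponents_direction
  obtain ⟨s, hs, hd⟩ := h w b hw.isVertex hb.isVertex (by
    rintro rfl
    have := level_white hw
    rw [level_black hb] at this
    norm_num at this)
  exact ⟨s, hs, fun d h => hc.trans_le ((hd d).1 h)⟩

theorem BoundedAngles.degree_white_black {w b : ℂ} (hw : T.IsWhite w) (hb : T.IsBlack b) :
    (T.exponents w b).degree = 2 := by
  rw [hT.degree_exponents hw.isVertex hb.isVertex, level_white hw, level_black hb]; rfl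

/-- Since the degree is 2 there is a pole `q`, and it has positive product with every admissible
`s`. All admissible rays therefore rotate to −q and give the same integral, whatever half plane the
definition selects; a last rotation leads to −p. -/
theorem BoundedAngles.kernel_eq {w b : ℂ} (hw : T.IsWhite w) (hb : T.IsBlack b) {s p : ℂ}
    (hs : ‖s‖ = 1) (hp : ‖p‖ = 1) (hns : ∀ d, 0 < T.exponents w b d → 0 < dot d s)
    (hps : 0 ≤ dot p s) :
    T.kernel w b = 1 / (2 * Real.pi) * rayInt (T.exponents w b) (-p) := by
  have hdeg := hT.degree_white_black hw hb
  have hunit : ∀ d, T.exponents w b d ≠ 0 → ‖d‖ = 1 := fun d =>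
    hT.norm_of_exponents_ne_zero hw.isVertex hb.isVertex
  obtain ⟨q, hq⟩ : ∃ q, 0 < T.exponents w b q := by
    by_contra! h
    rw [degree_eq_sum] at hdeg
    have := Finset.sum_nonpos (s := (T.exponents w b).support) fun d _ => h d
    linarith
  have hspec := Classical.epsilon_spec (hT.exists_half_plane hw hb)
  rw [kernel, rayInt_rotate hunit hdeg hspec.1 (hunit q hq.ne') hspec.2 (hspec.2 q hq).le,
    ← rayInt_rotate hunit hdeg hs (hunit q hq.ne') hns (hns q hq).le,
    rayInt_rotate hunit hdeg hs hp hns hps]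

/-- The displacement is a sum of `N` signed unit vectors, `N` being the total absolute exponent, so
|b − w| ≤ N, and the ray integral is O(1/N). -/
theorem BoundedAngles.exists_kernel_bound : ∃ C : ℝ, 0 < C ∧ ∀ w b : ℂ, T.IsWhite w →
    T.IsBlack b → 4 ≤ ‖b - w‖ → ‖T.kernel w b‖ ≤ C / ‖b - w‖ := by
  obtain ⟨c, hc, -, h⟩ := hT.exists_exponents_direction
  refine ⟨1 / (2 * Real.pi) * (4 / c), by positivity, fun w b hw hb hwb => ?_⟩
  obtain ⟨s, hs, hd⟩ := h w b hw.isVertex hb.isVertex (by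
    rintro rfl
    simp at hwb
    linarith)
  have hnonneg : 0 ≤ ∑ d ∈ (T.exponents w b).support, |T.exponents w b d| :=
    Finset.sum_nonneg fun _ _ => abs_nonneg _
  obtain ⟨N, hN⟩ := Int.eq_ofNat_of_zero_le hnonneg
  have hNb : ‖b - w‖ ≤ N := by
    rw [← hT.sum_exponents hw.isVertex hb.isVertex, Finsupp.sum]
    refine (norm_sum_le _ _).trans ?_
    have h1 : ((N : ℤ) : ℝ) = ∑ d ∈ (T.exponents w b).support, ((|T.exponents w b d| : ℤ) : ℝ) := by
      have : (N : ℤ) = ∑ d ∈ (T.exponents w b).support, |T.exponents w b d| := hN.symm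
      rw [this]; push_cast; rfl
    rw [show (N : ℝ) = ((N : ℤ) : ℝ) by simp, h1]
    refine Finset.sum_le_sum fun d hd => ?_
    rw [norm_mul, hT.norm_of_exponents_ne_zero hw.isVertex hb.isVertex
      (Finsupp.mem_support_iff.1 hd), mul_one, Complex.norm_intCast, Int.cast_abs]
  have hN4 : 4 ≤ N := by exact_mod_cast hwb.trans hNb
  have hle := norm_rayInt_le (fun d => hT.norm_of_exponents_ne_zero hw.isVertex hb.isVertex)
    (hT.degree_white_black hw hb) hs hc hd hN.symm hN4
  rw [hT.kernel_eq hw hb hs hs (fun d h => hc.trans_le ((hd d).1 h)) (by rw [dot_self]; positivity),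
    norm_mul]
  have hpi : ‖(1 / (2 * Real.pi) : ℂ)‖ = 1 / (2 * Real.pi) := by
    rw [show (1 / (2 * Real.pi) : ℂ) = ((1 / (2 * Real.pi) : ℝ) : ℂ) by push_cast; rfl,
      Complex.norm_real, Real.norm_of_nonneg (by positivity)]
  rw [hpi, mul_div_assoc]
  have h0 : 0 < ‖b - w‖ := by linarith
  gcongr
  refine hle.trans ?_
  rw [div_div, mul_comm]
  gcongr

/-- The local sums at a white vertex. -/
theorem BoundedAngles.sum_kernel_white {w w' : ℂ} (hw : T.IsWhite w) (hw' : T.IsWhite w') :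
    ∑ R ∈ hT.whiteFan w', Complex.I * (R.left - R.right) * T.kernel w R.black =
      if w = w' then 1 else 0 := by
  choose s hs using fun b : T.Black => hT.exists_half_plane hw b.2
  classical
  set s' : Rhombus → ℂ := fun R => if h : T.IsBlack R.black then s ⟨_, h⟩ else 0 with hs'
  have hexp : ∀ R ∈ hT.whiteFan w', T.exponents w R.black =
      T.exponents w w' + (Finsupp.single R.right 1 + Finsupp.single R.left 1) := by
    intro R hR
    obtain ⟨hR', rfl⟩ := hT.mem_whiteFan.1 hR
    rw [← hT.exponents_white_black hR', hT.exponents_add hw.isVertex hw'.isVertex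
      (IsBlack.isVertex ⟨R, hR', rfl⟩)]
  have hspec : ∀ R ∈ hT.whiteFan w', ‖s' R‖ = 1 ∧
      ∀ d, 0 < T.exponents w R.black d → 0 < dot d (s' R) := by
    intro R hR
    have hb : T.IsBlack R.black := ⟨R, (hT.mem_whiteFan.1 hR).1, rfl⟩
    have := hs ⟨_, hb⟩
    simpa only [hs', dif_pos hb] using this
  have h1 := (hT.isFan_white hw').sum_rayInt (m := T.exponents w w')
    (by rw [hT.degree_exponents hw.isVertex hw'.isVertex, level_white hw, level_white hw']; rfl)
    (fun d => hT.norm_of_exponents_ne_zero hw.isVertex hw'.isVertex)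
    (fun R hR => (hspec R hR).1) (fun R hR => by rw [← hexp R hR]; exact (hspec R hR).2)
  have h2 : ∀ R ∈ hT.whiteFan w', Complex.I * (R.left - R.right) * T.kernel w R.black =
      1 / (2 * Real.pi) * (Complex.I * (R.left - R.right) * rayInt (T.exponents w w' +
        (Finsupp.single R.right 1 + Finsupp.single R.left 1)) (-s' R)) := by
    intro R hR
    rw [hT.kernel_eq hw ⟨R, (hT.mem_whiteFan.1 hR).1, rfl⟩ (hspec R hR).1 (hspec R hR).1
      (hspec R hR).2 (by rw [dot_self]; positivity), hexp R hR]
    ring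
  rw [Finset.sum_congr rfl h2, ← Finset.mul_sum, h1]
  simp only [hT.exponents_eq_zero_iff hw.isVertex hw'.isVertex]
  split_ifs
  · have : (Real.pi : ℂ) ≠ 0 := by exact_mod_cast Real.pi_ne_zero
    field_simp
  · simp

/-- The local sums at a black vertex. -/
theorem BoundedAngles.sum_kernel_black {b b' : ℂ} (hb : T.IsBlack b) (hb' : T.IsBlack b') :
    ∑ R ∈ hT.blackFan b, Complex.I * (R.left - R.right) * T.kernel R.white b' =
      if b = b' then 1 else 0 := by
  choose s hs using fun w : T.White => hT.exists_half_plane w.2 hb'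
  classical
  set s' : Rhombus → ℂ := fun R => if h : T.IsWhite R.white then s ⟨_, h⟩ else 0 with hs'
  have hexp : ∀ R ∈ hT.blackFan b, T.exponents R.white b' =
      T.exponents b b' + (Finsupp.single R.right 1 + Finsupp.single R.left 1) := by
    intro R hR
    obtain ⟨hR', rfl⟩ := hT.mem_blackFan.1 hR
    rw [← hT.exponents_white_black hR', add_comm, hT.exponents_add (IsWhite.isVertex ⟨R, hR', rfl⟩)
      hb.isVertex hb'.isVertex]
  have hspec : ∀ R ∈ hT.blackFan b, ‖s' R‖ = 1 ∧
      ∀ d, 0 < T.exponents R.white b' d → 0 < dot d (s' R) := by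
    intro R hR
    have hw : T.IsWhite R.white := ⟨R, (hT.mem_blackFan.1 hR).1, rfl⟩
    have := hs ⟨_, hw⟩
    simpa only [hs', dif_pos hw] using this
  have h1 := (hT.isFan_black hb).sum_rayInt (m := T.exponents b b')
    (by rw [hT.degree_exponents hb.isVertex hb'.isVertex, level_black hb, level_black hb']; rfl)
    (fun d => hT.norm_of_exponents_ne_zero hb.isVertex hb'.isVertex)
    (fun R hR => (hspec R hR).1) (fun R hR => by rw [← hexp R hR]; exact (hspec R hR).2)
  have h2 : ∀ R ∈ hT.blackFan b, Complex.I * (R.left - R.right) * T.kernel R.white b' =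
      1 / (2 * Real.pi) * (Complex.I * (R.left - R.right) * rayInt (T.exponents b b' +
        (Finsupp.single R.right 1 + Finsupp.single R.left 1)) (-s' R)) := by
    intro R hR
    rw [hT.kernel_eq ⟨R, (hT.mem_blackFan.1 hR).1, rfl⟩ hb' (hspec R hR).1 (hspec R hR).1
      (hspec R hR).2 (by rw [dot_self]; positivity), hexp R hR]
    ring
  rw [Finset.sum_congr rfl h2, ← Finset.mul_sum, h1]
  simp only [hT.exponents_eq_zero_iff hb.isVertex hb'.isVertex]
  split_ifs
  · have : (Real.pi : ℂ) ≠ 0 := by exact_mod_cast Real.pi_ne_zero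
    field_simp
  · simp

end Kernel

end RhombusGraph

/-! ### The kernel is the inverse Kasteleyn matrix. -/

open Filter Topology

theorem finsum_eq_sum_of_param {ι α : Type*} (Z : Finset ι) (e : ∀ i ∈ Z, α) (f : α → ℂ)
    (g : ι → ℂ) (hinj : ∀ i hi j hj, e i hi = e j hj → i = j)
    (hsupp : ∀ a, f a ≠ 0 → ∃ i hi, e i hi = a) (hfg : ∀ i hi, f (e i hi) = g i) :
    ∑ᶠ a, f a = ∑ i ∈ Z, g i := by
  classical
  have h1 : Function.support f ⊆ (Z.attach.image fun i => e i.1 i.2 : Finset α) := by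
    intro a ha
    obtain ⟨i, hi, rfl⟩ := hsupp a ha
    simp only [Finset.coe_image, Set.mem_image, Finset.mem_coe, Finset.mem_attach, true_and]
    exact ⟨⟨i, hi⟩, rfl⟩
  rw [finsum_eq_sum_of_support_subset f h1, Finset.sum_image, ← Finset.sum_attach Z]
  · exact Finset.sum_congr rfl fun i _ => hfg i.1 i.2
  · exact fun i _ j _ h => Subtype.ext (hinj _ _ _ _ h)

namespace RhombusGraph

variable {T : RhombusGraph}

/-- The kernel as a matrix. -/
noncomputable def kernelMatrix (T : RhombusGraph) : Matrix T.White T.Black ℂ :=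
  fun w b => T.kernel w b

section Inverse

variable (hT : T.BoundedAngles)
include hT

theorem BoundedAngles.finsum_black (w : T.White) (f : T.Black → ℂ) (g : Rhombus → ℂ)
    (hsupp : ∀ b, f b ≠ 0 → T.dbar b w ≠ 0)
    (hfg : ∀ R ∈ hT.whiteFan w, ∀ b : T.Black, R.black = b → f b = g R) :
    ∑ᶠ b, f b = ∑ R ∈ hT.whiteFan w, g R := by
  refine finsum_eq_sum_of_param (hT.whiteFan w)
    (fun R hR => (⟨R.black, R, (hT.mem_whiteFan.1 hR).1, rfl⟩ : T.Black)) f g ?_ ?_ ?_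
  · intro R hR S hS h
    rw [hT.mem_whiteFan] at hR hS
    exact eq_of_white_black hR.1 hS.1 (hR.2.trans hS.2.symm) (Subtype.ext_iff.1 h)
  · intro b hb
    obtain ⟨R, hR, hw, hb⟩ := exists_of_dbar_ne_zero (hsupp b hb)
    exact ⟨R, hT.mem_whiteFan.2 ⟨hR, hw⟩, Subtype.ext hb⟩
  · exact fun R hR => hfg R hR _ rfl

theorem BoundedAngles.finsum_white (b : T.Black) (f : T.White → ℂ) (g : Rhombus → ℂ)
    (hsupp : ∀ w, f w ≠ 0 → T.dbar b w ≠ 0)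
    (hfg : ∀ R ∈ hT.blackFan b, ∀ w : T.White, R.white = w → f w = g R) :
    ∑ᶠ w, f w = ∑ R ∈ hT.blackFan b, g R := by
  refine finsum_eq_sum_of_param (hT.blackFan b)
    (fun R hR => (⟨R.white, R, (hT.mem_blackFan.1 hR).1, rfl⟩ : T.White)) f g ?_ ?_ ?_
  · intro R hR S hS h
    rw [hT.mem_blackFan] at hR hS
    exact eq_of_white_black hR.1 hS.1 (Subtype.ext_iff.1 h) (hR.2.trans hS.2.symm)
  · intro w hw
    obtain ⟨R, hR, hw, hb⟩ := exists_of_dbar_ne_zero (hsupp w hw)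
    exact ⟨R, hT.mem_blackFan.2 ⟨hR, hb⟩, Subtype.ext hw⟩
  · exact fun R hR => hfg R hR _ rfl

theorem BoundedAngles.tendsto_kernel {w : ℂ} (hw : T.IsWhite w) :
    Tendsto (fun b : T.Black => T.kernel w b)
      (comap (fun b : T.Black => (b : ℂ)) (cocompact ℂ)) (𝓝 0) := by
  obtain ⟨C, hC, h⟩ := hT.exists_kernel_bound
  have h1 : Tendsto (fun b : T.Black => ‖(b : ℂ) - w‖)
      (comap (fun b : T.Black => (b : ℂ)) (cocompact ℂ)) atTop := by
    have h2 : Tendsto (fun b : ℂ => ‖b - w‖) (cocompact ℂ) atTop := by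
      refine tendsto_atTop_mono (fun b => norm_sub_norm_le b w) ?_
      exact tendsto_atTop_add_const_right _ _ (tendsto_norm_cocompact_atTop)
    exact h2.comp tendsto_comap
  refine squeeze_zero_norm' ?_ (tendsto_const_nhds (x := C) |>.div_atTop h1)
  filter_upwards [h1.eventually_ge_atTop 4] with b hb
  exact h w b hw b.2 hb

theorem BoundedAngles.isInverse_kernel :
    T.IsInverseKasteleyn T.kernelMatrix := by
  classical
  refine ⟨fun b b' => ?_, fun w w' => ?_, fun w => hT.tendsto_kernel w.2⟩
  · change ∑ᶠ w : T.White, T.dbar b w * T.kernel w b' = _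
    rw [hT.finsum_white b _ (fun R => Complex.I * (R.left - R.right) * T.kernel R.white b'),
      hT.sum_kernel_black b.2 b'.2]
    · simp only [Subtype.ext_iff]
    · exact fun w h => left_ne_zero_of_mul h
    · intro R hR w hw
      rw [hT.mem_blackFan] at hR
      rw [dbar_eq hR.1 b w hR.2 hw, hw]
  · change ∑ᶠ b : T.Black, T.kernel w b * T.dbar b w' = _
    rw [hT.finsum_black w' _ (fun R => Complex.I * (R.left - R.right) * T.kernel w R.black),
      hT.sum_kernel_white w.2 w'.2]
    · simp only [Subtype.ext_iff]
    · exact fun w h => right_ne_zero_of_mul h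
    · intro R hR b hb
      rw [hT.mem_whiteFan] at hR
      rw [dbar_eq hR.1 b w' hb hR.2, hb, mul_comm]

/-- A bounded harmonic-type row that decays at infinity vanishes. -/
theorem BoundedAngles.eq_zero_of_decay (h : ℂ → ℂ)
    (hsum : ∀ w, T.IsWhite w →
      ∑ R ∈ hT.whiteFan w, h R.black * (Complex.I * (R.left - R.right)) = 0)
    (hdecay : ∀ ε > 0, ∃ r : ℝ, ∀ b, T.IsBlack b → r ≤ ‖b‖ → ‖h b‖ ≤ ε)
    {b₀ : ℂ} (hb₀ : T.IsBlack b₀) : h b₀ = 0 := by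
  classical
  obtain ⟨C, hC, hcard⟩ := hT.exists_card_annulus_le
  obtain ⟨C', hC', hker⟩ := hT.exists_kernel_bound
  -- Summation by parts for Σ h(b) ∂̄(b,w) K(w,b₀) over a disc of radius ρ. Grouping rhombi by black
  -- corners in the disc gives h(b₀); grouping by white corners gives 0. The two sums differ only by
  -- rhombi near the circle, which are O(ρ) in number and contribute O(ε/ρ) each.
  set term : Rhombus → ℂ := fun R =>
    h R.black * (Complex.I * (R.left - R.right)) * T.kernel R.white b₀ with hterm
  have hclose : ∀ R : Rhombus, ‖R.black - R.white‖ ≤ 2 := fun R => R.dist_white_le R.black_mem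
  have hbw : ∀ R : Rhombus, ‖R.black‖ ≤ ‖R.white‖ + 2 := fun R => by
    have := norm_sub_norm_le R.black R.white
    linarith [hclose R]
  have hwb : ∀ R : Rhombus, ‖R.white‖ ≤ ‖R.black‖ + 2 := fun R => by
    have := norm_sub_norm_le R.white R.black
    rw [norm_sub_rev] at this
    linarith [hclose R]
  have key : ∀ ε > 0, ‖h b₀‖ ≤ C * 2 * 2 * 2 * C' * ε := by
    intro ε hε
    obtain ⟨r₀, hr₀⟩ := hdecay ε hε
    -- Large enough that black corners near the circle have norm at least `r₀`, and that white
    -- corners there are at distance at least ρ/2 and at least 4 from `b₀`.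
    set ρ : ℝ := max (max 4 (r₀ + 2)) (2 * (‖b₀‖ + 4) + 4) with hρ
    have hρ1 : 4 ≤ ρ := (le_max_left _ _).trans (le_max_left _ _)
    have hρ2 : r₀ + 2 ≤ ρ := (le_max_right _ _).trans (le_max_left _ _)
    have hρ3 : 2 * (‖b₀‖ + 4) + 4 ≤ ρ := le_max_right _ _
    set Z := (hT.finite_white (ρ + 2)).toFinset with hZ
    have memZ : ∀ R, R ∈ Z ↔ R ∈ T.rhombi ∧ ‖R.white‖ ≤ ρ + 2 := by intro R; simp [hZ]
    set ZB := Z.filter fun R => ‖R.black‖ ≤ ρ with hZB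
    set ZW := Z.filter fun R => ‖R.white‖ ≤ ρ with hZW
    have memZB : ∀ R, R ∈ ZB ↔ R ∈ T.rhombi ∧ ‖R.black‖ ≤ ρ := by
      intro R
      rw [hZB, Finset.mem_filter, memZ]
      exact ⟨fun h => ⟨h.1.1, h.2⟩, fun h => ⟨⟨h.1, by linarith [hwb R, h.2]⟩, h.2⟩⟩
    have memZW : ∀ R, R ∈ ZW ↔ R ∈ T.rhombi ∧ ‖R.white‖ ≤ ρ := by
      intro R
      rw [hZW, Finset.mem_filter, memZ]
      exact ⟨fun h => ⟨h.1.1, h.2⟩, fun h => ⟨⟨h.1, by linarith [h.2]⟩, h.2⟩⟩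
    have sumB : ∑ R ∈ ZB, term R = h b₀ := by
      rw [← Finset.sum_fiberwise_of_maps_to (t := ZB.image Rhombus.black)
        (fun R hR => Finset.mem_image_of_mem _ hR)]
      have inner : ∀ b ∈ ZB.image Rhombus.black, ∑ R ∈ ZB with R.black = b, term R =
          if b = b₀ then h b else 0 := by
        intro b hb
        obtain ⟨S, hS, rfl⟩ := Finset.mem_image.1 hb
        rw [memZB] at hS
        have hfil : (ZB.filter fun R => R.black = S.black) = hT.blackFan S.black := by
          ext R
          rw [Finset.mem_filter, memZB, hT.mem_blackFan]
          exact ⟨fun h => ⟨h.1.1, h.2⟩, fun h => ⟨⟨h.1, by rw [h.2]; exact hS.2⟩, h.2⟩⟩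
        rw [hfil]
        have e : ∀ R ∈ hT.blackFan S.black, term R =
            h S.black * (Complex.I * (R.left - R.right) * T.kernel R.white b₀) := by
          intro R hR
          rw [hterm, ← (hT.mem_blackFan.1 hR).2]
          ring
        rw [Finset.sum_congr rfl e, ← Finset.mul_sum, hT.sum_kernel_black ⟨S, hS.1, rfl⟩ hb₀]
        split_ifs <;> simp
      rw [Finset.sum_congr rfl inner, Finset.sum_ite_eq' _ b₀ h, if_pos]
      obtain ⟨R, hR, rfl⟩ := hb₀
      refine Finset.mem_image_of_mem _ ((memZB R).2 ⟨hR, ?_⟩)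
      linarith [norm_nonneg R.black]
    have sumW : ∑ R ∈ ZW, term R = 0 := by
      rw [← Finset.sum_fiberwise_of_maps_to (t := ZW.image Rhombus.white)
        (fun R hR => Finset.mem_image_of_mem _ hR)]
      refine Finset.sum_eq_zero fun w hw => ?_
      obtain ⟨S, hS, rfl⟩ := Finset.mem_image.1 hw
      rw [memZW] at hS
      have hfil : (ZW.filter fun R => R.white = S.white) = hT.whiteFan S.white := by
        ext R
        rw [Finset.mem_filter, memZW, hT.mem_whiteFan]
        exact ⟨fun h => ⟨h.1.1, h.2⟩, fun h => ⟨⟨h.1, by rw [h.2]; exact hS.2⟩, h.2⟩⟩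
      rw [hfil]
      have e : ∀ R ∈ hT.whiteFan S.white, term R =
          h R.black * (Complex.I * (R.left - R.right)) * T.kernel S.white b₀ := by
        intro R hR
        rw [hterm, ← (hT.mem_whiteFan.1 hR).2]
      rw [Finset.sum_congr rfl e, ← Finset.sum_mul, hsum _ ⟨S, hS.1, rfl⟩, zero_mul]
    have hterm_le : ∀ R ∈ T.rhombi, ρ - 2 ≤ ‖R.white‖ → ρ - 2 ≤ ‖R.black‖ →
        ‖term R‖ ≤ ε * 2 * (C' * 2 / ρ) := by
      intro R hR h1 h2
      rw [hterm, norm_mul, norm_mul]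
      have e1 : ‖h R.black‖ ≤ ε := hr₀ _ ⟨R, hR, rfl⟩ (by linarith)
      have e2 : ‖Complex.I * (R.left - R.right)‖ ≤ 2 := by
        rw [norm_mul, Complex.norm_I, one_mul]
        refine (_root_.norm_sub_le _ _).trans ?_
        rw [R.norm_left, R.norm_right]; norm_num
      have e3 : ρ / 2 ≤ ‖b₀ - R.white‖ := by
        have := norm_sub_norm_le R.white b₀
        rw [norm_sub_rev] at this
        linarith [norm_nonneg b₀]
      have e4 : ‖T.kernel R.white b₀‖ ≤ C' * 2 / ρ := by
        refine (hker _ _ ⟨R, hR, rfl⟩ hb₀ (by linarith [norm_nonneg b₀])).trans ?_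
        calc C' / ‖b₀ - R.white‖ ≤ C' / (ρ / 2) := by gcongr
          _ = C' * 2 / ρ := by field_simp
      gcongr
    have hdiff : h b₀ = ∑ R ∈ ZB \ ZW, term R - ∑ R ∈ ZW \ ZB, term R := by
      rw [← sumB, ← sub_zero (∑ R ∈ ZB, term R), ← sumW, Finset.sum_sdiff_sub_sum_sdiff]
    have hbound : ∀ Y : Finset Rhombus, (∀ R ∈ Y, R ∈ T.rhombi ∧ ρ - 2 ≤ ‖R.white‖ ∧
        ‖R.white‖ ≤ ρ + 2 ∧ ρ - 2 ≤ ‖R.black‖) →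
        ‖∑ R ∈ Y, term R‖ ≤ C * ρ * (ε * 2 * (C' * 2 / ρ)) := by
      intro Y hY
      refine (norm_sum_le_of_le Y (f := term) (n := fun _ => ε * 2 * (C' * 2 / ρ))
        fun R hR => hterm_le R (hY R hR).1 (hY R hR).2.1 (hY R hR).2.2.2).trans ?_
      rw [Finset.sum_const, nsmul_eq_mul]
      have := hcard ρ hρ1 Y fun R hR => ⟨(hY R hR).1, (hY R hR).2.1, (hY R hR).2.2.1⟩
      have : 0 ≤ ε * 2 * (C' * 2 / ρ) := by positivity
      gcongr
    have b1 := hbound (ZB \ ZW) fun R hR => by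
      rw [Finset.mem_sdiff, memZB, memZW, not_and, not_le] at hR
      have := hR.2 hR.1.1
      exact ⟨hR.1.1, by linarith, by linarith [hwb R, hR.1.2], by linarith [hwb R]⟩
    have b2 := hbound (ZW \ ZB) fun R hR => by
      rw [Finset.mem_sdiff, memZB, memZW, not_and, not_le] at hR
      have := hR.2 hR.1.1
      exact ⟨hR.1.1, by linarith [hbw R], by linarith [hR.1.2], by linarith⟩
    have hρ0 : ρ ≠ 0 := by linarith
    calc ‖h b₀‖ ≤ ‖∑ R ∈ ZB \ ZW, term R‖ + ‖∑ R ∈ ZW \ ZB, term R‖ := by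
          rw [hdiff]; exact _root_.norm_sub_le _ _
      _ ≤ C * ρ * (ε * 2 * (C' * 2 / ρ)) + C * ρ * (ε * 2 * (C' * 2 / ρ)) := add_le_add b1 b2
      _ = C * 2 * 2 * 2 * C' * ε := by field_simp; ring
  have hlim : Tendsto (fun ε : ℝ => C * 2 * 2 * 2 * C' * ε) (𝓝[>] 0) (𝓝 0) := by
    have : Tendsto (fun ε : ℝ => C * 2 * 2 * 2 * C' * ε) (𝓝 0) (𝓝 (C * 2 * 2 * 2 * C' * 0)) :=
      tendsto_id.const_mul _
    rw [mul_zero] at this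
    exact this.mono_left nhdsWithin_le_nhds
  have := ge_of_tendsto hlim (eventually_nhdsWithin_of_forall fun ε hε => key ε hε)
  simpa using this

/-- A row of the difference of two inverses is annihilated by ∂̄ on the right and decays at
infinity, so it vanishes. -/
theorem BoundedAngles.isInverse_unique {K : Matrix T.White T.Black ℂ}
    (hK : T.IsInverseKasteleyn K) : K = T.kernelMatrix := by
  classical
  have hK' := hT.isInverse_kernel
  ext w b
  set h : ℂ → ℂ := fun v => if hv : T.IsBlack v then K w ⟨v, hv⟩ - T.kernel w v else 0 with hh
  have hval : ∀ b : T.Black, h b = K w b - T.kernelMatrix w b := fun b => by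
    rw [hh]; simp only [dif_pos b.2]; rfl
  have hfin : ∀ w' : T.White, ∀ K : Matrix T.White T.Black ℂ, infMul K T.dbar w w' =
      ∑ R ∈ hT.whiteFan w', (if hb : T.IsBlack R.black then K w ⟨R.black, hb⟩ else 0) *
        (Complex.I * (R.left - R.right)) := by
    intro w' K
    rw [infMul]
    refine hT.finsum_black w' _ _ (fun b hb => right_ne_zero_of_mul hb) fun R hR b hb => ?_
    rw [hT.mem_whiteFan] at hR
    rw [dbar_eq hR.1 b w' hb hR.2, dif_pos ⟨R, hR.1, rfl⟩]
    congr 2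
    exact Subtype.ext hb.symm
  have h0 : h b = 0 := by
    refine hT.eq_zero_of_decay h ?_ ?_ b.2
    · intro w' hw'
      have e := (hK.mul_dbar w ⟨w', hw'⟩).trans (hK'.mul_dbar w ⟨w', hw'⟩).symm
      rw [hfin, hfin, ← sub_eq_zero, ← Finset.sum_sub_distrib] at e
      rw [← e]
      refine Finset.sum_congr rfl fun R hR => ?_
      have hb : T.IsBlack R.black := ⟨R, (hT.mem_whiteFan.1 hR).1, rfl⟩
      rw [dif_pos hb, dif_pos hb, ← sub_mul, ← hval ⟨R.black, hb⟩]
    · intro ε hε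
      have ht := (hK.tendsto_zero w).sub (hK'.tendsto_zero w)
      rw [sub_zero] at ht
      have ev := ht.eventually (Metric.closedBall_mem_nhds (0 : ℂ) hε)
      rw [Filter.eventually_comap] at ev
      rw [← Metric.cobounded_eq_cocompact] at ev
      obtain ⟨r, -, hr⟩ := (Filter.hasBasis_cobounded_norm (E := ℂ)).eventually_iff.1 ev
      refine ⟨r, fun b hb hrb => ?_⟩
      have := hr hrb ⟨b, hb⟩ rfl
      rw [dist_zero_right] at this
      rwa [← hval ⟨b, hb⟩] at this
  rw [hval] at h0
  exact sub_eq_zero.1 h0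

theorem BoundedAngles.invDbar_eq : T.invDbar = T.kernelMatrix :=
  hT.isInverse_unique (Classical.epsilon_spec ⟨_, hT.isInverse_kernel⟩)

end Inverse

end RhombusGraph

/-! ### One ray for all pairs of zipper edges. -/

theorem dot_exp (a b : ℝ) :
    dot (Complex.exp (a * Complex.I)) (Complex.exp (b * Complex.I)) = Real.cos (a - b) := by
  rw [dot, Complex.exp_ofReal_mul_I_re, Complex.exp_ofReal_mul_I_im, Complex.exp_ofReal_mul_I_re,
    Complex.exp_ofReal_mul_I_im, Real.cos_sub]

theorem exp_add_pi_mul_I (a : ℝ) :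
    Complex.exp (((a + Real.pi : ℝ) : ℂ) * Complex.I) = -Complex.exp (a * Complex.I) := by
  push_cast
  rw [add_mul, Complex.exp_add, Complex.exp_pi_mul_I]; ring

theorem exp_add_half_pi_mul_I (a : ℝ) :
    Complex.exp (((a + Real.pi / 2 : ℝ) : ℂ) * Complex.I) = Complex.I * Complex.exp (a * Complex.I) := by
  push_cast
  rw [add_mul, Complex.exp_add, Complex.exp_pi_div_two_mul_I]; ring

theorem exp_mem_cone {a b c : ℝ} (hab : a < b) (hba : b < a + Real.pi) (hac : a ≤ c) (hcb : c ≤ b) :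
    Complex.exp (c * Complex.I) ∈
      cone (Complex.exp (a * Complex.I)) (Complex.exp (b * Complex.I)) := by
  have h0 : 0 < Real.sin (b - a) := Real.sin_pos_of_pos_of_lt_pi (by linarith) (by linarith)
  have h1 : 0 ≤ Real.sin (b - c) := Real.sin_nonneg_of_nonneg_of_le_pi (by linarith) (by linarith)
  have h2 : 0 ≤ Real.sin (c - a) := Real.sin_nonneg_of_nonneg_of_le_pi (by linarith) (by linarith)
  refine ⟨Real.sin (b - c) / Real.sin (b - a), Real.sin (c - a) / Real.sin (b - a),
    div_nonneg h1 h0.le, div_nonneg h2 h0.le, ?_⟩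
  apply Complex.ext
  · rw [Complex.add_re, Complex.re_ofReal_mul, Complex.re_ofReal_mul, Complex.exp_ofReal_mul_I_re,
      Complex.exp_ofReal_mul_I_re, Complex.exp_ofReal_mul_I_re]
    field_simp
    rw [Real.sin_sub, Real.sin_sub, Real.sin_sub]
    ring
  · rw [Complex.add_im, Complex.im_ofReal_mul, Complex.im_ofReal_mul, Complex.exp_ofReal_mul_I_im,
      Complex.exp_ofReal_mul_I_im, Complex.exp_ofReal_mul_I_im]
    field_simp
    rw [Real.sin_sub, Real.sin_sub, Real.sin_sub]
    ring

theorem dot_nonneg_of_mem_cone {a b c s : ℂ} (h : c ∈ cone a b) (ha : 0 ≤ dot a s)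
    (hb : 0 ≤ dot b s) : 0 ≤ dot c s := by
  obtain ⟨x, y, hx, hy, rfl⟩ := h
  rw [dot_add_left, dot_real_mul_left, dot_real_mul_left]
  positivity

/-- Exponents of a path all of whose steps make an acute angle with `ν`. -/
def Toward (ν : ℂ) (n : ℂ →₀ ℤ) : Prop :=
  ∀ d, (0 < n d → 0 < dot d ν) ∧ (n d < 0 → dot d ν < 0)

namespace Toward

variable {ν : ℂ} {n m : ℂ →₀ ℤ}

theorem zero : Toward ν 0 := fun d => by simp

theorem nonneg (h : Toward ν n) {d : ℂ} (hd : 0 < dot d ν) : 0 ≤ n d := by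
  by_contra! h1
  linarith [(h d).2 h1]

theorem nonpos (h : Toward ν n) {d : ℂ} (hd : dot d ν < 0) : n d ≤ 0 := by
  by_contra! h1
  linarith [(h d).1 h1]

theorem add (hn : Toward ν n) (hm : Toward ν m) : Toward ν (n + m) := by
  intro d
  rw [Finsupp.add_apply]
  constructor
  · intro h
    by_contra! h1
    rcases le_or_gt (n d) 0 with h2 | h2
    · have := (hm d).1 (by linarith); linarith
    · have := (hn d).1 h2; linarith
  · intro h
    by_contra! h1
    rcases le_or_gt 0 (n d) with h2 | h2
    · have := (hm d).2 (by linarith); linarith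
    · have := (hn d).2 h2; linarith

theorem neg (hn : Toward ν n) : Toward (-ν) (-n) := by
  intro d
  have e : dot d (-ν) = -dot d ν := by simp [dot]; ring
  rw [Finsupp.neg_apply, e]
  exact ⟨fun h => by linarith [(hn d).2 (by linarith)], fun h => by linarith [(hn d).1 (by linarith)]⟩

theorem single {d : ℂ} (h : 0 < dot d ν) : Toward ν (Finsupp.single d 1) := by
  intro e
  rw [Finsupp.single_apply]
  split_ifs with h1
  · subst h1; exact ⟨fun _ => h, fun h => by norm_num at h⟩
  · simp

theorem single_neg {d : ℂ} (h : dot d ν < 0) : Toward ν (Finsupp.single d (-1)) := by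
  intro e
  rw [Finsupp.single_apply]
  split_ifs with h1
  · subst h1; exact ⟨fun h => by norm_num at h, fun _ => h⟩
  · simp

end Toward

/-- `E'` arises from the nonnegative exponents `E` by dropping those at `-f`, which are
compensated by the exponents `G` of an adjacent step; the remaining directions lie in the half
plane of `ν`, or span together with `f` a cone containing `τ`. -/
structure Trimmed (f ν τ : ℂ) (E E' G : ℂ →₀ ℤ) : Prop where
  nonneg : ∀ d, 0 ≤ E' d
  apply_neg : E' (-f) = 0
  eq_of_ne : ∀ d, d ≠ -f → E d = E' d
  compensated : E (-f) + G (-f) ≤ 0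
  dir : ∀ d, 0 < E' d → 0 < dot d ν ∨ τ ∈ cone f d

theorem Trimmed.zero {f ν τ : ℂ} {G : ℂ →₀ ℤ} (hG : Toward ν G) (hf : 0 < dot f ν) :
    Trimmed f ν τ 0 0 G where
  nonneg _ := le_rfl
  apply_neg := rfl
  eq_of_ne _ _ := rfl
  compensated := by
    have := hG.nonpos (d := -f) (by rw [dot_neg_left]; linarith)
    simpa using this
  dir d h := by simp at h

theorem exp_ne_exp {a b : ℝ} (h : a < b) (h' : b < a + 2 * Real.pi) :
    Complex.exp (a * Complex.I) ≠ Complex.exp (b * Complex.I) := by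
  intro he
  rw [exp_eq_exp_iff_mod] at he
  obtain ⟨k, hk⟩ := he
  have hp := Real.pi_pos
  have h1 : (0 : ℝ) < -k := by
    by_contra! h2
    nlinarith
  have h2 : (-k : ℝ) < 1 := by
    by_contra! h2
    nlinarith
  have h3 : (0 : ℤ) < -k := by exact_mod_cast h1
  have h4 : -k < (1 : ℤ) := by exact_mod_cast h2
  omega

/-- Trimming the two sides of a rhombus, along a forward path. -/
theorem exists_trimmed_forward {θ φ φ' α β : ℝ} {r l : ℂ} (hr : r = Complex.exp (α * Complex.I))
    (hl : l = Complex.exp (β * Complex.I)) (hα : θ - Real.pi / 2 < α) (hαβ : α < β)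
    (hβ : β ≤ φ + Real.pi) (hφ : φ ≤ φ') (hφ' : φ' < θ + Real.pi / 2)
    (hφ'' : θ - Real.pi / 2 < φ') {G : ℂ →₀ ℤ}
    (hG : Toward (Complex.exp (θ * Complex.I)) G) (hG' : G (-Complex.exp (φ * Complex.I)) ≤ -1) :
    ∃ E' : ℂ →₀ ℤ, (E' = Finsupp.single r 1 + Finsupp.single l 1 ∨ E' = Finsupp.single r 1) ∧
      Trimmed (Complex.exp (φ' * Complex.I)) (Complex.exp (θ * Complex.I))
        (Complex.I * Complex.exp (θ * Complex.I)) (Finsupp.single r 1 + Finsupp.single l 1) E' G := by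
  have hp := Real.pi_pos
  -- A direction before θ + π/2 lies in the half plane of e^{iθ}. A later one spans with φ' an angle
  -- less than π, and this angle contains θ + π/2.
  have hdir : ∀ ε : ℝ, θ - Real.pi / 2 < ε → ε < φ' + Real.pi →
      (0 < dot (Complex.exp (ε * Complex.I)) (Complex.exp (θ * Complex.I)) ∨
        Complex.I * Complex.exp (θ * Complex.I) ∈ cone (Complex.exp (φ' * Complex.I))
          (Complex.exp (ε * Complex.I))) ∧
      Complex.exp (ε * Complex.I) ≠ -Complex.exp (φ' * Complex.I) := by
    intro ε h1 h2
    constructor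
    · rcases lt_or_ge ε (θ + Real.pi / 2) with h | h
      · left
        rw [dot_exp]
        exact Real.cos_pos_of_mem_Ioo ⟨by linarith, by linarith⟩
      · right
        rw [← exp_add_half_pi_mul_I]
        exact exp_mem_cone (by linarith) h2 hφ'.le h
    · rw [← exp_add_pi_mul_I]
      exact exp_ne_exp h2 (by linarith)
  have hr' := hdir α hα (by linarith)
  rw [← hr] at hr'
  have hcos : dot (-Complex.exp (φ' * Complex.I)) (Complex.exp (θ * Complex.I)) < 0 := by
    rw [dot_neg_left, dot_exp]
    have := Real.cos_pos_of_mem_Ioo (x := φ' - θ) ⟨by linarith, by linarith⟩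
    linarith
  have hGf := hG.nonpos hcos
  rcases lt_or_ge β (φ' + Real.pi) with h | h
  · have hl' := hdir β (by linarith) h
    rw [← hl] at hl'
    refine ⟨_, Or.inl rfl, ?_, ?_, fun _ _ => rfl, ?_, ?_⟩
    · intro d
      rw [Finsupp.add_apply, Finsupp.single_apply, Finsupp.single_apply]
      split_ifs <;> norm_num
    · rw [Finsupp.add_apply, Finsupp.single_apply, Finsupp.single_apply, if_neg hr'.2, if_neg hl'.2]
      rfl
    · rw [Finsupp.add_apply, Finsupp.single_apply, Finsupp.single_apply, if_neg hr'.2, if_neg hl'.2]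
      linarith
    · intro d hd
      rw [Finsupp.add_apply, Finsupp.single_apply, Finsupp.single_apply] at hd
      split_ifs at hd with h1 h2 h2
      · rw [← h1]; exact hr'.1
      · rw [← h1]; exact hr'.1
      · rw [← h2]; exact hl'.1
      · norm_num at hd
  -- Only in the extreme case is the left side opposite to `f`. It is then dropped, because the next
  -- step of the path carries exponent at most −1 in that direction.
  · have hφφ : φ = φ' := by linarith
    have hle : l = -Complex.exp (φ' * Complex.I) := by
      rw [hl, ← exp_add_pi_mul_I]
      congr 3
      linarith
    refine ⟨_, Or.inr rfl, ?_, ?_, ?_, ?_, ?_⟩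
    · intro d
      rw [Finsupp.single_apply]
      split_ifs <;> norm_num
    · rw [Finsupp.single_apply, if_neg hr'.2]
    · intro d hd
      rw [Finsupp.add_apply, Finsupp.single_apply (a := l), if_neg (by rw [hle]; exact hd.symm), add_zero]
    · rw [Finsupp.add_apply, Finsupp.single_apply, Finsupp.single_apply, if_neg hr'.2, if_pos hle,
        ← hφφ]
      linarith
    · intro d hd
      rw [Finsupp.single_apply] at hd
      split_ifs at hd with h1
      · rw [← h1]; exact hr'.1
      · norm_num at hd

/-- Trimming the two sides of a rhombus, along a backward path. -/
theorem exists_trimmed_backward {θ φ φ' α β : ℝ} {r l : ℂ} (hr : r = Complex.exp (α * Complex.I))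
    (hl : l = Complex.exp (β * Complex.I)) (hα : φ ≤ α) (hαβ : α < β)
    (hβ : β < θ + 3 * Real.pi / 2) (hφ : φ' ≤ φ) (hφ' : φ' < θ + Real.pi / 2)
    (hφ'' : θ - Real.pi / 2 < φ') {G : ℂ →₀ ℤ}
    (hG : Toward (-Complex.exp (θ * Complex.I)) G) (hG' : G (Complex.exp (φ * Complex.I)) ≤ -1) :
    ∃ E' : ℂ →₀ ℤ, (E' = Finsupp.single r 1 + Finsupp.single l 1 ∨ E' = Finsupp.single l 1) ∧
      Trimmed (-Complex.exp (φ' * Complex.I)) (-Complex.exp (θ * Complex.I))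
        (Complex.I * Complex.exp (θ * Complex.I)) (Finsupp.single r 1 + Finsupp.single l 1) E' G := by
  have hp := Real.pi_pos
  have hneg : ∀ a b : ℂ, dot a (-b) = -dot a b := fun a b => by simp [dot]; ring
  have hswap : ∀ {a b z : ℂ}, z ∈ cone a b → z ∈ cone b a := by
    rintro a b _ ⟨x, y, hx, hy, rfl⟩
    exact ⟨y, x, hy, hx, add_comm _ _⟩
  have hdir : ∀ ε : ℝ, φ' < ε → ε < θ + 3 * Real.pi / 2 →
      (0 < dot (Complex.exp (ε * Complex.I)) (-Complex.exp (θ * Complex.I)) ∨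
        Complex.I * Complex.exp (θ * Complex.I) ∈ cone (-Complex.exp (φ' * Complex.I))
          (Complex.exp (ε * Complex.I))) ∧
      Complex.exp (ε * Complex.I) ≠ Complex.exp (φ' * Complex.I) := by
    intro ε h1 h2
    constructor
    · rcases lt_or_ge (θ + Real.pi / 2) ε with h | h
      · left
        rw [hneg, dot_exp, ← Real.cos_sub_pi]
        exact Real.cos_pos_of_mem_Ioo ⟨by linarith, by linarith⟩
      · right
        rw [← exp_add_half_pi_mul_I, ← exp_add_pi_mul_I]
        exact hswap (exp_mem_cone (by linarith) (by linarith) h (by linarith))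
    · exact (exp_ne_exp h1 (by linarith)).symm
  have hl' := hdir β (by linarith) hβ
  rw [← hl] at hl'
  have hcos : dot (Complex.exp (φ' * Complex.I)) (-Complex.exp (θ * Complex.I)) < 0 := by
    rw [hneg, dot_exp]
    have := Real.cos_pos_of_mem_Ioo (x := φ' - θ) ⟨by linarith, by linarith⟩
    linarith
  have hGf := hG.nonpos hcos
  rcases lt_or_ge φ' α with h | h
  · have hr' := hdir α h (by linarith)
    rw [← hr] at hr'
    refine ⟨_, Or.inl rfl, ?_, ?_, fun _ _ => rfl, ?_, ?_⟩
    · intro d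
      rw [Finsupp.add_apply, Finsupp.single_apply, Finsupp.single_apply]
      split_ifs <;> norm_num
    · rw [neg_neg, Finsupp.add_apply, Finsupp.single_apply, Finsupp.single_apply, if_neg hr'.2,
        if_neg hl'.2]
      rfl
    · rw [neg_neg, Finsupp.add_apply, Finsupp.single_apply, Finsupp.single_apply, if_neg hr'.2,
        if_neg hl'.2]
      linarith
    · intro d hd
      rw [Finsupp.add_apply, Finsupp.single_apply, Finsupp.single_apply] at hd
      split_ifs at hd with h1 h2 h2
      · rw [← h1]; exact hr'.1
      · rw [← h1]; exact hr'.1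
      · rw [← h2]; exact hl'.1
      · norm_num at hd
  · have hφφ : φ = φ' := by linarith
    have hre : r = Complex.exp (φ' * Complex.I) := by
      rw [hr]
      congr 3
      linarith
    refine ⟨_, Or.inr rfl, ?_, ?_, ?_, ?_, ?_⟩
    · intro d
      rw [Finsupp.single_apply]
      split_ifs <;> norm_num
    · rw [neg_neg, Finsupp.single_apply, if_neg hl'.2]
    · intro d hd
      rw [neg_neg] at hd
      rw [Finsupp.add_apply, Finsupp.single_apply (a := r), if_neg (by rw [hre]; exact hd.symm), zero_add]
    · rw [neg_neg, Finsupp.add_apply, Finsupp.single_apply, Finsupp.single_apply, if_neg hl'.2,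
        if_pos hre, ← hφφ]
      linarith
    · intro d hd
      rw [Finsupp.single_apply] at hd
      split_ifs at hd with h1
      · rw [← h1]; exact hl'.1
      · norm_num at hd

namespace RhombusGraph

variable {T : RhombusGraph}

/-- A half plane for the poles of `g_{w → b}` with `τ` in its closure, from the path
`w → a → a₁ → c₁ → c → b`. -/
theorem BoundedAngles.exists_half_plane_of_trimmed (hT : T.BoundedAngles) {f ν τ : ℂ}
    {w x a a₁ c₁ c y b : ℂ} (hw : T.IsVertex w) (hx : T.IsVertex x) (ha : T.IsVertex a)
    (ha₁ : T.IsVertex a₁) (hc₁ : T.IsVertex c₁) (hc : T.IsVertex c) (hy : T.IsVertex y)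
    (hb : T.IsVertex b) (hν : ‖ν‖ = 1) (hτ : dot τ ν = 0) (hf : 0 < dot f ν)
    (hs : Trimmed f ν τ (T.exponents w a) (T.exponents x a) (T.exponents a a₁))
    (he : Trimmed f ν τ (T.exponents c b) (T.exponents c y) (T.exponents c₁ c))
    (t1 : Toward ν (T.exponents a a₁)) (t2 : Toward ν (T.exponents a₁ c₁))
    (t3 : Toward ν (T.exponents c₁ c))
    (hfe : T.exponents a a₁ f = 1 ∨ T.exponents a a₁ (-f) = -1 ∨
      T.exponents c₁ c f = 1 ∨ T.exponents c₁ c (-f) = -1) :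
    ∃ s : ℂ, ‖s‖ = 1 ∧ (∀ d, 0 < T.exponents w b d → 0 < dot d s) ∧ 0 ≤ dot τ s := by
  have hn : ∀ {p q : ℂ}, T.IsVertex p → T.IsVertex q → ∀ d, T.exponents p q d =
      T.exponents p a d + T.exponents a a₁ d + T.exponents a₁ c₁ d + T.exponents c₁ c d +
        T.exponents c q d := by
    intro p q hp hq d
    rw [← hT.exponents_add hp hc hq, ← hT.exponents_add hp hc₁ hc, ← hT.exponents_add hp ha₁ hc₁,
      ← hT.exponents_add hp ha ha₁]
    simp only [Finsupp.add_apply]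
  have hfneg : dot (-f) ν < 0 := by rw [dot_neg_left]; linarith
  have p1 := t1.nonneg hf
  have p2 := t2.nonneg hf
  have p3 := t3.nonneg hf
  have m1 := t1.nonpos hfneg
  have m2 := t2.nonpos hfneg
  have m3 := t3.nonpos hfneg
  -- Trimming loses no pole: exponents agree away from −f, and at −f the compensating steps leave
  -- none.
  have h1 : ∀ d, 0 < T.exponents w b d → 0 < T.exponents x y d := by
    intro d hd
    by_cases hdf : d = -f
    · subst hdf
      rw [hn hw hb] at hd
      linarith [hs.compensated, he.compensated]
    · rw [hn hw hb, hs.eq_of_ne d hdf, he.eq_of_ne d hdf] at hd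
      rwa [hn hx hy]
  -- One of the two end steps of the path has direction `f`, and nothing cancels it. Hence `f` has
  -- positive product with any vector that separates the signed directions between `x` and `y`.
  have h2 : 0 < T.exponents x y f ∨ T.exponents x y (-f) < 0 := by
    rw [hn hx hy, hn hx hy, hs.apply_neg, he.apply_neg]
    have q1 := hs.nonneg f
    have q2 := he.nonneg f
    rcases hfe with h | h | h | h
    · left; linarith
    · right; linarith
    · left; linarith
    · right; linarith
  -- If all poles lie in the half plane of `ν`, take `s = ν`, which is orthogonal to `τ`. Otherwise
  -- some pole `d` has `τ` in the cone of `f` and `d`, and any half plane for the pair `x`, `y`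
  -- contains both, hence has `τ` in its closure.
  by_cases hall : ∀ d, 0 < T.exponents x y d → 0 < dot d ν
  · exact ⟨ν, hν, fun d hd => hall d (h1 d hd), hτ.ge⟩
  · push Not at hall
    obtain ⟨d, hd, hdν⟩ := hall
    have hcone : τ ∈ cone f d := by
      have hor : 0 < T.exponents x a d ∨ 0 < T.exponents c y d := by
        by_contra! h
        rw [hn hx hy] at hd
        have hT3 := (t1.add (t2.add t3) d).1 (by simp only [Finsupp.add_apply]; linarith)
        linarith
      rcases hor with h | h
      · exact (hs.dir d h).resolve_left (not_lt.2 hdν)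
      · exact (he.dir d h).resolve_left (not_lt.2 hdν)
    have hxy : x ≠ y := by
      rintro rfl
      rw [hT.exponents_self hx] at hd
      simp at hd
    obtain ⟨c, hc, -, hdir⟩ := hT.exists_exponents_direction
    obtain ⟨s, hs1, hsd⟩ := hdir x y hx hy hxy
    refine ⟨s, hs1, fun d hd => hc.trans_le ((hsd d).1 (h1 d hd)), ?_⟩
    refine dot_nonneg_of_mem_cone hcone ?_ (hc.le.trans ((hsd d).1 hd))
    rcases h2 with h | h
    · exact hc.le.trans ((hsd f).1 h)
    · have := (hsd (-f)).2 h
      rw [dot_neg_left] at this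
      linarith

/-- The half plane for a single rhombus. -/
theorem exists_half_plane_of_rhombus {R : Rhombus} {θ α β : ℝ}
    (hr : R.right = Complex.exp (α * Complex.I)) (hl : R.left = Complex.exp (β * Complex.I))
    (hα : θ - Real.pi / 2 < α) (hαβ : α < β) (hβ : β < θ + 3 * Real.pi / 2) :
    ∃ s : ℂ, ‖s‖ = 1 ∧ 0 < dot R.right s ∧ 0 < dot R.left s ∧
      0 ≤ dot (Complex.I * Complex.exp (θ * Complex.I)) s := by
  have hp := Real.pi_pos
  have hang := R.angle_eq_of_exp hr hl hαβ (by linarith)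
  have hlt := R.angle_lt_pi
  have hsol : ∀ σ : ℝ, θ ≤ σ → σ ≤ θ + Real.pi → |α - σ| < Real.pi / 2 → |β - σ| < Real.pi / 2 →
      ∃ s : ℂ, ‖s‖ = 1 ∧ 0 < dot R.right s ∧ 0 < dot R.left s ∧
      0 ≤ dot (Complex.I * Complex.exp (θ * Complex.I)) s := by
    intro σ h1 h2 h3 h4
    refine ⟨Complex.exp (σ * Complex.I), Complex.norm_exp_ofReal_mul_I σ, ?_, ?_, ?_⟩
    · rw [hr, dot_exp]; exact Real.cos_pos_of_mem_Ioo (abs_lt.1 h3)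
    · rw [hl, dot_exp]; exact Real.cos_pos_of_mem_Ioo (abs_lt.1 h4)
    · rw [← exp_add_half_pi_mul_I, dot_exp]
      exact Real.cos_nonneg_of_mem_Icc ⟨by linarith, by linarith⟩
  -- The bisector of the rhombus angle, clamped to the interval from θ to θ + π.
  rcases lt_or_ge ((α + β) / 2) θ with h | h
  · exact hsol θ le_rfl (by linarith) (abs_lt.2 ⟨by linarith, by linarith⟩)
      (abs_lt.2 ⟨by linarith, by linarith⟩)
  · rcases lt_or_ge (θ + Real.pi) ((α + β) / 2) with h' | h'
    · exact hsol (θ + Real.pi) (by linarith) le_rfl (abs_lt.2 ⟨by linarith, by linarith⟩)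
        (abs_lt.2 ⟨by linarith, by linarith⟩)
    · exact hsol _ h h' (abs_lt.2 ⟨by linarith, by linarith⟩) (abs_lt.2 ⟨by linarith, by linarith⟩)

end RhombusGraph

namespace RhombusGraph

variable {T : RhombusGraph}

theorem _root_.Rhombus.isCorner_white (R : Rhombus) : R.IsCorner R.white := Or.inl rfl

theorem _root_.Rhombus.isCorner_faceR (R : Rhombus) : R.IsCorner R.faceR := Or.inr (Or.inl rfl)

theorem _root_.Rhombus.isCorner_faceL (R : Rhombus) : R.IsCorner R.faceL :=
  Or.inr (Or.inr (Or.inl rfl))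

theorem _root_.Rhombus.isCorner_black (R : Rhombus) : R.IsCorner R.black :=
  Or.inr (Or.inr (Or.inr rfl))

section Sides

variable (hT : T.BoundedAngles) {R : Rhombus} (hR : R ∈ T.rhombi)
include hT hR

theorem BoundedAngles.exponents_white_faceR :
    T.exponents R.white R.faceR = Finsupp.single R.right 1 := by
  rw [hT.exponents_arrow ⟨R, hR, Or.inl ⟨rfl, rfl⟩⟩ ⟨R, hR, R.isCorner_white⟩
    ⟨R, hR, R.isCorner_faceR⟩]
  simp [Rhombus.faceR]

theorem BoundedAngles.exponents_white_faceL :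
    T.exponents R.white R.faceL = Finsupp.single R.left 1 := by
  rw [hT.exponents_arrow ⟨R, hR, Or.inr (Or.inl ⟨rfl, rfl⟩)⟩ ⟨R, hR, R.isCorner_white⟩
    ⟨R, hR, R.isCorner_faceL⟩]
  simp [Rhombus.faceL]

theorem BoundedAngles.exponents_faceR_black :
    T.exponents R.faceR R.black = Finsupp.single R.left 1 := by
  rw [hT.exponents_arrow ⟨R, hR, Or.inr (Or.inr (Or.inl ⟨rfl, rfl⟩))⟩ ⟨R, hR, R.isCorner_faceR⟩
    ⟨R, hR, R.isCorner_black⟩]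
  simp [Rhombus.faceR, Rhombus.black]

theorem BoundedAngles.exponents_faceL_black :
    T.exponents R.faceL R.black = Finsupp.single R.right 1 := by
  rw [hT.exponents_arrow ⟨R, hR, Or.inr (Or.inr (Or.inr ⟨rfl, rfl⟩))⟩ ⟨R, hR, R.isCorner_faceL⟩
    ⟨R, hR, R.isCorner_black⟩]
  simp [Rhombus.faceL, Rhombus.black]

end Sides

theorem Arrow.isVertex {u v : ℂ} (h : T.Arrow u v) : T.IsVertex u ∧ T.IsVertex v := by
  obtain ⟨R, hR, ⟨rfl, rfl⟩ | ⟨rfl, rfl⟩ | ⟨rfl, rfl⟩ | ⟨rfl, rfl⟩⟩ := h <;>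
    exact ⟨⟨R, hR, by simp [Rhombus.IsCorner]⟩, ⟨R, hR, by simp [Rhombus.IsCorner]⟩⟩

theorem arrow_or_of_adj {u v : ℂ} (h : T.graph.Adj u v) : T.Arrow u v ∨ T.Arrow v u := by
  rw [graph, SimpleGraph.fromRel_adj] at h
  exact h.2

theorem isVertex_of_adj {u v : ℂ} (h : T.graph.Adj u v) : T.IsVertex u ∧ T.IsVertex v := by
  rcases arrow_or_of_adj h with h | h
  · exact h.isVertex
  · exact h.isVertex.symm

theorem level_nonneg (v : ℂ) : 0 ≤ T.level v := by
  rw [level]; split_ifs <;> norm_num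

theorem level_le (v : ℂ) : T.level v ≤ 2 := by
  rw [level]; split_ifs <;> norm_num

theorem arrow_of_white {u v : ℂ} (hu : T.IsWhite u) (h : T.graph.Adj u v) : T.Arrow u v := by
  refine (arrow_or_of_adj h).resolve_right fun h1 => ?_
  have := h1.level_eq
  rw [level_white hu] at this
  linarith [T.level_nonneg v]

theorem arrow_to_black {u v : ℂ} (hv : T.IsBlack v) (h : T.graph.Adj u v) : T.Arrow u v := by
  refine (arrow_or_of_adj h).resolve_right fun h1 => ?_
  have := h1.level_eq
  rw [level_black hv] at this
  linarith [T.level_le u]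

namespace StraightLinePath

variable {F F' : ℂ} {θ₀ : ℝ} (p : T.StraightLinePath F F' θ₀)

/-- The unit vector of a step. -/
noncomputable def dir (m : ℕ) : ℂ := Complex.exp (p.φ m * Complex.I)

variable {p}

theorem isVertex_of_lt {m : ℕ} (hm : m < 2 * p.P) : T.IsVertex (p.v m) ∧ T.IsVertex (p.v (m + 1)) :=
  isVertex_of_adj (p.adj m hm)

theorem isVertex (hF : T.IsVertex F) {m : ℕ} (hm : m ≤ 2 * p.P) : T.IsVertex (p.v m) := by
  rcases hm.lt_or_eq with h | h
  · exact (isVertex_of_lt h).1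
  · rcases Nat.eq_zero_or_pos p.P with h0 | h0
    · rw [h, h0, mul_zero, p.start_eq]; exact hF
    · have := (isVertex_of_lt (p := p) (m := m - 1) (by omega)).2
      rwa [show m - 1 + 1 = m by omega] at this

theorem dot_dir {m : ℕ} (hm : m < 2 * p.P) :
    0 < dot (p.dir m) (Complex.exp (θ₀ * Complex.I)) := by
  rw [dir, dot_exp]
  have := p.angle_mem m hm
  exact Real.cos_pos_of_mem_Ioo ⟨by linarith [this.1], by linarith [this.2]⟩

theorem exponents_of_arrow (hT : T.BoundedAngles) {m : ℕ} (hm : m < 2 * p.P)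
    (h : T.Arrow (p.v m) (p.v (m + 1))) :
    T.exponents (p.v m) (p.v (m + 1)) = Finsupp.single (p.dir m) 1 := by
  rw [hT.exponents_arrow h h.isVertex.1 h.isVertex.2, p.step m hm, dir]

theorem exponents_of_arrow_symm (hT : T.BoundedAngles) {m : ℕ} (hm : m < 2 * p.P)
    (h : T.Arrow (p.v (m + 1)) (p.v m)) :
    T.exponents (p.v m) (p.v (m + 1)) = Finsupp.single (-p.dir m) (-1) := by
  rw [hT.exponents_symm h.isVertex.1 h.isVertex.2, hT.exponents_arrow h h.isVertex.1 h.isVertex.2,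
    ← neg_sub, p.step m hm, dir, Finsupp.single_neg]

theorem exponents_step (hT : T.BoundedAngles) {m : ℕ} (hm : m < 2 * p.P) :
    T.exponents (p.v m) (p.v (m + 1)) = Finsupp.single (p.dir m) 1 ∨
    T.exponents (p.v m) (p.v (m + 1)) = Finsupp.single (-p.dir m) (-1) := by
  rcases arrow_or_of_adj (p.adj m hm) with h | h
  · exact Or.inl (exponents_of_arrow hT hm h)
  · exact Or.inr (exponents_of_arrow_symm hT hm h)

theorem toward_step (hT : T.BoundedAngles) {m : ℕ} (hm : m < 2 * p.P) :
    Toward (Complex.exp (θ₀ * Complex.I)) (T.exponents (p.v m) (p.v (m + 1))) := by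
  rcases exponents_step hT hm with h | h <;> rw [h]
  · exact Toward.single (dot_dir hm)
  · refine Toward.single_neg ?_
    rw [dot_neg_left]
    linarith [dot_dir (p := p) hm]

theorem toward (hT : T.BoundedAngles) (hF : T.IsVertex F) {m k : ℕ} (hmk : m ≤ k)
    (hk : k ≤ 2 * p.P) :
    Toward (Complex.exp (θ₀ * Complex.I)) (T.exponents (p.v m) (p.v k)) := by
  induction k, hmk using Nat.le_induction with
  | base => rw [hT.exponents_self (isVertex hF hk)]; exact Toward.zero
  | succ k hmk ih =>
    rw [← hT.exponents_add (isVertex (p := p) (m := m) hF (by omega))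
      (isVertex (p := p) (m := k) hF (by omega)) (isVertex hF hk)]
    exact (ih (by omega)).add (toward_step hT (by omega))

theorem toward_backward (hT : T.BoundedAngles) (hF : T.IsVertex F) {m k : ℕ} (hmk : m ≤ k)
    (hk : k ≤ 2 * p.P) :
    Toward (-Complex.exp (θ₀ * Complex.I)) (T.exponents (p.v k) (p.v m)) := by
  rw [hT.exponents_symm (isVertex hF (hmk.trans hk)) (isVertex hF hk)]
  exact (toward hT hF hmk hk).neg

theorem dot_I_mul (z : ℂ) : dot (Complex.I * z) z = 0 := by
  simp [dot]; ring

/-- The poles of the discrete exponential between zipper edges lie in a half plane whose closure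
contains the normal of the zipper. -/
theorem exists_half_plane (hT : T.BoundedAngles) (hF : T.IsVertex F) {R S : Rhombus}
    (hR : R ∈ p.zipper) (hS : S ∈ p.zipper) :
    ∃ s : ℂ, ‖s‖ = 1 ∧ (∀ d, 0 < T.exponents R.white S.black d → 0 < dot d s) ∧
      0 ≤ dot (Complex.I * Complex.exp (θ₀ * Complex.I)) s := by
  obtain ⟨hRT, j, hj, α, β, hαβ, hr, hl, hRc⟩ := hR
  obtain ⟨hST, k, hk, α', β', hαβ', hr', hl', hSc⟩ := hS
  have hp := Real.pi_pos
  have hang := fun m (hm : m < 2 * p.P) => p.angle_mem m hm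
  have bR := R.isCorner_black
  have hwv : T.IsVertex R.white := ⟨R, hRT, R.isCorner_white⟩
  have hbv : T.IsVertex S.black := ⟨S, hST, S.isCorner_black⟩
  have hvx := fun m (hm : m ≤ 2 * p.P) => isVertex (p := p) hF hm
  have hu : ‖Complex.exp (θ₀ * Complex.I)‖ = 1 := Complex.norm_exp_ofReal_mul_I θ₀
  have dneg : ∀ a b : ℂ, dot a (-b) = -dot a b := fun a b => by simp [dot]; ring
  have hblack : R.black = p.v (2 * j + 1) →
      T.exponents R.white (p.v (2 * j + 1)) = Finsupp.single R.right 1 + Finsupp.single R.left 1 :=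
    fun h => by rw [← h, hT.exponents_white_black hRT]
  have hwhite : S.white = p.v (2 * k + 1) →
      T.exponents (p.v (2 * k + 1)) S.black = Finsupp.single S.right 1 + Finsupp.single S.left 1 :=
    fun h => by rw [← h, hT.exponents_white_black hST]
  have a0 := hang (2 * j) (by omega)
  have a1 := hang (2 * j + 1) (by omega)
  have c0 := hang (2 * k) (by omega)
  have c1 := hang (2 * k + 1) (by omega)
  -- For j < k the path from `R` to `S` runs forward, for j > k backward, and for j = k only one
  -- rhombus is involved. As `f` serves both ends, it is the more extreme of the two steps next to
  -- the end vertices: the larger angle going forward, the smaller one going backward.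
  rcases lt_trichotomy j k with hjk | hjk | hjk
  · have hf : 0 < dot (Complex.exp ((max (p.φ (2 * j + 1)) (p.φ (2 * k)) : ℝ) * Complex.I))
        (Complex.exp (θ₀ * Complex.I)) := by
      rcases max_choice (p.φ (2 * j + 1)) (p.φ (2 * k)) with h | h <;> rw [h]
      · exact dot_dir (p := p) (m := 2 * j + 1) (by omega)
      · exact dot_dir (p := p) (m := 2 * k) (by omega)
    have hmaxlt : max (p.φ (2 * j + 1)) (p.φ (2 * k)) < θ₀ + Real.pi / 2 := max_lt a1.2 c0.2
    have hltmax : θ₀ - Real.pi / 2 < max (p.φ (2 * j + 1)) (p.φ (2 * k)) := lt_max_of_lt_left a1.1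
    have t1 := toward_step (p := p) hT (m := 2 * j + 1) (by omega)
    have t2 := toward (p := p) hT hF (m := 2 * j + 1 + 1) (k := 2 * k) (by omega) (by omega)
    have t3 := toward_step (p := p) hT (m := 2 * k) (by omega)
    obtain ⟨x, hx, hs⟩ : ∃ x, T.IsVertex x ∧ Trimmed
        (Complex.exp ((max (p.φ (2 * j + 1)) (p.φ (2 * k)) : ℝ) * Complex.I))
        (Complex.exp (θ₀ * Complex.I)) (Complex.I * Complex.exp (θ₀ * Complex.I))
        (T.exponents R.white (p.v (2 * j + 1))) (T.exponents x (p.v (2 * j + 1)))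
        (T.exponents (p.v (2 * j + 1)) (p.v (2 * j + 1 + 1))) := by
      rcases hRc with ⟨h, -, -⟩ | ⟨h, h1, h2⟩
      · refine ⟨R.white, hwv, ?_⟩
        rw [h, hT.exponents_self (hvx _ (by omega))]
        exact Trimmed.zero t1 hf
      · have harr : T.Arrow (p.v (2 * j + 1 + 1)) (p.v (2 * j + 1)) :=
          arrow_to_black ⟨R, hRT, h⟩ (p.adj (2 * j + 1) (by omega)).symm
        rw [hblack h]
        obtain ⟨E', hE', ht⟩ := exists_trimmed_forward hr hl (by linarith [a0.1]) hαβ h2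
          (le_max_left (p.φ (2 * j + 1)) (p.φ (2 * k))) hmaxlt hltmax t1 (by
            rw [exponents_of_arrow_symm hT (by omega) harr, dir, Finsupp.single_eq_same])
        rcases hE' with rfl | rfl
        · exact ⟨R.white, hwv, by rw [hblack h]; exact ht⟩
        -- Dropping the left side amounts to starting at the left face corner instead of the white
        -- corner, so the trimmed exponents still belong to a pair of vertices.
        · exact ⟨R.faceL, ⟨R, hRT, R.isCorner_faceL⟩, by
            rw [← h, hT.exponents_faceL_black hRT, h]; exact ht⟩
    obtain ⟨y, hy, he⟩ : ∃ y, T.IsVertex y ∧ Trimmed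
        (Complex.exp ((max (p.φ (2 * j + 1)) (p.φ (2 * k)) : ℝ) * Complex.I))
        (Complex.exp (θ₀ * Complex.I)) (Complex.I * Complex.exp (θ₀ * Complex.I))
        (T.exponents (p.v (2 * k + 1)) S.black) (T.exponents (p.v (2 * k + 1)) y)
        (T.exponents (p.v (2 * k)) (p.v (2 * k + 1))) := by
      rcases hSc with ⟨h, h1, h2⟩ | ⟨h, -, -⟩
      · have harr : T.Arrow (p.v (2 * k + 1)) (p.v (2 * k)) :=
          arrow_of_white ⟨S, hST, h⟩ (p.adj (2 * k) (by omega)).symm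
        rw [hwhite h]
        obtain ⟨E', hE', ht⟩ := exists_trimmed_forward hr' hl' (by linarith [c1.1]) hαβ' h2
          (le_max_right (p.φ (2 * j + 1)) (p.φ (2 * k))) hmaxlt hltmax t3 (by
            rw [exponents_of_arrow_symm hT (by omega) harr, dir, Finsupp.single_eq_same])
        rcases hE' with rfl | rfl
        · exact ⟨S.black, hbv, by rw [hwhite h]; exact ht⟩
        · exact ⟨S.faceR, ⟨S, hST, S.isCorner_faceR⟩, by
            rw [← h, hT.exponents_white_faceR hST, h]; exact ht⟩
      · refine ⟨S.black, hbv, ?_⟩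
        rw [h, hT.exponents_self (hvx _ (by omega))]
        exact Trimmed.zero t3 hf
    refine hT.exists_half_plane_of_trimmed hwv hx (hvx _ (by omega)) (hvx _ (by omega))
      (hvx _ (by omega)) (hvx _ (by omega)) hy hbv hu (dot_I_mul _) hf hs he t1 t2 t3 ?_
    rcases max_choice (p.φ (2 * j + 1)) (p.φ (2 * k)) with h | h <;> rw [h]
    · rcases exponents_step (p := p) hT (m := 2 * j + 1) (by omega) with h1 | h1
      · left; rw [h1, dir, Finsupp.single_eq_same]
      · right; left; rw [h1, dir, Finsupp.single_eq_same]
    · rcases exponents_step (p := p) hT (m := 2 * k) (by omega) with h1 | h1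
      · right; right; left; rw [h1, dir, Finsupp.single_eq_same]
      · right; right; right; rw [h1, dir, Finsupp.single_eq_same]
  · subst hjk
    rcases hRc with ⟨h, h1, h2⟩ | ⟨h, h1, h2⟩ <;> rcases hSc with ⟨g, g1, g2⟩ | ⟨g, g1, g2⟩
    · rw [h, hwhite g]
      obtain ⟨s, hs, e1, e2, e3⟩ := exists_half_plane_of_rhombus (θ := θ₀) hr' hl'
        (by linarith [c1.1]) hαβ' (by linarith [c0.2])
      refine ⟨s, hs, fun d hd => ?_, e3⟩
      rw [Finsupp.add_apply, Finsupp.single_apply, Finsupp.single_apply] at hd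
      split_ifs at hd with i1 i2 i2 <;> first | (rw [← i1]; exact e1) | (rw [← i2]; exact e2) | norm_num at hd
    · exact absurd (h.trans g.symm) (T.white_ne_black hST hRT)
    · exact absurd (g.trans h.symm) (T.white_ne_black hRT hST)
    · rw [g, hblack h]
      obtain ⟨s, hs, e1, e2, e3⟩ := exists_half_plane_of_rhombus (θ := θ₀) hr hl
        (by linarith [a0.1]) hαβ (by linarith [a1.2])
      refine ⟨s, hs, fun d hd => ?_, e3⟩
      rw [Finsupp.add_apply, Finsupp.single_apply, Finsupp.single_apply] at hd
      split_ifs at hd with i1 i2 i2 <;> first | (rw [← i1]; exact e1) | (rw [← i2]; exact e2) | norm_num at hd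
  · have hf : 0 < dot (-Complex.exp ((min (p.φ (2 * j)) (p.φ (2 * k + 1)) : ℝ) * Complex.I))
        (-Complex.exp (θ₀ * Complex.I)) := by
      rw [dneg, dot_neg_left, neg_neg]
      rcases min_choice (p.φ (2 * j)) (p.φ (2 * k + 1)) with h | h <;> rw [h]
      · exact dot_dir (p := p) (m := 2 * j) (by omega)
      · exact dot_dir (p := p) (m := 2 * k + 1) (by omega)
    have hltmin : θ₀ - Real.pi / 2 < min (p.φ (2 * j)) (p.φ (2 * k + 1)) := lt_min a0.1 c1.1
    have hminlt : min (p.φ (2 * j)) (p.φ (2 * k + 1)) < θ₀ + Real.pi / 2 := min_lt_of_left_lt a0.2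
    have t1 := toward_backward (p := p) hT hF (m := 2 * j) (k := 2 * j + 1) (by omega) (by omega)
    have t2 := toward_backward (p := p) hT hF (m := 2 * k + 1 + 1) (k := 2 * j) (by omega) (by omega)
    have t3 := toward_backward (p := p) hT hF (m := 2 * k + 1) (k := 2 * k + 1 + 1) (by omega)
      (by omega)
    have s1 := hT.exponents_symm (hvx (2 * j) (by omega)) (hvx (2 * j + 1) (by omega))
    have s3 := hT.exponents_symm (hvx (2 * k + 1) (by omega)) (hvx (2 * k + 1 + 1) (by omega))
    obtain ⟨x, hx, hs⟩ : ∃ x, T.IsVertex x ∧ Trimmed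
        (-Complex.exp ((min (p.φ (2 * j)) (p.φ (2 * k + 1)) : ℝ) * Complex.I))
        (-Complex.exp (θ₀ * Complex.I)) (Complex.I * Complex.exp (θ₀ * Complex.I))
        (T.exponents R.white (p.v (2 * j + 1))) (T.exponents x (p.v (2 * j + 1)))
        (T.exponents (p.v (2 * j + 1)) (p.v (2 * j))) := by
      rcases hRc with ⟨h, -, -⟩ | ⟨h, h1, h2⟩
      · refine ⟨R.white, hwv, ?_⟩
        rw [h, hT.exponents_self (hvx _ (by omega))]
        exact Trimmed.zero t1 hf
      · have harr : T.Arrow (p.v (2 * j)) (p.v (2 * j + 1)) :=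
          arrow_to_black ⟨R, hRT, h⟩ (p.adj (2 * j) (by omega))
        rw [hblack h]
        obtain ⟨E', hE', ht⟩ := exists_trimmed_backward hr hl h1 hαβ (by linarith [a1.2])
          (min_le_left (p.φ (2 * j)) (p.φ (2 * k + 1))) hminlt hltmin t1 (by
            rw [s1, exponents_of_arrow hT (by omega) harr, dir, Finsupp.neg_apply,
              Finsupp.single_eq_same])
        rcases hE' with rfl | rfl
        · exact ⟨R.white, hwv, by rw [hblack h]; exact ht⟩
        · exact ⟨R.faceR, ⟨R, hRT, R.isCorner_faceR⟩, by
            rw [← h, hT.exponents_faceR_black hRT, h]; exact ht⟩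
    obtain ⟨y, hy, he⟩ : ∃ y, T.IsVertex y ∧ Trimmed
        (-Complex.exp ((min (p.φ (2 * j)) (p.φ (2 * k + 1)) : ℝ) * Complex.I))
        (-Complex.exp (θ₀ * Complex.I)) (Complex.I * Complex.exp (θ₀ * Complex.I))
        (T.exponents (p.v (2 * k + 1)) S.black) (T.exponents (p.v (2 * k + 1)) y)
        (T.exponents (p.v (2 * k + 1 + 1)) (p.v (2 * k + 1))) := by
      rcases hSc with ⟨h, h1, h2⟩ | ⟨h, -, -⟩
      · have harr : T.Arrow (p.v (2 * k + 1)) (p.v (2 * k + 1 + 1)) :=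
          arrow_of_white ⟨S, hST, h⟩ (p.adj (2 * k + 1) (by omega))
        rw [hwhite h]
        obtain ⟨E', hE', ht⟩ := exists_trimmed_backward hr' hl' h1 hαβ' (by linarith [c0.2])
          (min_le_right (p.φ (2 * j)) (p.φ (2 * k + 1))) hminlt hltmin t3 (by
            rw [s3, exponents_of_arrow hT (by omega) harr, dir, Finsupp.neg_apply,
              Finsupp.single_eq_same])
        rcases hE' with rfl | rfl
        · exact ⟨S.black, hbv, by rw [hwhite h]; exact ht⟩
        · exact ⟨S.faceL, ⟨S, hST, S.isCorner_faceL⟩, by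
            rw [← h, hT.exponents_white_faceL hST, h]; exact ht⟩
      · refine ⟨S.black, hbv, ?_⟩
        rw [h, hT.exponents_self (hvx _ (by omega))]
        exact Trimmed.zero t3 hf
    refine hT.exists_half_plane_of_trimmed hwv hx (hvx _ (by omega)) (hvx _ (by omega))
      (hvx _ (by omega)) (hvx _ (by omega)) hy hbv (by rw [norm_neg, hu])
      (by rw [dneg, dot_I_mul, neg_zero]) hf hs he t1 t2 t3 ?_
    rw [neg_neg]
    rcases min_choice (p.φ (2 * j)) (p.φ (2 * k + 1)) with h | h <;> rw [h]
    · rcases exponents_step (p := p) hT (m := 2 * j) (by omega) with h1 | h1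
      · right; left; rw [s1, h1, dir, Finsupp.neg_apply, Finsupp.single_eq_same]
      · left; rw [s1, h1, dir, Finsupp.neg_apply, Finsupp.single_eq_same, neg_neg]
    · rcases exponents_step (p := p) hT (m := 2 * k + 1) (by omega) with h1 | h1
      · right; right; right; rw [s3, h1, dir, Finsupp.neg_apply, Finsupp.single_eq_same]
      · right; right; left; rw [s3, h1, dir, Finsupp.neg_apply, Finsupp.single_eq_same, neg_neg]

end StraightLinePath

end RhombusGraph

/-! ### Telescoping the sums over zipper edges. -/

theorem apply_eq_zero_of_norm_ne {n : ℂ →₀ ℤ} (hn : ∀ d, n d ≠ 0 → ‖d‖ = 1) {z : ℂ} (hz : ‖z‖ ≠ 1) :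
    n z = 0 := by
  by_contra h; exact hz (hn z h)

/-- The sum `∑ n d / (z - d)`, which is minus the logarithmic derivative of `expEval n`. -/
noncomputable def poleSum (n : ℂ →₀ ℤ) (z : ℂ) : ℂ := n.sum fun d k => (k : ℂ) * (z - d)⁻¹

theorem poleSum_add (n m : ℂ →₀ ℤ) (z : ℂ) : poleSum (n + m) z = poleSum n z + poleSum m z :=
  Finsupp.sum_add_index' (by simp) (by intros; push_cast; ring)

theorem poleSum_single (d : ℂ) (k : ℤ) (z : ℂ) :
    poleSum (Finsupp.single d k) z = (k : ℂ) * (z - d)⁻¹ :=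
  Finsupp.sum_single_index (by simp)

theorem poleSum_zero (z : ℂ) : poleSum 0 z = 0 := Finsupp.sum_zero_index

theorem logDeriv_expEval {n : ℂ →₀ ℤ} {z : ℂ} (hz : n z = 0) :
    logDeriv (expEval n) z = -poleSum n z := by
  have hne : ∀ d ∈ n.support, z - d ≠ 0 := by
    intro d hd h
    rw [sub_eq_zero] at h
    subst h
    exact Finsupp.mem_support_iff.1 hd hz
  have : expEval n = fun z => ∏ d ∈ n.support, (z - d) ^ (-n d) := rfl
  rw [this, logDeriv_prod (f := fun d z => (z - d) ^ (-n d)) (fun d hd => zpow_ne_zero _ (hne d hd))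
    (fun d hd => DifferentiableAt.zpow (by fun_prop) (Or.inl (hne d hd))), poleSum, Finsupp.sum,
    ← Finset.sum_neg_distrib]
  refine Finset.sum_congr rfl fun d hd => ?_
  rw [logDeriv_fun_zpow (by fun_prop), logDeriv_apply]
  simp

namespace RhombusGraph

variable {T : RhombusGraph}

/-- Rhombi at a white vertex seen along an outgoing arrow. -/
theorem BoundedAngles.exists_white_side (hT : T.BoundedAngles) {a v : ℂ} (ha : T.IsWhite a)
    (h : T.Arrow a v) : (∃ R ∈ hT.whiteFan a, R.right = v - a) ∧
      ∃ R ∈ hT.whiteFan a, R.left = v - a := by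
  have hF := hT.isFan_white ha
  obtain ⟨S, hS, rfl⟩ := ha
  obtain ⟨R, hR, ⟨h1, rfl⟩ | ⟨h1, rfl⟩ | ⟨h1, rfl⟩ | ⟨h1, rfl⟩⟩ := h
  · have hm := hT.mem_whiteFan.2 ⟨hR, h1.symm⟩
    have e : R.right = R.faceR - S.white := by rw [h1]; simp [Rhombus.faceR]
    refine ⟨⟨R, hm, e⟩, ?_⟩
    obtain ⟨Q, hQ, hQ'⟩ := hF.exists_left_eq_right hm
    exact ⟨Q, hQ, hQ'.trans e⟩
  · have hm := hT.mem_whiteFan.2 ⟨hR, h1.symm⟩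
    have e : R.left = R.faceL - S.white := by rw [h1]; simp [Rhombus.faceL]
    refine ⟨?_, ⟨R, hm, e⟩⟩
    obtain ⟨Q, hQ, hQ'⟩ := hF.exists_right_eq_left hm
    exact ⟨Q, hQ, hQ'.trans e⟩
  · exact absurd h1 (T.white_ne_face hR hS).1
  · exact absurd h1 (T.white_ne_face hR hS).2

/-- Rhombi at a black vertex seen along an incoming arrow. -/
theorem BoundedAngles.exists_black_side (hT : T.BoundedAngles) {a v : ℂ} (ha : T.IsBlack a)
    (h : T.Arrow v a) : (∃ R ∈ hT.blackFan a, R.right = a - v) ∧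
      ∃ R ∈ hT.blackFan a, R.left = a - v := by
  have hF := hT.isFan_black ha
  obtain ⟨S, hS, rfl⟩ := ha
  obtain ⟨R, hR, ⟨rfl, h1⟩ | ⟨rfl, h1⟩ | ⟨rfl, h1⟩ | ⟨rfl, h1⟩⟩ := h
  · exact absurd h1 (T.black_ne_face hR hS).1
  · exact absurd h1 (T.black_ne_face hR hS).2
  · have hm := hT.mem_blackFan.2 ⟨hR, h1.symm⟩
    have e : R.left = S.black - R.faceR := by rw [h1]; simp [Rhombus.faceR, Rhombus.black]
    refine ⟨?_, ⟨R, hm, e⟩⟩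
    obtain ⟨Q, hQ, hQ'⟩ := hF.exists_right_eq_left hm
    exact ⟨Q, hQ, hQ'.trans e⟩
  · have hm := hT.mem_blackFan.2 ⟨hR, h1.symm⟩
    have e : R.right = S.black - R.faceL := by rw [h1]; simp [Rhombus.faceL, Rhombus.black]
    refine ⟨⟨R, hm, e⟩, ?_⟩
    obtain ⟨Q, hQ, hQ'⟩ := hF.exists_left_eq_right hm
    exact ⟨Q, hQ, hQ'.trans e⟩

/-- The discrete exponential `g_{u → v}` outside the unit circle. -/
noncomputable def expAt (T : RhombusGraph) (u v z : ℂ) : ℂ := expEval (T.exponents u v) z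

section ExpAt

variable (hT : T.BoundedAngles)
include hT

theorem BoundedAngles.exponents_apply_eq_zero {u v z : ℂ} (hu : T.IsVertex u) (hv : T.IsVertex v)
    (hz : ‖z‖ ≠ 1) : T.exponents u v z = 0 :=
  apply_eq_zero_of_norm_ne (fun _ => hT.norm_of_exponents_ne_zero hu hv) hz

theorem BoundedAngles.expAt_mul {u v w z : ℂ} (hu : T.IsVertex u) (hv : T.IsVertex v)
    (hw : T.IsVertex w) (hz : ‖z‖ ≠ 1) : T.expAt u v z * T.expAt v w z = T.expAt u w z := by
  rw [expAt, expAt, expAt, ← hT.exponents_add hu hv hw,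
    expEval_add (hT.exponents_apply_eq_zero hu hv hz) (hT.exponents_apply_eq_zero hv hw hz)]

theorem BoundedAngles.expAt_rhombus {R : Rhombus} (hR : R ∈ T.rhombi) {z : ℂ} (hz : ‖z‖ ≠ 1) :
    T.expAt R.white R.black z = (z - R.right)⁻¹ * (z - R.left)⁻¹ := by
  have h1 : ∀ d : ℂ, ‖d‖ = 1 → (Finsupp.single d 1 : ℂ →₀ ℤ) z = 0 := fun d hd => by
    rw [Finsupp.single_apply, if_neg]; rintro rfl; exact hz hd
  rw [expAt, hT.exponents_white_black hR, expEval_add (h1 _ R.norm_right) (h1 _ R.norm_left),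
    expEval_single, expEval_single, zpow_neg_one, zpow_neg_one]

theorem BoundedAngles.expAt_arrow {u v z : ℂ} (h : T.Arrow u v) :
    T.expAt u v z = (z - (v - u))⁻¹ := by
  rw [expAt, hT.exponents_arrow h h.isVertex.1 h.isVertex.2, expEval_single, zpow_neg_one]

end ExpAt

namespace StraightLinePath

variable {F F' : ℂ} {θ₀ : ℝ} (p : T.StraightLinePath F F' θ₀)

/-- The zipper edges at one of the middle vertices. -/
def zipperAt (j : ℕ) : Set Rhombus :=
  {R | R ∈ T.rhombi ∧ ∃ α β : ℝ, α < β ∧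
    R.right = Complex.exp (α * Complex.I) ∧ R.left = Complex.exp (β * Complex.I) ∧
    ((R.white = p.v (2 * j + 1) ∧ p.φ (2 * j + 1) ≤ α ∧ β ≤ p.φ (2 * j) + Real.pi) ∨
      (R.black = p.v (2 * j + 1) ∧ p.φ (2 * j) ≤ α ∧ β ≤ p.φ (2 * j + 1) + Real.pi))}

theorem mem_zipper {R : Rhombus} : R ∈ p.zipper ↔ ∃ j < p.P, R ∈ p.zipperAt j := by
  constructor
  · rintro ⟨hR, j, hj, h⟩; exact ⟨j, hj, hR, h⟩
  · rintro ⟨j, hj, hR, h⟩; exact ⟨hR, j, hj, h⟩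

variable {p}

theorem finite_zipperAt (hT : T.BoundedAngles) (j : ℕ) : (p.zipperAt j).Finite := by
  classical
  refine ((hT.whiteFan (p.v (2 * j + 1))) ∪ (hT.blackFan (p.v (2 * j + 1)))).finite_toSet.subset ?_
  rintro R ⟨hR, α, β, -, -, -, ⟨h, -⟩ | ⟨h, -⟩⟩
  · exact Finset.mem_coe.2 (Finset.mem_union_left _ (hT.mem_whiteFan.2 ⟨hR, h⟩))
  · exact Finset.mem_coe.2 (Finset.mem_union_right _ (hT.mem_blackFan.2 ⟨hR, h⟩))

/-- Each step changes the level by one and the path starts at a face, of level 1; after an odd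
number of steps the level is even. -/
theorem level_ne_one (hF : T.IsFace F) {j : ℕ} (hj : j < p.P) : T.level (p.v (2 * j + 1)) ≠ 1 := by
  have h : ∀ m, m ≤ 2 * p.P → T.level (p.v m) % 2 = ((m : ℤ) + 1) % 2 := by
    intro m
    induction m with
    | zero => intro _; rw [p.start_eq, level_face hF]; norm_num
    | succ m ih =>
      intro hm
      have := ih (by omega)
      rcases arrow_or_of_adj (p.adj m (by omega)) with h | h
      · rw [h.level_eq]; push_cast; omega
      · rw [h.level_eq] at this; push_cast; omega
  have := h (2 * j + 1) (by omega)
  push_cast at this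
  omega

theorem isWhite_or_isBlack (hF : T.IsFace F) {j : ℕ} (hj : j < p.P) :
    T.IsWhite (p.v (2 * j + 1)) ∨ T.IsBlack (p.v (2 * j + 1)) := by
  have := level_ne_one hF hj
  rw [level] at this
  split_ifs at this with h1 h2
  · exact Or.inl h1
  · exact Or.inr h2
  · exact absurd rfl this

/-- Makes the zipper a disjoint union over its middle vertices. A forward path does not return to
the same vertex, so the two middle vertices would be opposite corners of `R`, joined by exponents
consisting of its two sides. The sector conditions force the first and the last step onto the same
side, which would then have exponent of absolute value at least 2. -/
theorem not_mem_zipperAt_of_lt (hT : T.BoundedAngles) (hF : T.IsVertex F) {j k : ℕ} (hjk : j < k)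
    (hk : k < p.P) {R : Rhombus} (hj' : R ∈ p.zipperAt j) (hk' : R ∈ p.zipperAt k) : False := by
  obtain ⟨hR, α, β, hαβ, hr, hl, hc⟩ := hj'
  obtain ⟨-, α', β', hαβ', hr', hl', hc'⟩ := hk'
  have hp := Real.pi_pos
  have a0 := p.angle_mem (2 * j) (by omega)
  have a1 := p.angle_mem (2 * j + 1) (by omega)
  have c0 := p.angle_mem (2 * k) (by omega)
  have c1 := p.angle_mem (2 * k + 1) (by omega)
  have hvx := fun m (hm : m ≤ 2 * p.P) => isVertex (p := p) hF hm
  have t1 := toward_step (p := p) hT (m := 2 * j + 1) (by omega)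
  have t2 := toward (p := p) hT hF (m := 2 * j + 1 + 1) (k := 2 * k) (by omega) (by omega)
  have t3 := toward_step (p := p) hT (m := 2 * k) (by omega)
  have hsum : ∀ d, T.exponents (p.v (2 * j + 1)) (p.v (2 * k + 1)) d =
      T.exponents (p.v (2 * j + 1)) (p.v (2 * j + 1 + 1)) d +
        T.exponents (p.v (2 * j + 1 + 1)) (p.v (2 * k)) d +
        T.exponents (p.v (2 * k)) (p.v (2 * k + 1)) d := by
    intro d
    rw [← hT.exponents_add (hvx (2 * j + 1) (by omega)) (hvx (2 * k) (by omega))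
      (hvx (2 * k + 1) (by omega)), ← hT.exponents_add (hvx (2 * j + 1) (by omega))
      (hvx (2 * j + 1 + 1) (by omega)) (hvx (2 * k) (by omega))]
    simp only [Finsupp.add_apply]
  have d1 := dot_dir (p := p) (m := 2 * j + 1) (by omega)
  have d2 := dot_dir (p := p) (m := 2 * k) (by omega)
  have hne : p.v (2 * j + 1) ≠ p.v (2 * k + 1) := by
    intro h
    have h0 : ∀ d, T.exponents (p.v (2 * j + 1)) (p.v (2 * k + 1)) d = 0 := by
      rw [← h, hT.exponents_self (hvx _ (by omega))]; intro d; rfl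
    rcases exponents_step (p := p) hT (m := 2 * j + 1) (by omega) with e | e
    · have := hsum (p.dir (2 * j + 1))
      rw [h0, e, Finsupp.single_eq_same] at this
      linarith [t2.nonneg d1, t3.nonneg d1]
    · have hd : dot (-p.dir (2 * j + 1)) (Complex.exp (θ₀ * Complex.I)) < 0 := by
        rw [dot_neg_left]; linarith
      have := hsum (-p.dir (2 * j + 1))
      rw [h0, e, Finsupp.single_eq_same] at this
      linarith [t2.nonpos hd, t3.nonpos hd]
  have hsides : ∀ d, (Finsupp.single R.right 1 + Finsupp.single R.left 1 : ℂ →₀ ℤ) d ≠ 0 →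
      d = R.right ∨ d = R.left := by
    intro d hd
    by_contra! h
    rw [Finsupp.add_apply, Finsupp.single_apply, Finsupp.single_apply, if_neg h.1.symm,
      if_neg h.2.symm] at hd
    simp at hd
  rcases hc with ⟨h, h1, h2⟩ | ⟨h, h1, h2⟩ <;> rcases hc' with ⟨g, g1, g2⟩ | ⟨g, g1, g2⟩
  · exact hne (h.symm.trans g)
  · have e := hT.exponents_white_black hR
    rw [h, g] at e
    have e1 := exponents_of_arrow (p := p) hT (m := 2 * j + 1) (by omega)
      (arrow_of_white ⟨R, hR, h⟩ (p.adj _ (by omega)))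
    have e2 := exponents_of_arrow (p := p) hT (m := 2 * k) (by omega)
      (arrow_to_black ⟨R, hR, g⟩ (p.adj _ (by omega)))
    rw [e, e1, e2] at hsum
    rw [e1] at t1
    rw [e2] at t3
    have r1 : p.dir (2 * j + 1) = R.right := by
      refine (hsides _ ?_).resolve_right ?_
      · rw [hsum, Finsupp.single_eq_same]
        linarith [t2.nonneg d1, t3.nonneg d1]
      · rw [hl, dir]
        exact exp_ne_exp (by linarith) (by linarith [a0.2, a1.1])
    have r2 : p.dir (2 * k) = R.right := by
      refine (hsides _ ?_).resolve_right ?_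
      · rw [hsum, Finsupp.single_eq_same]
        linarith [t2.nonneg d2, t1.nonneg d2]
      · rw [hl', dir]
        exact exp_ne_exp (by linarith) (by linarith [c1.2, c0.1])
    have := hsum R.right
    rw [r1, r2, Finsupp.add_apply, Finsupp.single_eq_same, Finsupp.single_apply,
      if_neg R.right_ne_left.symm] at this
    rw [r1] at d1
    linarith [t2.nonneg d1]
  · have e := hT.exponents_white_black hR
    rw [h, g, hT.exponents_symm (hvx (2 * j + 1) (by omega)) (hvx (2 * k + 1) (by omega)),
      neg_eq_iff_eq_neg] at e
    have e1 := exponents_of_arrow_symm (p := p) hT (m := 2 * j + 1) (by omega)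
      (arrow_to_black ⟨R, hR, h⟩ (p.adj _ (by omega)).symm)
    have e2 := exponents_of_arrow_symm (p := p) hT (m := 2 * k) (by omega)
      (arrow_of_white ⟨R, hR, g⟩ (p.adj _ (by omega)).symm)
    rw [e, e1, e2] at hsum
    rw [e1] at t1
    rw [e2] at t3
    have d1' : dot (-p.dir (2 * j + 1)) (Complex.exp (θ₀ * Complex.I)) < 0 := by
      rw [dot_neg_left]; linarith
    have d2' : dot (-p.dir (2 * k)) (Complex.exp (θ₀ * Complex.I)) < 0 := by
      rw [dot_neg_left]; linarith
    have r1 : -p.dir (2 * j + 1) = R.left := by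
      refine (hsides _ ?_).resolve_left ?_
      · rw [← neg_ne_zero, ← Finsupp.neg_apply, hsum, Finsupp.single_eq_same]
        linarith [t2.nonpos d1', t3.nonpos d1']
      · rw [hr, dir, ← exp_add_pi_mul_I]
        exact (exp_ne_exp (by linarith) (by linarith [a0.1, a1.2])).symm
    have r2 : -p.dir (2 * k) = R.left := by
      refine (hsides _ ?_).resolve_left ?_
      · rw [← neg_ne_zero, ← Finsupp.neg_apply, hsum, Finsupp.single_eq_same]
        linarith [t2.nonpos d2', t1.nonpos d2']
      · rw [hr', dir, ← exp_add_pi_mul_I]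
        exact (exp_ne_exp (by linarith) (by linarith [c1.1, c0.2])).symm
    have := hsum R.left
    rw [r1, r2, Finsupp.neg_apply, Finsupp.add_apply, Finsupp.single_eq_same, Finsupp.single_apply,
      if_neg R.right_ne_left, Finsupp.single_eq_same] at this
    rw [r1] at d1'
    linarith [t2.nonpos d1']
  · exact hne (h.symm.trans g)

end StraightLinePath

end RhombusGraph

/-! ### Sector sums and the cyclic kernel. -/

open Filter Topology

namespace RhombusGraph

namespace StraightLinePath

variable {T : RhombusGraph} {F F' : ℂ} {θ₀ : ℝ} {p : T.StraightLinePath F F' θ₀}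

/-- The rhombi of the zipper at a white vertex form a sector. -/
theorem sum_zipperAt_white (hT : T.BoundedAngles) {j : ℕ} (hj : j < p.P)
    (ha : T.IsWhite (p.v (2 * j + 1))) (Z : Finset Rhombus) (hZ : ∀ R, R ∈ Z ↔ R ∈ p.zipperAt j)
    (f : ℂ → ℂ) :
    ∑ R ∈ Z, (f R.left - f R.right) = f (-p.dir (2 * j)) - f (p.dir (2 * j + 1)) := by
  have hp := Real.pi_pos
  have a0 := p.angle_mem (2 * j) (by omega)
  have a1 := p.angle_mem (2 * j + 1) (by omega)
  have s0 := (hT.exists_white_side ha (arrow_of_white ha (p.adj (2 * j) (by omega)).symm)).2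
  have s1 := (hT.exists_white_side ha (arrow_of_white ha (p.adj (2 * j + 1) (by omega)))).1
  rw [← neg_sub, p.step (2 * j) (by omega), ← exp_add_pi_mul_I] at s0
  rw [p.step (2 * j + 1) (by omega)] at s1
  rw [dir, ← exp_add_pi_mul_I, dir]
  refine (hT.isFan_white ha).sum_sector f (by linarith [a0.1, a1.2]) (by linarith [a0.2, a1.1])
    s1 s0 Z fun R => ?_
  rw [hZ, hT.mem_whiteFan]
  constructor
  · rintro ⟨hR, α, β, h1, h2, h3, ⟨h4, h5⟩ | ⟨h4, h5⟩⟩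
    · exact ⟨⟨hR, h4⟩, α, β, h1, h2, h3, h5⟩
    · obtain ⟨S, hS, ha⟩ := ha
      exact absurd (ha.trans h4.symm) (T.white_ne_black hR hS)
  · rintro ⟨⟨hR, h4⟩, α, β, h1, h2, h3, h5⟩
    exact ⟨hR, α, β, h1, h2, h3, Or.inl ⟨h4, h5⟩⟩

/-- The rhombi of the zipper at a black vertex form a sector. -/
theorem sum_zipperAt_black (hT : T.BoundedAngles) {j : ℕ} (hj : j < p.P)
    (ha : T.IsBlack (p.v (2 * j + 1))) (Z : Finset Rhombus) (hZ : ∀ R, R ∈ Z ↔ R ∈ p.zipperAt j)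
    (f : ℂ → ℂ) :
    ∑ R ∈ Z, (f R.left - f R.right) = f (-p.dir (2 * j + 1)) - f (p.dir (2 * j)) := by
  have hp := Real.pi_pos
  have a0 := p.angle_mem (2 * j) (by omega)
  have a1 := p.angle_mem (2 * j + 1) (by omega)
  have s0 := (hT.exists_black_side ha (arrow_to_black ha (p.adj (2 * j) (by omega)))).1
  have s1 := (hT.exists_black_side ha (arrow_to_black ha (p.adj (2 * j + 1) (by omega)).symm)).2
  rw [p.step (2 * j) (by omega)] at s0
  rw [← neg_sub, p.step (2 * j + 1) (by omega), ← exp_add_pi_mul_I] at s1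
  rw [dir, ← exp_add_pi_mul_I, dir]
  refine (hT.isFan_black ha).sum_sector f (by linarith [a0.2, a1.1]) (by linarith [a0.1, a1.2])
    s0 s1 Z fun R => ?_
  rw [hZ, hT.mem_blackFan]
  constructor
  · rintro ⟨hR, α, β, h1, h2, h3, ⟨h4, h5⟩ | ⟨h4, h5⟩⟩
    · obtain ⟨S, hS, ha⟩ := ha
      exact absurd (h4.trans ha.symm) (T.white_ne_black hS hR)
    · exact ⟨⟨hR, h4⟩, α, β, h1, h2, h3, h5⟩
  · rintro ⟨⟨hR, h4⟩, α, β, h1, h2, h3, h5⟩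
    exact ⟨hR, α, β, h1, h2, h3, Or.inr ⟨h4, h5⟩⟩

/-- The contribution of a rhombus to the kernel of the trace. -/
noncomputable def zipperTerm (T : RhombusGraph) (F : ℂ) (x y : ℂ) (R : Rhombus) : ℂ :=
  Complex.I * (R.left - R.right) * (T.expAt F R.black x * T.expAt R.white F y)

section

variable (hT : T.BoundedAngles) (hF : T.IsFace F) {j : ℕ} (hj : j < p.P)
  (Z : Finset Rhombus) (hZ : ∀ R, R ∈ Z ↔ R ∈ p.zipperAt j) {x y : ℂ}
include hT hF hj hZ

/-- Going from the white vertex to a black corner divides by (x − r)(x − l), and (l − r) over this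
product is a difference of simple fractions. Over the sector only the two extreme fractions survive.
At a black vertex the same happens in the variable `y`. -/
theorem sum_zipperTerm_white (hx : ‖x‖ ≠ 1) (ha : T.IsWhite (p.v (2 * j + 1))) :
    ∑ R ∈ Z, zipperTerm T F x y R = Complex.I *
      (T.expAt F (p.v (2 * j + 1)) x * T.expAt (p.v (2 * j + 1)) F y) *
        ((x + p.dir (2 * j))⁻¹ - (x - p.dir (2 * j + 1))⁻¹) := by
  have h := sum_zipperAt_white hT hj ha Z hZ fun d => (x - d)⁻¹
  rw [sub_neg_eq_add] at h
  rw [← h, Finset.mul_sum]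
  refine Finset.sum_congr rfl fun R hR => ?_
  have hRz := (hZ R).1 hR
  obtain ⟨hR, α, β, -, -, -, ⟨h4, -⟩ | ⟨h4, -⟩⟩ := hRz
  · have hv : T.IsVertex R.white := ⟨R, hR, R.isCorner_white⟩
    rw [zipperTerm, ← h4, ← hT.expAt_mul hF.isVertex hv ⟨R, hR, R.isCorner_black⟩ hx,
      hT.expAt_rhombus hR hx]
    have e1 : x - R.right ≠ 0 := by
      intro h; rw [sub_eq_zero] at h; exact hx (h ▸ R.norm_right)
    have e2 : x - R.left ≠ 0 := by
      intro h; rw [sub_eq_zero] at h; exact hx (h ▸ R.norm_left)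
    rw [inv_sub_inv e2 e1]
    field_simp
    ring
  · obtain ⟨S, hS, ha⟩ := ha
    exact absurd (ha.trans h4.symm) (T.white_ne_black hR hS)

theorem sum_zipperTerm_black (hy : ‖y‖ ≠ 1) (ha : T.IsBlack (p.v (2 * j + 1))) :
    ∑ R ∈ Z, zipperTerm T F x y R = Complex.I *
      (T.expAt F (p.v (2 * j + 1)) x * T.expAt (p.v (2 * j + 1)) F y) *
        ((y + p.dir (2 * j + 1))⁻¹ - (y - p.dir (2 * j))⁻¹) := by
  have h := sum_zipperAt_black hT hj ha Z hZ fun d => (y - d)⁻¹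
  rw [sub_neg_eq_add] at h
  rw [← h, Finset.mul_sum]
  refine Finset.sum_congr rfl fun R hR => ?_
  have hRz := (hZ R).1 hR
  obtain ⟨hR, α, β, -, -, -, ⟨h4, -⟩ | ⟨h4, -⟩⟩ := hRz
  · obtain ⟨S, hS, ha⟩ := ha
    exact absurd (h4.trans ha.symm) (T.white_ne_black hS hR)
  · have hv : T.IsVertex R.black := ⟨R, hR, R.isCorner_black⟩
    rw [zipperTerm, ← h4, ← hT.expAt_mul ⟨R, hR, R.isCorner_white⟩ hv hF.isVertex hy,
      hT.expAt_rhombus hR hy]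
    have e1 : y - R.right ≠ 0 := by
      intro h; rw [sub_eq_zero] at h; exact hy (h ▸ R.norm_right)
    have e2 : y - R.left ≠ 0 := by
      intro h; rw [sub_eq_zero] at h; exact hy (h ▸ R.norm_left)
    rw [inv_sub_inv e2 e1]
    field_simp
    ring

/-- The sum over the zipper edges at one middle vertex, as a difference. -/
theorem sum_zipperTerm_of_ne (hx : ‖x‖ ≠ 1) (hy : ‖y‖ ≠ 1) (hxy : x ≠ y) :
    ∑ R ∈ Z, zipperTerm T F x y R = Complex.I / (x - y) *
      (T.expAt F (p.v (2 * (j + 1))) x * T.expAt (p.v (2 * (j + 1))) F y -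
        T.expAt F (p.v (2 * j)) x * T.expAt (p.v (2 * j)) F y) := by
  have hsub : x - y ≠ 0 := sub_ne_zero.2 hxy
  have adj0 := p.adj (2 * j) (by omega)
  have adj1 := p.adj (2 * j + 1) (by omega)
  have st0 := p.step (2 * j) (by omega)
  have st1 := p.step (2 * j + 1) (by omega)
  have vF := hF.isVertex
  have v0 := (isVertex_of_adj adj0).1
  have va := (isVertex_of_adj adj0).2
  have v1 := (isVertex_of_adj adj1).2
  have ndir : ∀ m : ℕ, ‖p.dir m‖ = 1 := fun m => Complex.norm_exp_ofReal_mul_I _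
  have hm : ∀ {z : ℂ}, ‖z‖ ≠ 1 → ∀ m, z - p.dir m ≠ 0 := by
    intro z hz m h; rw [sub_eq_zero] at h; exact hz (h ▸ ndir m)
  have hpl : ∀ {z : ℂ}, ‖z‖ ≠ 1 → ∀ m, z + p.dir m ≠ 0 := by
    intro z hz m h; rw [add_eq_zero_iff_eq_neg] at h; exact hz (by rw [h, norm_neg, ndir m])
  change _ = Complex.I / (x - y) * (T.expAt F (p.v (2 * j + 1 + 1)) x *
    T.expAt (p.v (2 * j + 1 + 1)) F y - _)
  have hx0 := hm hx (2 * j)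
  have hx1 := hm hx (2 * j + 1)
  have hx0' := hpl hx (2 * j)
  have hx1' := hpl hx (2 * j + 1)
  have hy0 := hm hy (2 * j)
  have hy1 := hm hy (2 * j + 1)
  have hy0' := hpl hy (2 * j)
  have hy1' := hpl hy (2 * j + 1)
  rcases isWhite_or_isBlack hF hj with ha | ha
  · rw [sum_zipperTerm_white hT hF hj Z hZ hx ha]
    have e0 : ∀ z, T.expAt (p.v (2 * j + 1)) (p.v (2 * j)) z = (z + p.dir (2 * j))⁻¹ := by
      intro z
      rw [hT.expAt_arrow (arrow_of_white ha adj0.symm), ← neg_sub (p.v (2 * j + 1)), st0, sub_neg_eq_add, dir]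
    have e1 : ∀ z, T.expAt (p.v (2 * j + 1)) (p.v (2 * j + 1 + 1)) z =
        (z - p.dir (2 * j + 1))⁻¹ := by
      intro z
      rw [hT.expAt_arrow (arrow_of_white ha adj1), st1, dir]
    rw [← hT.expAt_mul va v0 vF hy, e0]
    have q0 := hT.expAt_mul vF va v0 hx
    have q1 := hT.expAt_mul vF va v1 hx
    have q2 := hT.expAt_mul va v1 vF hy
    rw [← hT.expAt_mul va v0 vF hy, e0, e1] at q2
    rw [e0] at q0
    rw [e1] at q1
    have q3 : T.expAt (p.v (2 * j + 1 + 1)) F y = (y - p.dir (2 * j + 1)) *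
        ((y + p.dir (2 * j))⁻¹ * T.expAt (p.v (2 * j)) F y) := by
      rw [← q2, mul_inv_cancel_left₀ hy1]
    rw [← q0, ← q1, q3]
    field_simp
    ring
  · rw [sum_zipperTerm_black hT hF hj Z hZ hy ha]
    have e0 : ∀ z, T.expAt (p.v (2 * j)) (p.v (2 * j + 1)) z = (z - p.dir (2 * j))⁻¹ := by
      intro z
      rw [hT.expAt_arrow (arrow_to_black ha adj0), st0, dir]
    have e1 : ∀ z, T.expAt (p.v (2 * j + 1 + 1)) (p.v (2 * j + 1)) z =
        (z + p.dir (2 * j + 1))⁻¹ := by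
      intro z
      rw [hT.expAt_arrow (arrow_to_black ha adj1.symm), ← neg_sub (p.v (2 * j + 1 + 1)), st1, sub_neg_eq_add, dir]
    have q0 := hT.expAt_mul vF v0 va hx
    have q1 := hT.expAt_mul vF v1 va hx
    rw [e0] at q0
    rw [e1] at q1
    rw [← hT.expAt_mul v0 va vF hy, ← hT.expAt_mul v1 va vF hy, e0, e1]
    have q2 : T.expAt F (p.v (2 * j)) x = (x - p.dir (2 * j)) * T.expAt F (p.v (2 * j + 1)) x := by
      rw [← q0, mul_comm (x - _), inv_mul_cancel_right₀ hx0]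
    have q3 : T.expAt F (p.v (2 * j + 1 + 1)) x =
        (x + p.dir (2 * j + 1)) * T.expAt F (p.v (2 * j + 1)) x := by
      rw [← q1, mul_comm (x + _), inv_mul_cancel_right₀ hx1']
    rw [q2, q3]
    field_simp
    ring

/-- For equal arguments the two exponentials multiply to 1, and the two extreme fractions are
exactly the increments of the pole sum along the two steps through the middle vertex. -/
theorem sum_zipperTerm_self (hx : ‖x‖ ≠ 1) :
    ∑ R ∈ Z, zipperTerm T F x x R = -Complex.I *
      (poleSum (T.exponents F (p.v (2 * (j + 1)))) x - poleSum (T.exponents F (p.v (2 * j))) x) := by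
  have adj0 := p.adj (2 * j) (by omega)
  have adj1 := p.adj (2 * j + 1) (by omega)
  have vF := hF.isVertex
  have v0 := (isVertex_of_adj adj0).1
  have va := (isVertex_of_adj adj0).2
  have v1 := (isVertex_of_adj adj1).2
  have hone : T.expAt F (p.v (2 * j + 1)) x * T.expAt (p.v (2 * j + 1)) F x = 1 := by
    rw [hT.expAt_mul vF va vF hx, expAt, hT.exponents_self vF, expEval_zero]
  change _ = -Complex.I * (poleSum (T.exponents F (p.v (2 * j + 1 + 1))) x - _)
  rw [← hT.exponents_add vF va v1, ← hT.exponents_add vF v0 va, poleSum_add, poleSum_add]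
  rcases isWhite_or_isBlack hF hj with ha | ha
  · rw [sum_zipperTerm_white hT hF hj Z hZ hx ha, hone,
      exponents_of_arrow_symm hT (by omega) (arrow_of_white ha adj0.symm),
      exponents_of_arrow hT (by omega) (arrow_of_white ha adj1), poleSum_single, poleSum_single,
      sub_neg_eq_add]
    push_cast
    ring
  · rw [sum_zipperTerm_black hT hF hj Z hZ hx ha, hone,
      exponents_of_arrow hT (by omega) (arrow_to_black ha adj0),
      exponents_of_arrow_symm hT (by omega) (arrow_to_black ha adj1.symm), poleSum_single,
      poleSum_single, sub_neg_eq_add]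
    push_cast
    ring

end

/-- The zipper is finite. -/
theorem finite_zipper (hT : T.BoundedAngles) : p.zipper.Finite := by
  have : p.zipper = ⋃ j ∈ Finset.range p.P, p.zipperAt j := by
    ext R
    simp [p.mem_zipper]
  rw [this]
  exact Set.Finite.biUnion (Finset.finite_toSet _) fun j _ => finite_zipperAt hT j

/-- Summing over the zipper produces the cyclic kernel. -/
theorem sum_zipperTerm (hT : T.BoundedAngles) (hF : T.IsFace F) (hF' : T.IsFace F')
    {x y : ℂ} (hx : ‖x‖ ≠ 1) (hy : ‖y‖ ≠ 1) :
    ∑ R ∈ (finite_zipper (p := p) hT).toFinset, zipperTerm T F x y R =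
      -Complex.I * cyclicKernel (T.discreteExp F F') x y := by
  classical
  have vF := hF.isVertex
  have vF' := hF'.isVertex
  have hdecomp : (finite_zipper (p := p) hT).toFinset = (Finset.range p.P).biUnion fun j =>
      (finite_zipperAt (p := p) hT j).toFinset := by
    ext R
    simp [p.mem_zipper]
  have hdisj : Set.PairwiseDisjoint (Finset.range p.P : Set ℕ) fun j =>
      (finite_zipperAt (p := p) hT j).toFinset := by
    intro j hj k hk hjk
    rw [Finset.coe_range, Set.mem_Iio] at hj hk
    refine Finset.disjoint_left.2 fun R h1 h2 => ?_
    rw [Set.Finite.mem_toFinset] at h1 h2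
    rcases lt_or_gt_of_ne hjk with h | h
    · exact not_mem_zipperAt_of_lt hT vF h hk h1 h2
    · exact not_mem_zipperAt_of_lt hT vF h hj h2 h1
  have hval : ∀ {z : ℂ}, ‖z‖ ≠ 1 → T.discreteExp F F' z = T.expAt F F' z := fun hz =>
    discreteExp_eq (hT.reachable vF vF') (hT.exponents_apply_eq_zero vF vF' hz)
  have hself : ∀ {z : ℂ}, T.expAt F F z = 1 := by
    intro z; rw [expAt, hT.exponents_self vF, expEval_zero]
  rw [hdecomp, Finset.sum_biUnion hdisj, cyclicKernel]
  split_ifs with hxy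
  · subst hxy
    have hterm : ∀ j ∈ Finset.range p.P,
        ∑ R ∈ (finite_zipperAt (p := p) hT j).toFinset, zipperTerm T F x x R = -Complex.I *
          (poleSum (T.exponents F (p.v (2 * (j + 1)))) x -
            poleSum (T.exponents F (p.v (2 * j))) x) := fun j hj =>
      sum_zipperTerm_self hT hF (Finset.mem_range.1 hj) _ (fun R => by simp) hx
    rw [Finset.sum_congr rfl hterm, ← Finset.mul_sum,
      Finset.sum_range_sub (fun j => poleSum (T.exponents F (p.v (2 * j))) x), mul_zero, p.start_eq,
      p.end_eq, hT.exponents_self vF, poleSum_zero, sub_zero]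
    -- The derivative requires equality on a neighbourhood, which is available because the
    -- complement of the unit circle is open.
    have heq : T.discreteExp F F' =ᶠ[𝓝 x] expEval (T.exponents F F') := by
      have hopen : ∀ᶠ z : ℂ in 𝓝 x, ‖z‖ ≠ 1 := by
        have : IsOpen {z : ℂ | ‖z‖ ≠ 1} := isOpen_ne_fun continuous_norm continuous_const
        exact this.mem_nhds hx
      exact hopen.mono fun z hz => hval hz
    rw [heq.deriv_eq, heq.eq_of_nhds, ← logDeriv_apply,
      logDeriv_expEval (hT.exponents_apply_eq_zero vF vF' hx), neg_neg]
  · have hterm : ∀ j ∈ Finset.range p.P,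
        ∑ R ∈ (finite_zipperAt (p := p) hT j).toFinset, zipperTerm T F x y R =
          Complex.I / (x - y) *
          (T.expAt F (p.v (2 * (j + 1))) x * T.expAt (p.v (2 * (j + 1))) F y -
            T.expAt F (p.v (2 * j)) x * T.expAt (p.v (2 * j)) F y) := fun j hj =>
      sum_zipperTerm_of_ne hT hF (Finset.mem_range.1 hj) _ (fun R => by simp) hx hy hxy
    rw [Finset.sum_congr rfl hterm, ← Finset.mul_sum,
      Finset.sum_range_sub (fun j => T.expAt F (p.v (2 * j)) x * T.expAt (p.v (2 * j)) F y),
      mul_zero, p.start_eq, p.end_eq, hself, hself, hval hx, hval hy]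
    have h2 := hT.expAt_mul vF vF' vF hy
    rw [hself] at h2
    rw [eq_inv_of_mul_eq_one_right h2]
    ring

end StraightLinePath

end RhombusGraph

/-! ### The trace as a sum over closed sequences of edges, and Fubini. -/

open MeasureTheory Filter Topology

open Classical in
theorem finsum_mul_ite {ι α : Type*} [Fintype ι] (e : ι → α) (f : α → ℂ) (c : ι → α → ℂ) :
    ∑ᶠ a, f a * (∑ i, if e i = a then c i a else 0) = ∑ i, f (e i) * c i (e i) := by
  have h1 : ∀ a, f a * (∑ i, if e i = a then c i a else 0) =
      ∑ i, if e i = a then f a * c i a else 0 := by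
    intro a
    rw [Finset.mul_sum]
    exact Finset.sum_congr rfl fun i _ => by split_ifs <;> simp
  rw [finsum_congr h1, finsum_sum_comm]
  · refine Finset.sum_congr rfl fun i _ => ?_
    rw [finsum_eq_single _ (e i) fun a ha => if_neg ha.symm, if_pos rfl]
  · intro i _
    refine (Set.finite_singleton (e i)).subset fun a ha => ?_
    by_contra h
    exact ha (if_neg fun h' => h h'.symm)

section Trace

variable {ι : Type*} [Fintype ι] [DecidableEq ι]

/-- The weight `g` of the two ends lets the induction remove the first vertex; choosing `g` as the
closing entry gives the trace. -/
theorem sum_path_prod (N : Matrix ι ι ℂ) (m : ℕ) (g : ι → ι → ℂ) :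
    ∑ ρ : Fin (m + 1) → ι, (∏ j : Fin m, N (ρ j.castSucc) (ρ j.succ)) * g (ρ 0) (ρ (Fin.last m)) =
      ∑ i, ∑ k, (N ^ m) i k * g i k := by
  induction m generalizing g with
  | zero =>
    rw [← (Fin.consEquiv fun _ => ι).sum_comp, Fintype.sum_prod_type]
    refine Finset.sum_congr rfl fun i _ => ?_
    rw [Fintype.sum_unique, Finset.sum_eq_single i]
    · simp [Fin.consEquiv]
    · intro k _ hk
      simp [hk.symm]
    · simp
  | succ m ih =>
    rw [← (Fin.consEquiv fun _ => ι).sum_comp, Fintype.sum_prod_type]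
    refine Finset.sum_congr rfl fun i _ => ?_
    have h := ih fun a k => N i a * g i k
    have e : ∀ σ : Fin (m + 1) → ι, (∏ j : Fin (m + 1),
        N ((Fin.consEquiv fun _ => ι) (i, σ) j.castSucc) ((Fin.consEquiv fun _ => ι) (i, σ) j.succ)) *
          g ((Fin.consEquiv fun _ => ι) (i, σ) 0)
            ((Fin.consEquiv fun _ => ι) (i, σ) (Fin.last (m + 1))) =
        (∏ j : Fin m, N (σ j.castSucc) (σ j.succ)) *
          (N i (σ 0) * g i (σ (Fin.last m))) := by
      intro σ
      rw [Fin.prod_univ_succ]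
      simp only [Fin.consEquiv, Equiv.coe_fn_mk, Fin.castSucc_zero, Fin.cons_zero, Fin.cons_succ,
        Fin.castSucc_succ, ← Fin.succ_last]
      ring
    rw [Finset.sum_congr rfl fun σ _ => e σ, h, Finset.sum_comm]
    refine Finset.sum_congr rfl fun k _ => ?_
    rw [pow_succ', Matrix.mul_apply, Finset.sum_mul]
    exact Finset.sum_congr rfl fun a _ => by ring

/-- The trace of a power as a sum over closed paths. -/
theorem trace_pow_eq_sum (N : Matrix ι ι ℂ) (n : ℕ) [NeZero n] :
    (N ^ n).trace = ∑ ρ : Fin n → ι, ∏ j : Fin n, N (ρ j) (ρ (j + 1)) := by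
  cases n with
  | zero => exact absurd rfl (NeZero.ne 0)
  | succ m =>
    have h := sum_path_prod N m fun i k => N k i
    have e : ∀ ρ : Fin (m + 1) → ι, ∏ j : Fin (m + 1), N (ρ j) (ρ (j + 1)) =
        (∏ j : Fin m, N (ρ j.castSucc) (ρ j.succ)) * N (ρ (Fin.last m)) (ρ 0) := by
      intro ρ
      rw [Fin.prod_univ_castSucc, Fin.last_add_one]
      simp only [Fin.coeSucc_eq_succ]
    rw [Finset.sum_congr rfl fun ρ _ => e ρ, h, pow_succ, Matrix.trace]
    exact Finset.sum_congr rfl fun i _ => by rw [Matrix.diag_apply, Matrix.mul_apply]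

variable {α : Type*} (e : ι → α) (M : ι → α → ℂ)

-- The matrix factors as an incidence matrix of `e` times `M`, and the trace is invariant when the
-- two factors are interchanged. The map `e` need not be injective: several zipper edges can share a
-- black vertex.
open Classical in
theorem infTrace_infPow {Q : Matrix α α ℂ} (hQ : ∀ a a', Q a a' = ∑ i, if e i = a then M i a' else 0)
    (n : ℕ) [NeZero n] :
    infTrace (infPow Q n) = ((Matrix.of fun i j => M i (e j)) ^ n).trace := by
  obtain ⟨m, rfl⟩ := Nat.exists_eq_succ_of_ne_zero (NeZero.ne n)
  set N : Matrix ι ι ℂ := Matrix.of fun i j => M i (e j) with hN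
  have key : ∀ m a a', infPow Q (m + 1) a a' =
      ∑ i, if e i = a then ∑ k, (N ^ m) i k * M k a' else 0 := by
    intro m
    induction m with
    | zero =>
      intro a a'
      change ∑ᶠ b, (if a = b then (1 : ℂ) else 0) * Q b a' = _
      rw [finsum_eq_single _ a fun b hb => by rw [if_neg hb.symm, zero_mul], if_pos rfl, one_mul, hQ]
      refine Finset.sum_congr rfl fun i _ => ?_
      rw [pow_zero, Finset.sum_eq_single i]
      · simp
      · intro k _ hk; rw [Matrix.one_apply_ne hk.symm, zero_mul]
      · simp
    | succ m ih =>
      intro a a'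
      change ∑ᶠ b, infPow Q (m + 1) a b * Q b a' = _
      rw [finsum_congr fun b => by rw [hQ], finsum_mul_ite e _ fun i _ => M i a']
      rw [Finset.sum_congr rfl fun k _ => by rw [ih, Finset.sum_mul], Finset.sum_comm]
      refine Finset.sum_congr rfl fun i _ => ?_
      split_ifs
      · refine Finset.sum_congr rfl fun k _ => ?_
        rw [pow_succ, Matrix.mul_apply]
        rfl
      · simp
  have h : ∀ a, infPow Q (m + 1) a a = 1 * ∑ i, if e i = a then ∑ k, (N ^ m) i k * M k a else 0 := by
    intro a; rw [one_mul, key]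
  rw [infTrace, finsum_congr h, finsum_mul_ite e (fun _ => 1), Matrix.trace]
  refine Finset.sum_congr rfl fun i _ => ?_
  rw [one_mul, Matrix.diag_apply, pow_succ, Matrix.mul_apply]
  rfl

end Trace

/-- Expand the product and shift the second factors cyclically, so that the factor with index `j`
depends on the variable `j` alone; this separates the variables for Fubini. -/
theorem prod_cyclic_sum {ι : Type*} [Fintype ι] [DecidableEq ι] {n : ℕ} [NeZero n]
    (A B : ι → Fin n → ℂ) :
    ∏ j : Fin n, ∑ r, A r j * B r (j + 1) =
      ∑ ρ : Fin n → ι, ∏ j : Fin n, A (ρ j) j * B (ρ (j - 1)) j := by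
  have h := Finset.prod_univ_sum (fun _ : Fin n => (Finset.univ : Finset ι))
    (fun j r => A r j * B r (j + 1))
  rw [h, Fintype.piFinset_univ]
  refine Finset.sum_congr rfl fun ρ _ => ?_
  rw [Finset.prod_mul_distrib, Finset.prod_mul_distrib]
  congr 1
  rw [← Equiv.prod_comp (Equiv.addRight (1 : Fin n)) fun j => B (ρ (j - 1)) j]
  simp

namespace RhombusGraph

namespace StraightLinePath

variable {T : RhombusGraph} {F F' : ℂ} {θ₀ : ℝ} {p : T.StraightLinePath F F' θ₀}

section

variable (hT : T.BoundedAngles)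

/-- Coefficients of the zipper matrix. -/
noncomputable def coeff (T : RhombusGraph) (R S : Rhombus) : ℂ :=
  Complex.I * (R.left - R.right) * T.kernel R.white S.black

include hT

open Classical in
theorem zipRatio_eq (b b' : T.Black) : p.zipRatio b b' =
    ∑ R : (finite_zipper (p := p) hT).toFinset,
      if (⟨R.1.black, R.1, ((finite_zipper hT).mem_toFinset.1 R.2).1, rfl⟩ : T.Black) = b then
        Complex.I * (R.1.left - R.1.right) * T.kernel R.1.white b' else 0 := by
  have h1 : p.zipRatio b b' = ∑ R ∈ hT.blackFan b, if R ∈ p.zipper then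
      Complex.I * (R.left - R.right) * T.kernel R.white b' else 0 := by
    rw [zipRatio, hT.invDbar_eq]
    change ∑ᶠ w : T.White, T.dbarOn p.zipper b w * T.kernel w b' = _
    refine hT.finsum_white b _ _ ?_ ?_
    · intro w hw h0
      apply hw
      rw [dbarOn]
      split_ifs
      · rw [h0, zero_mul]
      · rw [zero_mul]
    · intro R hR w hw
      rw [hT.mem_blackFan] at hR
      rw [dbarOn]
      by_cases hz : R ∈ p.zipper
      · rw [if_pos ⟨R, hz, hw, hR.2⟩, if_pos hz, dbar_eq hR.1 b w hR.2 hw, hw]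
      · rw [if_neg hz, if_neg, zero_mul]
        rintro ⟨S, hS, h1, h2⟩
        rw [eq_of_white_black hS.1 hR.1 (h1.trans hw.symm) (h2.trans hR.2.symm)] at hS
        exact hz hS
  rw [h1]
  simp only [Subtype.ext_iff]
  rw [Finset.sum_coe_sort (finite_zipper (p := p) hT).toFinset fun R =>
    if R.black = b then Complex.I * (R.left - R.right) * T.kernel R.white b' else 0,
    ← Finset.sum_filter, ← Finset.sum_filter]
  refine Finset.sum_congr ?_ fun _ _ => rfl
  ext R
  rw [Finset.mem_filter, Finset.mem_filter, hT.mem_blackFan, Set.Finite.mem_toFinset]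
  exact ⟨fun h => ⟨h.2, h.1.2⟩, fun h => ⟨⟨h.1.1, h.2⟩, h.1⟩⟩

theorem trace_zipRatio (n : ℕ) [NeZero n] : infTrace (infPow p.zipRatio n) =
    ∑ ρ : Fin n → (finite_zipper (p := p) hT).toFinset,
      ∏ j : Fin n, coeff T (ρ j).1 (ρ (j + 1)).1 := by
  classical
  have h := infTrace_infPow (fun R : (finite_zipper (p := p) hT).toFinset =>
      (⟨R.1.black, R.1, ((finite_zipper hT).mem_toFinset.1 R.2).1, rfl⟩ : T.Black))
    (fun R b' => Complex.I * (R.1.left - R.1.right) * T.kernel R.1.white b')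
    (Q := p.zipRatio) (fun b b' => by convert zipRatio_eq hT b b') n
  rw [h, trace_pow_eq_sum]
  rfl

/-- The one-variable integrals. -/
theorem integral_zipper (hF : T.IsFace F) {R S : Rhombus} (hR : R ∈ p.zipper)
    (hS : S ∈ p.zipper) :
    IntegrableOn (fun t : ℝ => T.expAt R.white S.black (t * (-Complex.I * Complex.exp (θ₀ * Complex.I))))
      (Set.Ioi 0) ∧
    ∫ t in Set.Ioi (0 : ℝ), T.expAt R.white S.black (t * (-Complex.I * Complex.exp (θ₀ * Complex.I))) *
      (-Complex.I * Complex.exp (θ₀ * Complex.I)) = 2 * Real.pi * T.kernel R.white S.black := by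
  obtain ⟨s, hs, hpos, hτ⟩ := exists_half_plane hT hF.isVertex hR hS
  have hw : T.IsWhite R.white := ⟨R, hR.1, rfl⟩
  have hb : T.IsBlack S.black := ⟨S, hS.1, rfl⟩
  have hτ1 : ‖Complex.I * Complex.exp (θ₀ * Complex.I)‖ = 1 := by
    rw [norm_mul, Complex.norm_I, one_mul, Complex.norm_exp_ofReal_mul_I]
  rw [neg_mul]
  constructor
  · exact integrableOn_expEval_ray (fun _ => hT.norm_of_exponents_ne_zero hw.isVertex hb.isVertex)
      (hT.degree_white_black hw hb) (by rw [norm_neg, hτ1]) (expEval_ray_nonpos hpos hτ)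
  · change rayInt (T.exponents R.white S.black) _ = _
    rw [hT.kernel_eq hw hb hs hτ1 hpos hτ]
    have : (Real.pi : ℂ) ≠ 0 := by exact_mod_cast Real.pi_ne_zero
    generalize rayInt _ _ = X
    field_simp

/-- Almost everywhere on the orthant the integrand is a sum of products over closed paths in the
zipper. -/
theorem rayPullback_ae (hF : T.IsFace F) (hF' : T.IsFace F') (n : ℕ) [NeZero n] :
    rayPullback (-Complex.I * Complex.exp (θ₀ * Complex.I)) n
        (cyclicIntegrand (T.discreteExp F F') n) =ᵐ[Measure.pi fun _ : Fin n =>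
          volume.restrict (Set.Ioi (0 : ℝ))]
      fun t => ∑ ρ : Fin n → (finite_zipper (p := p) hT).toFinset, ∏ j : Fin n,
        Complex.I * (Complex.I * ((ρ j).1.left - (ρ j).1.right)) *
          (T.expAt (ρ (j - 1)).1.white (ρ j).1.black
            (t j * (-Complex.I * Complex.exp (θ₀ * Complex.I))) *
              (-Complex.I * Complex.exp (θ₀ * Complex.I))) := by
  classical
  set u := -Complex.I * Complex.exp (θ₀ * Complex.I) with hu
  have hu1 : ‖u‖ = 1 := by
    rw [hu, norm_mul, norm_neg, Complex.norm_I, one_mul, Complex.norm_exp_ofReal_mul_I]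
  -- The formula for the cyclic kernel is available off the unit circle, which each ray meets in one
  -- point.
  have hone : ∀ᵐ t : ℝ ∂(volume.restrict (Set.Ioi (0 : ℝ))), ‖(t : ℂ) * u‖ ≠ 1 := by
    have h1 : ∀ᵐ t : ℝ ∂(volume.restrict (Set.Ioi (0 : ℝ))), t ≠ 1 :=
      ae_restrict_of_ae (Measure.ae_ne volume 1)
    filter_upwards [h1, ae_restrict_mem measurableSet_Ioi] with t h1 h2
    rwa [norm_mul, hu1, mul_one, Complex.norm_real, Real.norm_of_nonneg (le_of_lt h2)]
  have hall : ∀ᵐ t : Fin n → ℝ ∂(Measure.pi fun _ : Fin n => volume.restrict (Set.Ioi (0 : ℝ))),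
      ∀ j, ‖(t j : ℂ) * u‖ ≠ 1 :=
    ae_all_iff.2 fun j => (Measure.tendsto_eval_ae_ae
      (μ := fun _ : Fin n => volume.restrict (Set.Ioi (0 : ℝ))) (i := j)).eventually hone
  filter_upwards [hall] with t ht
  have hZ : ∀ R : (finite_zipper (p := p) hT).toFinset, R.1 ∈ p.zipper := fun R =>
    (finite_zipper hT).mem_toFinset.1 R.2
  have hker : ∀ j : Fin n, cyclicKernel (T.discreteExp F F') (t j * u) (t (j + 1) * u) =
      ∑ R : (finite_zipper (p := p) hT).toFinset,
        (Complex.I * (Complex.I * (R.1.left - R.1.right)) * T.expAt F R.1.black (t j * u)) *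
          T.expAt R.1.white F (t (j + 1) * u) := by
    intro j
    have h := sum_zipperTerm (p := p) hT hF hF' (ht j) (ht (j + 1))
    have h2 : cyclicKernel (T.discreteExp F F') (t j * u) (t (j + 1) * u) =
        Complex.I * (-Complex.I * cyclicKernel (T.discreteExp F F') (t j * u) (t (j + 1) * u)) := by
      generalize cyclicKernel _ _ _ = k
      linear_combination k * Complex.I_mul_I
    rw [h2, ← h, ← Finset.sum_coe_sort, Finset.mul_sum]
    refine Finset.sum_congr rfl fun R _ => ?_
    rw [zipperTerm]
    ring
  rw [rayPullback, cyclicIntegrand, Finset.prod_congr rfl fun j _ => hker j,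
    prod_cyclic_sum (fun (R : (finite_zipper (p := p) hT).toFinset) (j : Fin n) =>
      Complex.I * (Complex.I * (R.1.left - R.1.right)) * T.expAt F R.1.black (t j * u))
    (fun R j => T.expAt R.1.white F (t j * u)), Finset.sum_mul]
  refine Finset.sum_congr rfl fun ρ _ => ?_
  have hun : u ^ n = ∏ _j : Fin n, u := by simp
  rw [hun, ← Finset.prod_mul_distrib]
  refine Finset.prod_congr rfl fun j _ => ?_
  rw [← hT.expAt_mul ⟨_, (hZ (ρ (j - 1))).1, Rhombus.isCorner_white _⟩ hF.isVertex
    ⟨_, (hZ (ρ j)).1, Rhombus.isCorner_black _⟩ (ht j)]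
  ring

/-- Almost everywhere the integrand is a finite sum of products of one-variable functions that are
integrable along the ray. Each factor integrates to 2πi times ∂̄(b,w) for one edge and the kernel
from the preceding white corner, and the resulting sum is the expansion of the trace. -/
theorem integrable_and_trace (hF : T.IsFace F) (hF' : T.IsFace F') (n : ℕ) [NeZero n] :
    IntegrableOn (rayPullback (-Complex.I * Complex.exp (θ₀ * Complex.I)) n
        (cyclicIntegrand (T.discreteExp F F') n)) (orthant n) ∧
    rayIntegral (-Complex.I * Complex.exp (θ₀ * Complex.I)) n
        (cyclicIntegrand (T.discreteExp F F') n) =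
      (2 * Real.pi * Complex.I) ^ n * infTrace (infPow p.zipRatio n) := by
  have hZ : ∀ R : (finite_zipper (p := p) hT).toFinset, R.1 ∈ p.zipper := fun R =>
    (finite_zipper hT).mem_toFinset.1 R.2
  have hae := rayPullback_ae (p := p) hT hF hF' n
  have hmeas : (volume.restrict (orthant n) : Measure (Fin n → ℝ)) =
      Measure.pi fun _ : Fin n => volume.restrict (Set.Ioi (0 : ℝ)) := by
    rw [orthant, volume_pi, Measure.restrict_pi_pi]
  have hint : ∀ ρ : Fin n → (finite_zipper (p := p) hT).toFinset, Integrable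
      (fun t : Fin n → ℝ => ∏ j : Fin n,
        Complex.I * (Complex.I * ((ρ j).1.left - (ρ j).1.right)) *
          (T.expAt (ρ (j - 1)).1.white (ρ j).1.black
            (t j * (-Complex.I * Complex.exp (θ₀ * Complex.I))) *
              (-Complex.I * Complex.exp (θ₀ * Complex.I))))
      (Measure.pi fun _ : Fin n => volume.restrict (Set.Ioi (0 : ℝ))) := by
    intro ρ
    refine Integrable.fintype_prod (f := fun (j : Fin n) (t : ℝ) =>
      Complex.I * (Complex.I * ((ρ j).1.left - (ρ j).1.right)) *
          (T.expAt (ρ (j - 1)).1.white (ρ j).1.black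
            (t * (-Complex.I * Complex.exp (θ₀ * Complex.I))) *
              (-Complex.I * Complex.exp (θ₀ * Complex.I)))) fun j => ?_
    exact ((integral_zipper hT hF (hZ _) (hZ _)).1.mul_const _).const_mul _
  constructor
  · rw [IntegrableOn, hmeas]
    exact (integrable_congr hae).2 (integrable_finsetSum _ fun ρ _ => hint ρ)
  · rw [rayIntegral, hmeas, integral_congr_ae hae, integral_finsetSum _ fun ρ _ => hint ρ,
      trace_zipRatio hT, Finset.mul_sum]
    refine Finset.sum_congr rfl fun ρ _ => ?_
    rw [integral_fintype_prod_eq_prod fun (j : Fin n) (t : ℝ) =>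
      Complex.I * (Complex.I * ((ρ j).1.left - (ρ j).1.right)) *
          (T.expAt (ρ (j - 1)).1.white (ρ j).1.black
            (t * (-Complex.I * Complex.exp (θ₀ * Complex.I))) *
              (-Complex.I * Complex.exp (θ₀ * Complex.I)))]
    have h1 : ∀ j : Fin n, ∫ t in Set.Ioi (0 : ℝ),
        Complex.I * (Complex.I * ((ρ j).1.left - (ρ j).1.right)) *
          (T.expAt (ρ (j - 1)).1.white (ρ j).1.black
            (t * (-Complex.I * Complex.exp (θ₀ * Complex.I))) *
              (-Complex.I * Complex.exp (θ₀ * Complex.I))) =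
        2 * Real.pi * Complex.I * (Complex.I * ((ρ j).1.left - (ρ j).1.right)) *
          T.kernel (ρ (j - 1)).1.white (ρ j).1.black := by
      intro j
      rw [integral_const_mul, (integral_zipper hT hF (hZ _) (hZ _)).2]
      ring
    rw [Finset.prod_congr rfl fun j _ => h1 j, Finset.prod_mul_distrib, Finset.prod_mul_distrib]
    simp only [coeff]
    -- Undoes the cyclic shift: the kernel between edges `j - 1` and `j` becomes the one between `j`
    -- and `j + 1`.
    rw [← Equiv.prod_comp (Equiv.addRight (1 : Fin n)) fun j =>
      T.kernel (ρ (j - 1)).1.white (ρ j).1.black]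
    simp only [Finset.prod_const, Finset.card_univ, Fintype.card_fin, Equiv.coe_addRight,
      add_sub_cancel_right, Finset.prod_mul_distrib]
    ring

end

end StraightLinePath

end RhombusGraph

theorem corollary1 (T : RhombusGraph) (hT : T.BoundedAngles) (F F' : ℂ)
    (hF : T.IsFace F) (hF' : T.IsFace F') (D θ₀ : ℝ) (hD : 0 < D)
    (hFF' : F' - F = (D : ℂ) * Complex.exp (θ₀ * Complex.I))
    (p : T.StraightLinePath F F' θ₀) (n : ℕ) [NeZero n] :
    MeasureTheory.IntegrableOn
      (rayPullback (-Complex.I * Complex.exp (θ₀ * Complex.I)) n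
        (cyclicIntegrand (T.discreteExp F F') n)) (orthant n) ∧
    infTrace (infPow p.zipRatio n) =
      1 / (2 * (Real.pi : ℂ) * Complex.I) ^ n *
        rayIntegral (-Complex.I * Complex.exp (θ₀ * Complex.I)) n
          (cyclicIntegrand (T.discreteExp F F') n) := by
  obtain ⟨h1, h2⟩ := RhombusGraph.StraightLinePath.integrable_and_trace (p := p) hT hF hF' n
  refine ⟨h1, ?_⟩
  have h3 : (2 * (Real.pi : ℂ) * Complex.I) ^ n ≠ 0 := pow_ne_zero _ (by
    have : (Real.pi : ℂ) ≠ 0 := by exact_mod_cast Real.pi_ne_zero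
    simp [this])
  rw [h2, one_div, inv_mul_cancel_left₀ h3]
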